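/- **Setting.** Let $\mathcal B=\{X\in\mathbb R^3:|X|\le 1\}$, $\bar\rho>0$, $G\in\mathbb R$, $0<T\le\infty$, and let $GL_+(3,\mathbb R)$ be the set of real $3\times3$ matrices with positive determinant. Let $\widehat{S}:GL_+(3,\mathbb R)\to\mathbb R^{3\times 3}$ be $C^1$ and let $W:GL_+(3,\mathbb R)\to\mathbb R$ be a differentiable strain-energy function with $\widehat S=\bar\rho\,\partial W/\partial F$ (the body is hyperelastic and homogeneous), such that for all $F\in GL_+(3,\mathbb R)$, $O\in SO(3)$ and $\sigma>0$ $$W(OF)=W(F)\ \text{(objective)},\qquad W(FO)=W(F)\ \text{(isotropic)},\qquad W(\sigma F)=\sigma^{-1}W(F)\ \text{(homogeneous of degree } -1).$$ For a unit vector $\omega\in\mathbb R^3$ put $g(y)=\bar\rho^{-1/3}\,W\big(I+(y-1)\,\omega\otimes\omega\big)$, $y>0$. **The system.** A classical solution on $[0,T)$, with flow map $x$, of the self-gravitating elastic system with solid vacuum boundary condition consists of a density $\rho(t,\cdot)\ge0$ on $\mathbb R^3$, with $\mathcal B(t)=\operatorname{supp}\rho(t)$, and a velocity field $\mathbf u(t,\cdot)$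 on $\mathcal B(t)$, such that $\rho$, $\mathbf u$ and the Cauchy stress $\mathsf T$ below are $C^1$ (up to the boundary) on $\{(t,z):t\in[0,T),\,z\in\mathcal B(t)\}$ and such that for every $t\in[0,T)$: * $x(t,\cdot):\mathcal B\to\mathcal B(t)$ is an orientation-preserving $C^1$ diffeomorphism, $x$ is $C^2$ in time, and $\dot x(t,X)=\mathbf u(t,x(t,X))$ and $\rho(t,x(t,X))\det Dx(t,X)=\bar\rho$ for all $X\in\mathcal B$; * the Cauchy stress satisfies $\det Dx\;\mathsf T(t,x(t,X))\,Dx^{-T}=\widehat S(Dx)$, with $Dx=Dx(t,X)$, for all $X\in\mathcal B$; * $\partial_t\rho+\operatorname{div}(\rho\mathbf u)=0$ and $\rho(\partial_t\mathbf u+\mathbf u\cdot\nabla\mathbf u)=\operatorname{div}\mathsf T-G\rho\nabla\Phi$ in $\mathcal B(t)$; * $\Phi=\Phi[\rho(t)]\in C^1(\mathbb R^3)\cap C^2(\mathbb R^3\setminus\partial\mathcal B(t))$, $\Delta\Phi=4\pi\rho(t)$ in $\mathbb R^3\setminus\partial\mathcal B(t)$, and $\Phi(z)\to0$ as $|z|\to\infty$;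 * $\mathsf T(t,z)\,\mathbf n(z)=0$ for $z\in\partial\mathcal B(t)$, where $\mathbf n$ is the outward unit normal to $\partial\mathcal B(t)$. **Proposition 1.1.** Let $\varphi:[0,T)\times[0,1]\to\mathbb R$ be $C^2$ (up to the boundary), with $\varphi(t,0)=\varphi_{RR}(t,0)=0$ and $\varphi_R(t,R)>0$ for all $t\in[0,T)$, $R\in[0,1]$. Let $\Lambda(t,R)=\varphi(t,R)/R$ for $R\in(0,1]$, $\Lambda(t,0)=\varphi_R(t,0)$, and $y=\varphi_R/\Lambda$. Assume that for all $t\in[0,T)$ and $R\in(0,1]$ $$\varphi_{tt}-\bar\rho^{\frac13}\left[\frac1{R^2\varphi}\,\partial_R\!\left(\frac{R^4}{\varphi}\,g'(y)\right)+\frac{R}{\varphi^2}\,g(y)\right]+\frac{4\pi}{3}R^3G\bar\rho\,\varphi^{-2}=0,$$ and that $g'(y(t,1))=0$ for all $t\in[0,T)$. Then there is a pair $(\rho,\mathbf u)$ which is a classical solution of the system above on $[0,T)$ with flow map $x(t,X)=\varphi(t,|X|)\,X/|X|$ (where $x(t,0)=0$). In particular $\rho(t,x(t,X))\det Dx(t,X)=\bar\rho$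 and $\dot x(t,X)=\mathbf u(t,x(t,X))$ for all $t\in[0,T)$, $X\in\mathcal B$. -/

import Mathlib

open Set Filter Topology
open scoped Matrix

/- The smoothness notions for matrix-valued maps below do not depend on the choice of a norm on the
finite-dimensional space of matrices; the Frobenius norm is used throughout. -/
attribute [local instance] Matrix.frobeniusNormedAddCommGroup Matrix.frobeniusNormedSpace

noncomputable section

namespace SelfGravElastic

/-- Physical space `ℝ³` with its Euclidean norm. -/
abbrev Space : Type := EuclideanSpace ℝ (Fin 3)

/-- Real `3 × 3` matrices. -/
abbrev Mat : Type := Matrix (Fin 3) (Fin 3) ℝ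

/-- The `i`-th standard basis vector of `ℝ³`. -/
def stdVec (i : Fin 3) : Space := EuclideanSpace.single i (1 : ℝ)

/-- The time interval `[0, T)`, where `T` may be infinite. -/
def timeInterval (T : EReal) : Set ℝ := {t : ℝ | 0 ≤ t ∧ (t : EReal) < T}

/-- The reference body: the closed unit ball. -/
def refBody : Set Space := Metric.closedBall 0 1

/-! ### Constitutive theory -/

/-- `GL₊(3, ℝ)` as a set of matrices. -/
def GLPos : Set Mat := {F | 0 < F.det}

/-- The body with reference density `ρbar` is hyperelastic and homogeneous: the Piola–Kirchhoff
response is a `C¹` function `Shat` of the deformation gradient alone, and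
`Shat F = ρbar • ∂W/∂F` on `GL₊(3, ℝ)` for a strain energy `W`, also a function of `F` alone.
Values of `W` and `Shat` outside `GL₊(3, ℝ)` are irrelevant. -/
structure IsHyperelastic (ρbar : ℝ) (W : Mat → ℝ) (Shat : Mat → Mat) : Prop where
  contDiffOn_response : ContDiffOn ℝ 1 Shat GLPos
  differentiableAt_energy : ∀ F ∈ GLPos, DifferentiableAt ℝ W F
  response_eq : ∀ F ∈ GLPos, ∀ i j : Fin 3,
    Shat F i j = ρbar * fderiv ℝ W F (Matrix.single i j 1)

/-- Objectivity (frame indifference) of the strain energy. -/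
def IsObjective (W : Mat → ℝ) : Prop :=
  ∀ F ∈ GLPos, ∀ O ∈ Matrix.specialOrthogonalGroup (Fin 3) ℝ, W F = W (O * F)

/-- Isotropy of the strain energy. -/
def IsIsotropic (W : Mat → ℝ) : Prop :=
  ∀ F ∈ GLPos, ∀ O ∈ Matrix.specialOrthogonalGroup (Fin 3) ℝ, W F = W (F * O)

/-- Homogeneity of degree `h` of the strain energy. -/
def IsHomogeneousOfDegree (h : ℝ) (W : Mat → ℝ) : Prop :=
  ∀ σ : ℝ, 0 < σ → ∀ F ∈ GLPos, W (σ • F) = σ ^ h * W F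

/-- `g(y) = ρbar^(-1/3) W(I + (y - 1) ω ⊗ ω)`, for a unit vector `ω`. -/
def energyProfile (ρbar : ℝ) (W : Mat → ℝ) (ω : Space) (y : ℝ) : ℝ :=
  ρbar ^ (-(1 / 3) : ℝ) * W (1 + (y - 1) • Matrix.of fun i j => ω i * ω j)

/-! ### Space-time calculus on a (non-open) space-time domain -/

/-- `∂ₜ f (t, z)` for a function that is considered on the space-time domain `Ω` only
(one-sided at boundary points of `Ω`). -/
def timeDeriv (Ω : Set (ℝ × Space)) (f : ℝ → Space → ℝ) (t : ℝ) (z : Space) : ℝ :=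
  fderivWithin ℝ (fun p : ℝ × Space => f p.1 p.2) Ω (t, z) (1, 0)

/-- `∂ⱼ f (t, z)` for a function that is considered on the space-time domain `Ω` only. -/
def spaceDeriv (Ω : Set (ℝ × Space)) (j : Fin 3) (f : ℝ → Space → ℝ) (t : ℝ) (z : Space) : ℝ :=
  fderivWithin ℝ (fun p : ℝ × Space => f p.1 p.2) Ω (t, z) (0, stdVec j)

/-- The body `B(t) = supp ρ(t)` at time `t` (closed support). -/
def body (ρ : ℝ → Space → ℝ) (t : ℝ) : Set Space := tsupport (ρ t)

/-- The space-time region `{(t, z) : t ∈ I, z ∈ B(t)}` that the body occupies. -/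
def worldTube (I : Set ℝ) (ρ : ℝ → Space → ℝ) : Set (ℝ × Space) :=
  {p | p.1 ∈ I ∧ p.2 ∈ body ρ p.1}

/-! ### Flow map -/

/-- The deformation gradient `Dx(t, X)`, `(Dx)ᵢⱼ = ∂xᵢ/∂Xⱼ`, of a motion of the reference body. -/
def deformationGradient (x : ℝ → Space → Space) (t : ℝ) (X : Space) : Mat :=
  Matrix.of fun i j => fderivWithin ℝ (x t) refBody X (stdVec j) i

/-- `x` is a flow map of `(ρ, u)` on the time interval `I`: for every `t ∈ I`, `x(t, ·)` is an
orientation-preserving `C¹` diffeomorphism of the reference body onto `B(t)`; `x` is `C²` in time;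
`∂ₜ x(t, X) = u(t, x(t, X))` and `ρ(t, x(t, X)) det Dx(t, X) = ρbar`. -/
structure IsFlowMap (ρbar : ℝ) (I : Set ℝ) (ρ : ℝ → Space → ℝ) (u : ℝ → Space → Space)
    (x : ℝ → Space → Space) : Prop where
  bijOn : ∀ t ∈ I, BijOn (x t) refBody (body ρ t)
  contDiffOn : ∀ t ∈ I, ContDiffOn ℝ 1 (x t) refBody
  contDiffOn_inverse : ∀ t ∈ I, ∃ Y : Space → Space,
    ContDiffOn ℝ 1 Y (body ρ t) ∧ LeftInvOn Y (x t) refBody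
  orientation : ∀ t ∈ I, ∀ X ∈ refBody, 0 < (deformationGradient x t X).det
  contDiffOn_time : ∀ X ∈ refBody, ContDiffOn ℝ 2 (fun t => x t X) I
  velocity : ∀ t ∈ I, ∀ X ∈ refBody,
    HasDerivWithinAt (fun s => x s X) (u t (x t X)) I t
  density : ∀ t ∈ I, ∀ X ∈ refBody, ρ t (x t X) * (deformationGradient x t X).det = ρbar

/-! ### The Eulerian system -/

/-- `Φ` is the gravitational potential of the mass density `ϱ`: `ΔΦ = 4πϱ` and `Φ → 0` at infinity.
As `ϱ` jumps across the boundary of its support, the equation is understood classically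
in the interior and in the exterior of the support, with `Φ` and `∇Φ` continuous on all of `ℝ³`
(so that there is no mass layer on the boundary). -/
structure IsGravitationalPotential (ϱ : Space → ℝ) (Φ : Space → ℝ) : Prop where
  contDiff : ContDiff ℝ 1 Φ
  contDiffOn : ContDiffOn ℝ 2 Φ (frontier (tsupport ϱ))ᶜ
  poisson : ∀ z ∈ (frontier (tsupport ϱ))ᶜ, Laplacian.laplacian Φ z = 4 * Real.pi * ϱ z
  decay : Tendsto Φ (cocompact Space) (𝓝 0)

/-- `n` is an outward unit normal vector to the set `D` at its point `z`: it makes no acute angle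
with any direction of the (one-sided) tangent cone of `D` at `z`. -/
def IsOutwardUnitNormal (D : Set Space) (z n : Space) : Prop :=
  ‖n‖ = 1 ∧ ∀ v ∈ posTangentConeAt D z, inner ℝ n v ≤ 0

/-- `(ρ, u)`, with flow map `x`, Cauchy stress `τ` and gravitational potentials `Φ(t) = Φ[ρ(t)]`, is
a classical solution on the time interval `I` of the equations of motion of a self-gravitating
elastic body surrounded by vacuum, with solid vacuum boundary condition. The body has the
Piola–Kirchhoff response function `Shat` relative to the reference body with density `ρbar`. -/
structure IsClassicalSolutionWith (G ρbar : ℝ) (Shat : Mat → Mat) (I : Set ℝ)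
    (ρ : ℝ → Space → ℝ) (u : ℝ → Space → Space) (x : ℝ → Space → Space)
    (τ : ℝ → Space → Mat) (Φ : ℝ → Space → ℝ) : Prop where
  flow : IsFlowMap ρbar I ρ u x
  /-- `ρ`, `u` and the stress are `C¹` on the closed space-time region of the body. -/
  contDiffOn_density : ContDiffOn ℝ 1 (fun p : ℝ × Space => ρ p.1 p.2) (worldTube I ρ)
  contDiffOn_velocity : ContDiffOn ℝ 1 (fun p : ℝ × Space => u p.1 p.2) (worldTube I ρ)
  contDiffOn_stress : ∀ i j : Fin 3,
    ContDiffOn ℝ 1 (fun p : ℝ × Space => τ p.1 p.2 i j) (worldTube I ρ)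
  density_nonneg : ∀ t ∈ I, ∀ z, 0 ≤ ρ t z
  /-- The Piola–Kirchhoff stress `S = J τ(t, x) Dx⁻ᵀ` is `Shat(Dx)`. -/
  constitutive : ∀ t ∈ I, ∀ X ∈ refBody,
    (deformationGradient x t X).det • (τ t (x t X) * ((deformationGradient x t X)⁻¹)ᵀ)
      = Shat (deformationGradient x t X)
  /-- `∂ₜρ + div(ρu) = 0` in `B(t)`. -/
  continuity_equation : ∀ t ∈ I, ∀ z ∈ body ρ t,
    timeDeriv (worldTube I ρ) ρ t z
      + ∑ j, spaceDeriv (worldTube I ρ) j (fun s w => ρ s w * u s w j) t z = 0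
  /-- `ρ(∂ₜu + u·∇u) = div τ - Gρ∇Φ` in `B(t)`. -/
  momentum_equation : ∀ t ∈ I, ∀ z ∈ body ρ t, ∀ i : Fin 3,
    ρ t z * (timeDeriv (worldTube I ρ) (fun s w => u s w i) t z
        + ∑ j, u t z j * spaceDeriv (worldTube I ρ) j (fun s w => u s w i) t z)
      = ∑ j, spaceDeriv (worldTube I ρ) j (fun s w => τ s w i j) t z
        - G * ρ t z * fderiv ℝ (Φ t) z (stdVec i)
  /-- `ΔΦ[ρ(t)] = 4πρ(t)`, `Φ[ρ(t)] → 0` at infinity. -/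
  potential : ∀ t ∈ I, IsGravitationalPotential (ρ t) (Φ t)
  /-- `τ n = 0` on `∂B(t)`. -/
  boundary_condition : ∀ t ∈ I, ∀ z ∈ frontier (body ρ t), ∀ n : Space,
    IsOutwardUnitNormal (body ρ t) z n → ∀ i : Fin 3, ∑ j, τ t z i j * n j = 0

/-- `(ρ, u)` is a classical solution, with flow map `x`. -/
def IsClassicalSolution (G ρbar : ℝ) (Shat : Mat → Mat) (I : Set ℝ)
    (ρ : ℝ → Space → ℝ) (u : ℝ → Space → Space) (x : ℝ → Space → Space) : Prop :=
  ∃ (τ : ℝ → Space → Mat) (Φ : ℝ → Space → ℝ),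
    IsClassicalSolutionWith G ρbar Shat I ρ u x τ Φ

/-! ### Spherically symmetric motions -/

/-- The radial motion `x(t, X) = φ(t, |X|) X/|X|` (equal to `0` at `X = 0`). -/
def radialMotion (φ : ℝ → ℝ → ℝ) (t : ℝ) (X : Space) : Space :=
  (φ t ‖X‖ / ‖X‖) • X

/-- `φ_R(t, R)`, one-sided at the end points of `[0, 1]`. -/
def radialDeriv (φ : ℝ → ℝ → ℝ) (t R : ℝ) : ℝ := derivWithin (φ t) (Icc 0 1) R

/-- `φ_RR(t, R)`, one-sided at the end points of `[0, 1]`. -/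
def radialDeriv2 (φ : ℝ → ℝ → ℝ) (t R : ℝ) : ℝ := derivWithin (radialDeriv φ t) (Icc 0 1) R

/-- `φ_tt(t, R)`, one-sided at `t = 0`. -/
def accel (I : Set ℝ) (φ : ℝ → ℝ → ℝ) (t R : ℝ) : ℝ :=
  derivWithin (fun s => derivWithin (fun s' => φ s' R) I s) I t

/-- `Λ = φ/R` for `R > 0`, and `Λ(t, 0) = φ_R(t, 0)`. -/
def stretch (φ : ℝ → ℝ → ℝ) (t R : ℝ) : ℝ :=
  if R = 0 then radialDeriv φ t 0 else φ t R / R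

/-- `y = φ_R / Λ`. -/
def stretchRatio (φ : ℝ → ℝ → ℝ) (t R : ℝ) : ℝ := radialDeriv φ t R / stretch φ t R

/-- The Lagrangian equation of motion and boundary condition for `φ` on `I × [0, 1]`; the equation
has its singular point `R = 0` left out. -/
structure SolvesRadialSystem (G ρbar : ℝ) (g : ℝ → ℝ) (I : Set ℝ) (φ : ℝ → ℝ → ℝ) : Prop where
  equation : ∀ t ∈ I, ∀ R ∈ Ioc (0 : ℝ) 1,
    accel I φ t R
      - ρbar ^ (1 / 3 : ℝ) *
          (1 / (R ^ 2 * φ t R) *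
              derivWithin (fun r => r ^ 4 / φ t r * deriv g (stretchRatio φ t r)) (Icc 0 1) R
            + R / φ t R ^ 2 * g (stretchRatio φ t R))
      + 4 * Real.pi / 3 * R ^ 3 * G * ρbar / φ t R ^ 2 = 0
  boundary : ∀ t ∈ I, deriv g (stretchRatio φ t 1) = 0

end SelfGravElastic

end

/-! Everything reduces to scalar functions of (t, R). With e = X/|X|, the gradient Dx has eigenvalue
φ_R along e and Λ = φ/R across e (`deformationGradient_eq`). Objectivity and isotropy make `W`
invariant, hence `Shat` equivariant, under conjugation by rotations, so `Shat` of such a matrix has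
the same axial form (`response_axialMatrix`). Its axial value at stretches (y, 1) is ρbar^(4/3)
g'(y), because g is the energy along the axial stretch (`axialStress_eq`). Euler's identity in
degree -1 then yields the transversal value (`transversalStress_eq`), and homogeneity restores the
scale Λ (`response_axialMatrix'`). The Cauchy stress becomes b I + (a - b) e ⊗ e with a, b explicit
in Λ and φ_R.

Eulerian fields are fields on the reference body composed with the inverse of (t, X) ↦ (t, x(t, X)).
That inverse is C¹ up to the boundary (`contDiffOn_spaceTimeInverse`), so every Eulerian derivative
is a chain rule. The density ρbar/(Λ² φ_R) satisfies the continuity equation because div u is the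
logarithmic time derivative of Λ² φ_R (`continuity`). The acceleration is φ_tt e
(`material_acceleration`), and div T = (a_R/φ_R + 2(a - b)/φ) e (`divergence_stress`). The
gravitational field is P(z) z, with P = (4π/3) ρbar Λ⁻³ inside the body and Newtonian outside
(`exists_gravitationalPotential`). The momentum balance is then the radial equation multiplied by
the density (`momentum_radial`), and g'(y) = 0 at R = 1 says that the normal stress a vanishes on
the boundary.

The delicate point is the centre, where e is discontinuous. Since φ and φ_RR vanish at R = 0, Λ is
C¹ with Λ_R(t, 0) = 0 (`HasRadialFDeriv2.radialQuotient`), so C¹ functions of the two stretches are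
C¹ in X. Moreover a - b vanishes at the centre by isotropy, together with its radial derivative,
which makes (a - b) e ⊗ e a C¹ field. At X = 0, where no radial equation is imposed, both sides of
the momentum balance vanish by symmetry. -/

namespace SelfGravElastic

/-! ### Axial matrices and the rotations that carry one axis to another. -/

/-- The matrix with eigenvalue `a` in the direction of the unit vector `e` and eigenvalue `b`
on its orthogonal complement. -/
def axialMatrix (a b : ℝ) (e : Space) : Mat :=
  b • (1 : Mat) + (a - b) • Matrix.of fun i j => e i * e j

lemma axialMatrix_apply (a b : ℝ) (e : Space) (i j : Fin 3) :
    axialMatrix a b e i j = b * (1 : Mat) i j + (a - b) * (e i * e j) := by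
  simp [axialMatrix]

lemma axialMatrix_self (a : ℝ) (e : Space) : axialMatrix a a e = a • (1 : Mat) := by
  simp [axialMatrix]

lemma sum_sq_eq_one {e : Space} (he : ‖e‖ = 1) : e 0 ^ 2 + e 1 ^ 2 + e 2 ^ 2 = 1 := by
  have := EuclideanSpace.real_norm_sq_eq e
  rw [he, Fin.sum_univ_three] at this
  linarith

lemma axialMatrix_det (a b : ℝ) {e : Space} (he : ‖e‖ = 1) :
    (axialMatrix a b e).det = b ^ 2 * a := by
  have h := sum_sq_eq_one he
  simp only [Matrix.det_fin_three, axialMatrix_apply]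
  simp
  linear_combination (b ^ 2 * (a - b)) * h

lemma axialMatrix_mul (a b a' b' : ℝ) {e : Space} (he : ‖e‖ = 1) :
    axialMatrix a b e * axialMatrix a' b' e = axialMatrix (a * a') (b * b') e := by
  have h := sum_sq_eq_one he
  ext i j
  simp only [Matrix.mul_apply, Fin.sum_univ_three, axialMatrix_apply]
  fin_cases i <;> fin_cases j <;> simp [Matrix.one_apply] <;>
    first
    | linear_combination (a - b) * (a' - b') * e 0 * e 0 * h
    | linear_combination (a - b) * (a' - b') * e 0 * e 1 * h
    | linear_combination (a - b) * (a' - b') * e 0 * e 2 * h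
    | linear_combination (a - b) * (a' - b') * e 1 * e 1 * h
    | linear_combination (a - b) * (a' - b') * e 1 * e 2 * h
    | linear_combination (a - b) * (a' - b') * e 2 * e 2 * h

lemma axialMatrix_transpose (a b : ℝ) (e : Space) : (axialMatrix a b e)ᵀ = axialMatrix a b e := by
  ext i j
  simp only [Matrix.transpose_apply, axialMatrix_apply, Matrix.one_apply, mul_comm (e j),
    eq_comm (a := j)]

lemma axialMatrix_inv {a b : ℝ} (ha : a ≠ 0) (hb : b ≠ 0) {e : Space} (he : ‖e‖ = 1) :
    (axialMatrix a b e)⁻¹ = axialMatrix a⁻¹ b⁻¹ e := by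
  apply Matrix.inv_eq_right_inv
  rw [axialMatrix_mul _ _ _ _ he, mul_inv_cancel₀ ha, mul_inv_cancel₀ hb, axialMatrix_self, one_smul]

lemma smul_axialMatrix (c a b : ℝ) (e : Space) :
    c • axialMatrix a b e = axialMatrix (c * a) (c * b) e := by
  ext i j
  simp only [Matrix.smul_apply, axialMatrix_apply, smul_eq_mul]
  ring

lemma axialMatrix_mem_GLPos {a b : ℝ} (ha : 0 < a) (hb : 0 < b) {e : Space} (he : ‖e‖ = 1) :
    axialMatrix a b e ∈ GLPos := by
  rw [GLPos, mem_ofPred_eq, axialMatrix_det _ _ he]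
  positivity

lemma isOpen_GLPos : IsOpen GLPos := by
  have : Continuous fun F : Mat => F.det := by
    have h : ∀ i j : Fin 3, Continuous fun F : Mat => F i j := fun i j =>
      (Matrix.entryLinearMap ℝ ℝ i j).continuous_of_finiteDimensional
    simp only [Matrix.det_fin_three]
    fun_prop
  exact isOpen_lt continuous_const this

lemma norm_stdVec (i : Fin 3) : ‖stdVec i‖ = 1 := by simp [stdVec]

lemma stdVec_apply (i j : Fin 3) : stdVec i j = if j = i then 1 else 0 := by
  simp [stdVec]

/-- The special orthogonal group acts transitively on axes. -/
lemma exists_rotation_axialMatrix {e : Space} (he : ‖e‖ = 1) :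
    ∃ O ∈ Matrix.specialOrthogonalGroup (Fin 3) ℝ, ∀ a b : ℝ,
      O * axialMatrix a b (stdVec 0) * Oᵀ = axialMatrix a b e := by
  have h := sum_sq_eq_one he
  by_cases hp : 1 + e 0 = 0
  -- Here e is the opposite of `stdVec 0`, and an axial matrix does not see the sign of its axis.
  · refine ⟨1, one_mem _, fun a b => ?_⟩
    have h0 : e 0 = -1 := by linarith
    have h1 : e 1 = 0 := by nlinarith [sq_nonneg (e 1), sq_nonneg (e 2)]
    have h2 : e 2 = 0 := by nlinarith [sq_nonneg (e 1), sq_nonneg (e 2)]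
    ext i j
    simp only [one_mul, Matrix.transpose_one, mul_one, axialMatrix_apply, stdVec_apply]
    fin_cases i <;> fin_cases j <;> simp [h0, h1, h2]
  · set p := e 0
    set q := e 1
    set r := e 2
    let s := (1 + p)⁻¹
    have hs : (1 + p) * s = 1 := mul_inv_cancel₀ hp
    -- The half-turn 2 n nᵀ - I about the bisector n of `stdVec 0` and e. It exchanges the two
    -- vectors, and 1 + p is half the squared length of their sum.
    let O : Mat := !![p, q, r; q, q ^ 2 * s - 1, q * r * s; r, q * r * s, r ^ 2 * s - 1]
    have hqr : s * (q ^ 2 + r ^ 2) = 1 - p := by linear_combination s * h + (1 - p) * hs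
    have hO : O * Oᵀ = 1 := by
      ext i j
      simp only [O, Matrix.mul_apply, Fin.sum_univ_three, Matrix.transpose_apply]
      fin_cases i <;> fin_cases j <;> simp
      · linear_combination h
      · linear_combination q * hqr
      · linear_combination r * hqr
      · linear_combination q * hqr
      · linear_combination q ^ 2 * s * hqr - q ^ 2 * hs
      · linear_combination q * r * s * hqr - q * r * hs
      · linear_combination r * hqr
      · linear_combination q * r * s * hqr - q * r * hs
      · linear_combination r ^ 2 * s * hqr - r ^ 2 * hs
    refine ⟨O, ?_, fun a b => ?_⟩
    · rw [Matrix.mem_specialOrthogonalGroup_iff, Matrix.mem_orthogonalGroup_iff]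
      refine ⟨hO, ?_⟩
      simp only [O, Matrix.det_fin_three]
      simp
      linear_combination (-p) * hqr + h
    · have : axialMatrix a b (stdVec 0)
          = b • (1 : Mat) + (a - b) • !![1, 0, 0; 0, 0, 0; 0, 0, 0] := by
        ext i j
        simp only [axialMatrix_apply, stdVec_apply]
        fin_cases i <;> fin_cases j <;> simp
      rw [this, mul_add, add_mul, Matrix.mul_smul, mul_one, Matrix.smul_mul, hO, Matrix.mul_smul,
        Matrix.smul_mul, axialMatrix]
      congr 2
      ext i j
      simp only [O, Matrix.mul_apply, Fin.sum_univ_three, Matrix.transpose_apply]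
      fin_cases i <;> fin_cases j <;> simp [p, q, r]

lemma mul_mem_GLPos {F O : Mat} (hF : F ∈ GLPos)
    (hO : O ∈ Matrix.specialOrthogonalGroup (Fin 3) ℝ) : O * F ∈ GLPos := by
  have := (Matrix.mem_specialOrthogonalGroup_iff.1 hO).2
  simpa [GLPos, this] using hF

lemma transpose_mem_specialOrthogonalGroup {O : Mat}
    (hO : O ∈ Matrix.specialOrthogonalGroup (Fin 3) ℝ) :
    Oᵀ ∈ Matrix.specialOrthogonalGroup (Fin 3) ℝ := by
  rw [Matrix.mem_specialOrthogonalGroup_iff, Matrix.mem_orthogonalGroup_iff] at hO ⊢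
  refine ⟨?_, by rw [Matrix.det_transpose, hO.2]⟩
  exact mul_eq_one_comm.1 hO.1

lemma energy_conj {W : Mat → ℝ} (hobj : IsObjective W) (hiso : IsIsotropic W) {F O : Mat}
    (hF : F ∈ GLPos) (hO : O ∈ Matrix.specialOrthogonalGroup (Fin 3) ℝ) :
    W (O * F * Oᵀ) = W F := by
  rw [← hiso _ (mul_mem_GLPos hF hO) _ (transpose_mem_specialOrthogonalGroup hO), ← hobj F hF O hO]

lemma conj_mem_GLPos {F O : Mat} (hF : F ∈ GLPos)
    (hO : O ∈ Matrix.specialOrthogonalGroup (Fin 3) ℝ) : O * F * Oᵀ ∈ GLPos := by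
  have := (Matrix.mem_specialOrthogonalGroup_iff.1 hO).2
  simpa [GLPos, this] using hF

/-- Conjugation `F ↦ O F Oᵀ` as a continuous linear map. -/
noncomputable def conjCLM (O : Mat) : Mat →L[ℝ] Mat :=
  LinearMap.toContinuousLinearMap
    { toFun := fun F => O * F * Oᵀ
      map_add' := fun A B => by rw [mul_add, add_mul]
      map_smul' := fun c A => by simp }

/-! ### Symmetries of the energy, passed on to the response. -/

section

variable {ρbar : ℝ} {W : Mat → ℝ} {Shat : Mat → Mat}

lemma fderiv_energy_conj (hyper : IsHyperelastic ρbar W Shat) (hobj : IsObjective W)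
    (hiso : IsIsotropic W) {F O : Mat}
    (hF : F ∈ GLPos) (hO : O ∈ Matrix.specialOrthogonalGroup (Fin 3) ℝ) (H : Mat) :
    fderiv ℝ W (O * F * Oᵀ) (O * H * Oᵀ) = fderiv ℝ W F H := by
  have h1 : HasFDerivAt (fun X => W (conjCLM O X)) ((fderiv ℝ W (O * F * Oᵀ)).comp (conjCLM O)) F :=
    HasFDerivAt.comp F (hyper.differentiableAt_energy _ (conj_mem_GLPos hF hO)).hasFDerivAt
      (conjCLM O).hasFDerivAt
  have h2 : (fun X => W (conjCLM O X)) =ᶠ[𝓝 F] W := by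
    filter_upwards [isOpen_GLPos.mem_nhds hF] with X hX
    exact energy_conj hobj hiso hX hO
  exact congrArg (fun L => L H) (h1.congr_of_eventuallyEq h2.symm).fderiv.symm

/-- `Shat` is the gradient of ρbar W for the Frobenius pairing. This form allows arbitrary
directions: a conjugated basis matrix in `response_conj`, and F itself in Euler's identity. -/
lemma sum_response_mul (hyper : IsHyperelastic ρbar W Shat) {F : Mat} (hF : F ∈ GLPos) (H : Mat) :
    ∑ i, ∑ j, Shat F i j * H i j = ρbar * fderiv ℝ W F H := by
  conv_rhs => rw [Matrix.matrix_eq_sum_single H]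
  simp only [map_sum, Finset.mul_sum]
  refine Finset.sum_congr rfl fun i _ => Finset.sum_congr rfl fun j _ => ?_
  have : Matrix.single i j (H i j) = H i j • Matrix.single i j (1 : ℝ) := by simp
  rw [hyper.response_eq F hF, this, map_smul, smul_eq_mul]
  ring

/-- Conjugation by an orthogonal matrix preserves the Frobenius pairing, so the gradient of a
conjugation-invariant function is equivariant. -/
lemma response_conj (hyper : IsHyperelastic ρbar W Shat) (hobj : IsObjective W)
    (hiso : IsIsotropic W) {F O : Mat}
    (hF : F ∈ GLPos) (hO : O ∈ Matrix.specialOrthogonalGroup (Fin 3) ℝ) :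
    Shat (O * F * Oᵀ) = O * Shat F * Oᵀ := by
  have hO' := transpose_mem_specialOrthogonalGroup hO
  have h1 : O * Oᵀ = 1 :=
    (Matrix.mem_orthogonalGroup_iff _ _).1 (Matrix.mem_specialOrthogonalGroup_iff.1 hO).1
  ext i j
  rw [hyper.response_eq _ (conj_mem_GLPos hF hO)]
  -- The basis direction is written as a conjugate, so that the invariance of the derivative moves
  -- the base point back to F.
  have h2 : Matrix.single i j (1 : ℝ) = O * (Oᵀ * Matrix.single i j 1 * O) * Oᵀ := by
    calc _ = (O * Oᵀ) * Matrix.single i j (1 : ℝ) * (O * Oᵀ) := by rw [h1, one_mul, mul_one]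
      _ = _ := by simp only [mul_assoc]
  rw [h2, fderiv_energy_conj hyper hobj hiso hF hO, ← sum_response_mul hyper hF]
  simp only [Matrix.mul_apply, Matrix.transpose_apply, Finset.sum_mul, Finset.mul_sum,
    Matrix.single_apply]
  rw [Finset.sum_comm]
  refine Finset.sum_congr rfl fun l _ => Finset.sum_congr rfl fun k _ => ?_
  rw [Finset.sum_eq_single j]
  · rw [Finset.sum_eq_single i]
    · simp
      ring
    · intro b _ hb
      simp [hb.symm]
    · simp
  · intro b _ hb
    simp [hb.symm]
  · simp

/-- Differentiating W(σF) = σ⁻¹ W(F) in F produces a factor σ on the left, hence degree -2 for the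
gradient. -/
lemma response_smul (hyper : IsHyperelastic ρbar W Shat) (hhom : IsHomogeneousOfDegree (-1) W)
    {F : Mat} (hF : F ∈ GLPos) {σ : ℝ} (hσ : 0 < σ) : Shat (σ • F) = (σ ^ 2)⁻¹ • Shat F := by
  have hmem : ∀ {X : Mat}, X ∈ GLPos → σ • X ∈ GLPos := fun {X} hX => by
    have : 0 < X.det := hX
    simp only [GLPos, mem_ofPred_eq, Matrix.det_smul]
    positivity
  have h1 : HasFDerivAt (fun X => W (σ • X))
      ((fderiv ℝ W (σ • F)).comp (σ • ContinuousLinearMap.id ℝ Mat)) F :=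
    HasFDerivAt.comp F (hyper.differentiableAt_energy _ (hmem hF)).hasFDerivAt
      ((hasFDerivAt_id F).const_smul σ)
  have h2 : (fun X => W (σ • X)) =ᶠ[𝓝 F] fun X => σ ^ (-1 : ℝ) * W X := by
    filter_upwards [isOpen_GLPos.mem_nhds hF] with X hX
    exact hhom σ hσ X hX
  have h3 := h1.congr_of_eventuallyEq h2.symm
  have h4 : HasFDerivAt (fun X => σ ^ (-1 : ℝ) * W X) (σ ^ (-1 : ℝ) • fderiv ℝ W F) F :=
    (hyper.differentiableAt_energy _ hF).hasFDerivAt.const_mul _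
  ext i j
  have h5 := congrArg (fun L => L (Matrix.single i j (1 : ℝ))) (h3.unique h4)
  simp only [ContinuousLinearMap.comp_apply, smul_apply,
    ContinuousLinearMap.id_apply, map_smul, smul_eq_mul, Real.rpow_neg_one] at h5
  rw [hyper.response_eq _ (hmem hF), Matrix.smul_apply, hyper.response_eq _ hF, smul_eq_mul]
  have : fderiv ℝ W (σ • F) (Matrix.single i j 1)
      = (σ ^ 2)⁻¹ * fderiv ℝ W F (Matrix.single i j 1) := by
    field_simp at h5 ⊢
    linarith
  rw [this]
  ring

/-- Euler's identity for an energy that is homogeneous of degree `-1`. -/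
lemma fderiv_energy_self (hyper : IsHyperelastic ρbar W Shat) (hhom : IsHomogeneousOfDegree (-1) W)
    {F : Mat} (hF : F ∈ GLPos) : fderiv ℝ W F F = -W F := by
  have h0 : HasDerivAt (fun σ : ℝ => σ • F) F 1 := by
    have := (hasDerivAt_id (1 : ℝ)).smul_const F
    rw [one_smul] at this
    exact this
  have h1 : HasDerivAt (fun σ : ℝ => W (σ • F)) (fderiv ℝ W F F) 1 := by
    refine HasFDerivAt.comp_hasDerivAt (1 : ℝ) ?_ h0
    rw [one_smul]
    exact (hyper.differentiableAt_energy _ hF).hasFDerivAt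
  have h2 : (fun σ : ℝ => W (σ • F)) =ᶠ[𝓝 1] fun σ => σ⁻¹ * W F := by
    filter_upwards [Ioi_mem_nhds (zero_lt_one' ℝ)] with σ hσ
    rw [hhom σ hσ F hF, Real.rpow_neg_one]
  have h3 : HasDerivAt (fun σ : ℝ => σ⁻¹ * W F) (-W F) 1 := by
    simpa using (hasDerivAt_inv (one_ne_zero (α := ℝ))).mul_const (W F)
  exact (h1.congr_of_eventuallyEq h2.symm).unique h3

end

lemma mem_specialOrthogonalGroup_of {O : Mat} (h : O * Oᵀ = 1) (hdet : O.det = 1) :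
    O ∈ Matrix.specialOrthogonalGroup (Fin 3) ℝ := by
  rw [Matrix.mem_specialOrthogonalGroup_iff, Matrix.mem_orthogonalGroup_iff]
  exact ⟨h, hdet⟩

/-! ### Principal stresses of an axial stretch in terms of the energy profile. -/

lemma axialMatrix_stdVec_zero (a b : ℝ) :
    axialMatrix a b (stdVec 0) = !![a, 0, 0; 0, b, 0; 0, 0, b] := by
  ext i j
  simp only [axialMatrix_apply, stdVec_apply]
  fin_cases i <;> fin_cases j <;> simp

/-- The principal stress in the axial direction. -/
noncomputable def axialStress (Shat : Mat → Mat) (y : ℝ) : ℝ :=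
  Shat (axialMatrix y 1 (stdVec 0)) 0 0

/-- The principal stress in the transversal directions. -/
noncomputable def transversalStress (Shat : Mat → Mat) (y : ℝ) : ℝ :=
  Shat (axialMatrix y 1 (stdVec 0)) 1 1

section

variable {ρbar : ℝ} {W : Mat → ℝ} {Shat : Mat → Mat}

/-- By equivariance it suffices to treat the axis `stdVec 0`. There the response is fixed by
conjugation with every rotation that fixes the axial stretch, and three half-turns already force the
axial form. -/
lemma response_axialMatrix (hyper : IsHyperelastic ρbar W Shat) (hobj : IsObjective W)
    (hiso : IsIsotropic W) {y : ℝ} (hy : 0 < y) {e : Space} (he : ‖e‖ = 1) :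
    Shat (axialMatrix y 1 e)
      = axialMatrix (axialStress Shat y) (transversalStress Shat y) e := by
  obtain ⟨O, hO, hconj⟩ := exists_rotation_axialMatrix he
  have hmem := axialMatrix_mem_GLPos hy one_pos (norm_stdVec 0)
  rw [← hconj, response_conj hyper hobj hiso hmem hO, ← hconj]
  congr 2
  set S := Shat (axialMatrix y 1 (stdVec 0)) with hS
  have inv : ∀ R : Mat, R * Rᵀ = 1 → R.det = 1 →
      R * axialMatrix y 1 (stdVec 0) * Rᵀ = axialMatrix y 1 (stdVec 0) → S = R * S * Rᵀ := by
    intro R h1 h2 h3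
    rw [hS, ← response_conj hyper hobj hiso hmem (mem_specialOrthogonalGroup_of h1 h2), h3]
  -- The half-turns `e1` and `e2` about coordinate axes change the signs of off-diagonal entries and
  -- so annihilate them. The half-turn `e3` exchanges the two transversal axes and equates their
  -- diagonal entries.
  have e1 := inv !![-1, 0, 0; 0, -1, 0; 0, 0, 1]
    (by ext i j; fin_cases i <;> fin_cases j <;> simp [Matrix.mul_apply, Fin.sum_univ_three])
    (by simp [Matrix.det_fin_three])
    (by rw [axialMatrix_stdVec_zero]; ext i j
        fin_cases i <;> fin_cases j <;> simp [Matrix.mul_apply, Fin.sum_univ_three])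
  have e2 := inv !![-1, 0, 0; 0, 1, 0; 0, 0, -1]
    (by ext i j; fin_cases i <;> fin_cases j <;> simp [Matrix.mul_apply, Fin.sum_univ_three])
    (by simp [Matrix.det_fin_three])
    (by rw [axialMatrix_stdVec_zero]; ext i j
        fin_cases i <;> fin_cases j <;> simp [Matrix.mul_apply, Fin.sum_univ_three])
  have e3 := inv !![-1, 0, 0; 0, 0, 1; 0, 1, 0]
    (by ext i j; fin_cases i <;> fin_cases j <;> simp [Matrix.mul_apply, Fin.sum_univ_three])
    (by simp [Matrix.det_fin_three])
    (by rw [axialMatrix_stdVec_zero]; ext i j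
        fin_cases i <;> fin_cases j <;> simp [Matrix.mul_apply, Fin.sum_univ_three])
  have k1 := fun i j => congrFun (congrFun e1 i) j
  have k2 := fun i j => congrFun (congrFun e2 i) j
  have k3 := congrFun (congrFun e3 2) 2
  simp only [Matrix.mul_apply, Fin.sum_univ_three, Matrix.transpose_apply] at k1 k2 k3
  have h01 := k2 0 1
  have h02 := k1 0 2
  have h10 := k2 1 0
  have h12 := k1 1 2
  have h20 := k1 2 0
  have h21 := k1 2 1
  simp at h01 h02 h10 h12 h20 h21 k3
  rw [axialMatrix_stdVec_zero]
  ext i j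
  fin_cases i <;> fin_cases j <;> simp [axialStress, transversalStress, ← hS] <;> linarith

/-- The identity commutes with the cyclic permutation of the axes. This makes the stress isotropic
at the centre of the body, where the two stretches agree. -/
lemma axialStress_one (hyper : IsHyperelastic ρbar W Shat) (hobj : IsObjective W)
    (hiso : IsIsotropic W) : axialStress Shat 1 = transversalStress Shat 1 := by
  have hmem := axialMatrix_mem_GLPos one_pos one_pos (norm_stdVec 0)
  have h1 : (!![0, 1, 0; 0, 0, 1; 1, 0, 0] : Mat) * (!![0, 1, 0; 0, 0, 1; 1, 0, 0] : Mat)ᵀ = 1 := by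
    ext i j; fin_cases i <;> fin_cases j <;> simp [Matrix.mul_apply, Fin.sum_univ_three]
  have h2 := response_conj hyper hobj hiso hmem
    (mem_specialOrthogonalGroup_of h1 (by simp [Matrix.det_fin_three]))
  rw [axialMatrix_self, one_smul, mul_one, h1] at h2
  have h3 := congrFun (congrFun h2 0) 0
  simp only [Matrix.mul_apply, Fin.sum_univ_three, Matrix.transpose_apply] at h3
  simp at h3
  simp only [axialStress, transversalStress, axialMatrix_self, one_smul]
  exact h3

/-- Consequently the profile g does not depend on the choice of ω. -/
lemma energy_axialMatrix (hobj : IsObjective W) (hiso : IsIsotropic W) {y : ℝ} (hy : 0 < y)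
    {e : Space} (he : ‖e‖ = 1) :
    W (axialMatrix y 1 e) = W (axialMatrix y 1 (stdVec 0)) := by
  obtain ⟨O, hO, hconj⟩ := exists_rotation_axialMatrix he
  rw [← hconj, energy_conj hobj hiso (axialMatrix_mem_GLPos hy one_pos (norm_stdVec 0)) hO]

lemma hasDerivAt_axialMatrix (y : ℝ) :
    HasDerivAt (fun y : ℝ => axialMatrix y 1 (stdVec 0)) (Matrix.single 0 0 1 : Mat) y := by
  have h1 : (Matrix.of fun i j => stdVec 0 i * stdVec 0 j : Mat) = Matrix.single 0 0 1 := by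
    ext i j
    fin_cases i <;> fin_cases j <;> simp [stdVec_apply]
  have h2 := (((hasDerivAt_id y).sub_const 1).smul_const (Matrix.single 0 0 1 : Mat)).const_add
    (1 : Mat)
  rw [one_smul] at h2
  simp only [axialMatrix, h1, one_smul]
  exact h2

lemma hasDerivAt_energyProfile (hρ : 0 < ρbar) (hyper : IsHyperelastic ρbar W Shat)
    (hobj : IsObjective W) (hiso : IsIsotropic W) {ω : Space} (hω : ‖ω‖ = 1) {y : ℝ} (hy : 0 < y) :
    HasDerivAt (energyProfile ρbar W ω) (ρbar ^ (-(4 / 3) : ℝ) * axialStress Shat y) y := by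
  have hmem := axialMatrix_mem_GLPos hy one_pos (norm_stdVec 0)
  have h1 := ((hyper.differentiableAt_energy _ hmem).hasFDerivAt.comp_hasDerivAt y
    (hasDerivAt_axialMatrix y)).const_mul (ρbar ^ (-(1 / 3) : ℝ))
  have h2 : ρbar ^ (-(4 / 3) : ℝ) * axialStress Shat y
      = ρbar ^ (-(1 / 3) : ℝ) *
        fderiv ℝ W (axialMatrix y 1 (stdVec 0)) (Matrix.single 0 0 1) := by
    -- The exponent -4/3 collects the factor ρbar^(-1/3) of g and the ρbar⁻¹ that converts the
    -- stress into a derivative of `W`.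
    rw [axialStress, hyper.response_eq _ hmem,
      show (-(1 / 3) : ℝ) = -(4 / 3) + 1 by norm_num, Real.rpow_add_one hρ.ne']
    ring
  rw [h2]
  refine h1.congr_of_eventuallyEq ?_
  filter_upwards [Ioi_mem_nhds hy] with z hz
  simp only [Function.comp_apply]
  rw [← energy_axialMatrix hobj hiso hz hω, energyProfile, axialMatrix, one_smul]

lemma axialStress_eq (hρ : 0 < ρbar) (hyper : IsHyperelastic ρbar W Shat)
    (hobj : IsObjective W) (hiso : IsIsotropic W) {ω : Space} (hω : ‖ω‖ = 1) {y : ℝ} (hy : 0 < y) :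
    axialStress Shat y = ρbar ^ (4 / 3 : ℝ) * deriv (energyProfile ρbar W ω) y := by
  rw [(hasDerivAt_energyProfile hρ hyper hobj hiso hω hy).deriv, ← mul_assoc, ← Real.rpow_add hρ]
  simp

/-- Pairing the response with the stretch itself gives y times the axial stress plus twice the
transversal one, and Euler's identity equates this with -ρbar W. -/
lemma transversalStress_eq (hρ : 0 < ρbar) (hyper : IsHyperelastic ρbar W Shat)
    (hobj : IsObjective W) (hiso : IsIsotropic W) (hhom : IsHomogeneousOfDegree (-1) W)
    {ω : Space} (hω : ‖ω‖ = 1) {y : ℝ} (hy : 0 < y) :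
    transversalStress Shat y = -(ρbar ^ (4 / 3 : ℝ) *
      (energyProfile ρbar W ω y + y * deriv (energyProfile ρbar W ω) y)) / 2 := by
  have hmem := axialMatrix_mem_GLPos hy one_pos (norm_stdVec 0)
  have h1 := sum_response_mul hyper hmem (axialMatrix y 1 (stdVec 0))
  rw [fderiv_energy_self hyper hhom hmem,
    response_axialMatrix hyper hobj hiso hy (norm_stdVec 0), ← energy_axialMatrix hobj hiso hy hω]
    at h1
  simp only [axialMatrix_stdVec_zero, Fin.sum_univ_three] at h1
  simp at h1
  have h2 : ρbar ^ (4 / 3 : ℝ) * energyProfile ρbar W ω y = ρbar * W (axialMatrix y 1 ω) := by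
    rw [energyProfile, ← mul_assoc, ← Real.rpow_add hρ, axialMatrix, one_smul]
    norm_num
  have h3 := axialStress_eq hρ hyper hobj hiso hω hy
  linear_combination (1 / 2) * h1 + (1 / 2) * h2 - y / 2 * h3

lemma contDiffOn_response_axialMatrix (hyper : IsHyperelastic ρbar W Shat) (i j : Fin 3) :
    ContDiffOn ℝ 1 (fun y => Shat (axialMatrix y 1 (stdVec 0)) i j) (Ioi 0) := by
  have h1 : ContDiff ℝ 1 fun y : ℝ => axialMatrix y 1 (stdVec 0) := by
    have h2 : deriv (fun y : ℝ => axialMatrix y 1 (stdVec 0)) = fun _ => Matrix.single 0 0 1 :=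
      funext fun y => (hasDerivAt_axialMatrix y).deriv
    refine contDiff_one_iff_deriv.2 ⟨fun y => (hasDerivAt_axialMatrix y).differentiableAt, ?_⟩
    exact (congrArg _ h2).mpr continuous_const
  exact (Matrix.entryLinearMap ℝ ℝ i j).toContinuousLinearMap.contDiff.comp_contDiffOn
    (hyper.contDiffOn_response.comp h1.contDiffOn
      fun y hy => axialMatrix_mem_GLPos hy one_pos (norm_stdVec 0))

/-- The response to a conformal multiple of an axial stretch. -/
lemma response_axialMatrix' (hyper : IsHyperelastic ρbar W Shat) (hobj : IsObjective W)
    (hiso : IsIsotropic W) (hhom : IsHomogeneousOfDegree (-1) W) {a b : ℝ} (ha : 0 < a) (hb : 0 < b)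
    {e : Space} (he : ‖e‖ = 1) :
    Shat (axialMatrix a b e) = axialMatrix ((b ^ 2)⁻¹ * axialStress Shat (a / b))
      ((b ^ 2)⁻¹ * transversalStress Shat (a / b)) e := by
  have h1 : axialMatrix a b e = b • axialMatrix (a / b) 1 e := by
    rw [smul_axialMatrix, mul_div_cancel₀ _ hb.ne', mul_one]
  rw [h1, response_smul hyper hhom (axialMatrix_mem_GLPos (by positivity) one_pos he) hb,
    response_axialMatrix hyper hobj hiso (by positivity) he, smul_axialMatrix]

end

/-! ### Functions of time and radius -/

lemma timeInterval_exists_gt {T : EReal} {t : ℝ} (ht : t ∈ timeInterval T) :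
    ∃ t₁ : ℝ, t < t₁ ∧ (t₁ : EReal) < T := by
  obtain ⟨t₁, h1, h2⟩ := EReal.lt_iff_exists_real_btwn.1 ht.2
  exact ⟨t₁, EReal.coe_lt_coe_iff.1 h1, h2⟩

lemma zero_mem_timeInterval {T : EReal} (hT : 0 < T) : (0 : ℝ) ∈ timeInterval T :=
  ⟨le_rfl, by simpa using hT⟩

lemma Icc_subset_timeInterval {T : EReal} {t₁ : ℝ} (h : (t₁ : EReal) < T) :
    Icc 0 t₁ ⊆ timeInterval T :=
  fun _ hs => ⟨hs.1, lt_of_le_of_lt (EReal.coe_le_coe_iff.2 hs.2) h⟩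

lemma convex_timeInterval (T : EReal) : Convex ℝ (timeInterval T) := by
  refine OrdConnected.convex ⟨fun x hx y hy z hz => ⟨hx.1.trans hz.1, ?_⟩⟩
  exact lt_of_le_of_lt (EReal.coe_le_coe_iff.2 hz.2) hy.2

lemma interior_timeInterval_nonempty {T : EReal} (hT : 0 < T) :
    (interior (timeInterval T)).Nonempty := by
  obtain ⟨t₁, h1, h2⟩ := timeInterval_exists_gt (zero_mem_timeInterval hT)
  refine Nonempty.mono (interior_mono (Icc_subset_timeInterval h2)) ?_
  rw [interior_Icc]
  exact nonempty_Ioo.2 h1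

lemma uniqueDiffOn_timeInterval {T : EReal} (hT : 0 < T) : UniqueDiffOn ℝ (timeInterval T) :=
  uniqueDiffOn_convex (convex_timeInterval T) (interior_timeInterval_nonempty hT)

/-- Every point of a time interval has a compact neighbourhood within the interval. -/
lemma exists_compact_nhdsWithin_timeInterval {T : EReal} {t : ℝ} (ht : t ∈ timeInterval T) :
    ∃ C ⊆ timeInterval T, IsCompact C ∧ C ∈ 𝓝[timeInterval T] t := by
  obtain ⟨t₁, h1, h2⟩ := timeInterval_exists_gt ht
  refine ⟨Icc 0 t₁, Icc_subset_timeInterval h2, isCompact_Icc, ?_⟩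
  filter_upwards [self_mem_nhdsWithin, mem_nhdsWithin_of_mem_nhds (Iio_mem_nhds h1)] with s hs hs'
  exact ⟨hs.1, le_of_lt hs'⟩

/-- The derivative `a dt + b dR`. -/
noncomputable def radialCLM (a b : ℝ) : ℝ × ℝ →L[ℝ] ℝ :=
  a • ContinuousLinearMap.fst ℝ ℝ ℝ + b • ContinuousLinearMap.snd ℝ ℝ ℝ

@[simp] lemma radialCLM_apply (a b : ℝ) (v : ℝ × ℝ) : radialCLM a b v = a * v.1 + b * v.2 := by
  simp [radialCLM]

/-- `f` is `C¹` on `I × [0, 1]`, with partial derivatives `ft` and `fR`. -/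
structure HasRadialFDeriv (I : Set ℝ) (f ft fR : ℝ → ℝ → ℝ) : Prop where
  hasFDerivWithinAt : ∀ t ∈ I, ∀ R ∈ Icc (0 : ℝ) 1,
    HasFDerivWithinAt (fun p : ℝ × ℝ => f p.1 p.2) (radialCLM (ft t R) (fR t R))
      (I ×ˢ Icc (0 : ℝ) 1) (t, R)
  continuousOn_time : ContinuousOn (fun p : ℝ × ℝ => ft p.1 p.2) (I ×ˢ Icc (0 : ℝ) 1)
  continuousOn_radial : ContinuousOn (fun p : ℝ × ℝ => fR p.1 p.2) (I ×ˢ Icc (0 : ℝ) 1)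

lemma HasRadialFDeriv.of_contDiffOn {I : Set ℝ} (hI : UniqueDiffOn ℝ I) {f : ℝ → ℝ → ℝ}
    (hf : ContDiffOn ℝ 1 (fun p : ℝ × ℝ => f p.1 p.2) (I ×ˢ Icc (0 : ℝ) 1)) :
    HasRadialFDeriv I f
      (fun t R => fderivWithin ℝ (fun p : ℝ × ℝ => f p.1 p.2) (I ×ˢ Icc (0 : ℝ) 1) (t, R) (1, 0))
      (fun t R => fderivWithin ℝ (fun p : ℝ × ℝ => f p.1 p.2) (I ×ˢ Icc (0 : ℝ) 1) (t, R) (0, 1))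
      where
  hasFDerivWithinAt t ht R hR := by
    have h := (hf.differentiableOn one_ne_zero (t, R) ⟨ht, hR⟩).hasFDerivWithinAt
    refine h.congr_fderiv (ContinuousLinearMap.ext fun v => ?_)
    have hv : v = v.1 • ((1, 0) : ℝ × ℝ) + v.2 • ((0, 1) : ℝ × ℝ) := by ext <;> simp
    rw [radialCLM_apply]
    conv_lhs => rw [hv]
    rw [map_add, map_smul, map_smul, smul_eq_mul, smul_eq_mul, mul_comm v.1, mul_comm v.2]
  continuousOn_time :=
    (hf.continuousOn_fderivWithin (hI.prod (uniqueDiffOn_Icc zero_lt_one)) le_rfl).clm_apply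
      continuousOn_const
  continuousOn_radial :=
    (hf.continuousOn_fderivWithin (hI.prod (uniqueDiffOn_Icc zero_lt_one)) le_rfl).clm_apply
      continuousOn_const

section

variable {I : Set ℝ} {f ft fR : ℝ → ℝ → ℝ}

lemma HasRadialFDeriv.continuousOn (h : HasRadialFDeriv I f ft fR) :
    ContinuousOn (fun p : ℝ × ℝ => f p.1 p.2) (I ×ˢ Icc (0 : ℝ) 1) :=
  fun p hp => (h.hasFDerivWithinAt p.1 hp.1 p.2 hp.2).continuousWithinAt

lemma HasRadialFDeriv.hasDerivWithinAt_radial (h : HasRadialFDeriv I f ft fR) {t R : ℝ}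
    (ht : t ∈ I) (hR : R ∈ Icc (0 : ℝ) 1) : HasDerivWithinAt (f t) (fR t R) (Icc 0 1) R := by
  have h1 : HasDerivWithinAt (fun r : ℝ => ((t, r) : ℝ × ℝ)) (0, 1) (Icc 0 1) R :=
    (hasDerivWithinAt_const R _ t).prodMk (hasDerivWithinAt_id R _)
  exact ((h.hasFDerivWithinAt t ht R hR).comp_hasDerivWithinAt R h1
    fun r hr => ⟨ht, hr⟩).congr_deriv (by simp)

lemma HasRadialFDeriv.hasDerivWithinAt_time (h : HasRadialFDeriv I f ft fR) {t R : ℝ}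
    (ht : t ∈ I) (hR : R ∈ Icc (0 : ℝ) 1) :
    HasDerivWithinAt (fun s => f s R) (ft t R) I t := by
  have h1 : HasDerivWithinAt (fun s : ℝ => ((s, R) : ℝ × ℝ)) (1, 0) I t :=
    (hasDerivWithinAt_id t _).prodMk (hasDerivWithinAt_const t _ R)
  have h2 := (h.hasFDerivWithinAt t ht R hR).comp_hasDerivWithinAt t h1
    fun r hr => mk_mem_prod hr hR
  exact h2.congr_deriv (by simp)

lemma HasRadialFDeriv.derivWithin_radial (h : HasRadialFDeriv I f ft fR) {t R : ℝ}
    (ht : t ∈ I) (hR : R ∈ Icc (0 : ℝ) 1) : derivWithin (f t) (Icc 0 1) R = fR t R :=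
  (h.hasDerivWithinAt_radial ht hR).derivWithin (uniqueDiffOn_Icc zero_lt_one R hR)

lemma HasRadialFDeriv.derivWithin_time (h : HasRadialFDeriv I f ft fR) (hI : UniqueDiffOn ℝ I)
    {t R : ℝ} (ht : t ∈ I) (hR : R ∈ Icc (0 : ℝ) 1) : derivWithin (fun s => f s R) I t = ft t R :=
  (h.hasDerivWithinAt_time ht hR).derivWithin (hI t ht)

lemma HasRadialFDeriv.time_eq_zero (h : HasRadialFDeriv I f ft fR) (hI : UniqueDiffOn ℝ I)
    (h0 : ∀ t ∈ I, f t 0 = 0) : ∀ t ∈ I, ft t 0 = 0 := by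
  intro t ht
  rw [← h.derivWithin_time hI ht ⟨le_rfl, zero_le_one⟩,
    derivWithin_congr (f := fun _ => (0 : ℝ)) h0 (h0 t ht)]
  simp

lemma HasRadialFDeriv.sub {g gt gR : ℝ → ℝ → ℝ} (hf : HasRadialFDeriv I f ft fR)
    (hg : HasRadialFDeriv I g gt gR) :
    HasRadialFDeriv I (fun t R => f t R - g t R) (fun t R => ft t R - gt t R)
      (fun t R => fR t R - gR t R) where
  hasFDerivWithinAt t ht R hR := by
    refine ((hf.hasFDerivWithinAt t ht R hR).sub
      (hg.hasFDerivWithinAt t ht R hR)).congr_fderiv ?_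
    ext <;> simp
  continuousOn_time := hf.continuousOn_time.sub hg.continuousOn_time
  continuousOn_radial := hf.continuousOn_radial.sub hg.continuousOn_radial

/-- The composition of a `C¹` function of two variables with two `C¹` functions of time and
radius. -/
lemma HasRadialFDeriv.comp₂ {g gt gR : ℝ → ℝ → ℝ} (hf : HasRadialFDeriv I f ft fR)
    (hg : HasRadialFDeriv I g gt gR) {A : ℝ → ℝ → ℝ} {U : Set (ℝ × ℝ)} (hU : IsOpen U)
    (hA : ContDiffOn ℝ 1 (fun p : ℝ × ℝ => A p.1 p.2) U)
    (hmem : ∀ t ∈ I, ∀ R ∈ Icc (0 : ℝ) 1, (f t R, g t R) ∈ U) :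
    HasRadialFDeriv I (fun t R => A (f t R) (g t R))
      (fun t R => fderiv ℝ (fun p : ℝ × ℝ => A p.1 p.2) (f t R, g t R) (ft t R, gt t R))
      (fun t R => fderiv ℝ (fun p : ℝ × ℝ => A p.1 p.2) (f t R, g t R) (fR t R, gR t R)) where
  hasFDerivWithinAt t ht R hR := by
    have h1 := ((hA.contDiffAt (hU.mem_nhds (hmem t ht R hR))).differentiableAt
      one_ne_zero).hasFDerivAt
    have h2 := (hf.hasFDerivWithinAt t ht R hR).prodMk (hg.hasFDerivWithinAt t ht R hR)
    refine (h1.comp_hasFDerivWithinAt (t, R) h2).congr_fderiv ?_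
    ext <;> simp
  continuousOn_time := by
    have h1 := (hA.continuousOn_fderiv_of_isOpen hU le_rfl).comp
      (hf.continuousOn.prodMk hg.continuousOn) fun p hp => hmem p.1 hp.1 p.2 hp.2
    exact h1.clm_apply (hf.continuousOn_time.prodMk hg.continuousOn_time)
  continuousOn_radial := by
    have h1 := (hA.continuousOn_fderiv_of_isOpen hU le_rfl).comp
      (hf.continuousOn.prodMk hg.continuousOn) fun p hp => hmem p.1 hp.1 p.2 hp.2
    exact h1.clm_apply (hf.continuousOn_radial.prodMk hg.continuousOn_radial)

/-- A locally uniform mean value estimate at the origin. -/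
lemma eventually_abs_sub_le {f fR : ℝ → ℝ → ℝ} {t₀ c ε : ℝ} (ht₀ : t₀ ∈ I)
    (h0 : ∀ t ∈ I, f t 0 = 0)
    (hd : ∀ t ∈ I, ∀ R ∈ Icc (0 : ℝ) 1, HasDerivWithinAt (f t) (fR t R) (Icc 0 1) R)
    (hc : ContinuousOn (fun p : ℝ × ℝ => fR p.1 p.2) (I ×ˢ Icc (0 : ℝ) 1))
    (hval : fR t₀ 0 = c) (hε : 0 < ε) :
    ∃ δ > 0, ∀ t ∈ I, |t - t₀| < δ → ∀ R ∈ Icc (0 : ℝ) 1, R < δ → |f t R - c * R| ≤ ε * R := by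
  have h1 := hc (t₀, 0) ⟨ht₀, le_rfl, zero_le_one⟩
  obtain ⟨δ, hδ, hb⟩ := Metric.continuousWithinAt_iff.1 h1 ε hε
  refine ⟨δ, hδ, fun t ht htδ R hR hRδ => ?_⟩
  have hsub : Icc 0 R ⊆ Icc (0 : ℝ) 1 := Icc_subset_Icc_right hR.2
  have key := (convex_Icc (0 : ℝ) R).norm_image_sub_le_of_norm_hasDerivWithin_le
    (f := fun r => f t r - c * r) (f' := fun r => fR t r - c) (C := ε) (x := 0) (y := R)
    (fun r hr => ((hd t ht r (hsub hr)).mono hsub).sub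
      (by simpa using (hasDerivWithinAt_id r (Icc 0 R)).const_mul c))
    (fun r hr => by
      have := hb (x := (t, r)) ⟨ht, hsub hr⟩ (by
        rw [Prod.dist_eq, max_lt_iff]
        refine ⟨htδ, ?_⟩
        simp only [Real.dist_eq, sub_zero, abs_of_nonneg hr.1]
        exact lt_of_le_of_lt hr.2 hRδ)
      rw [Real.dist_eq, hval] at this
      exact this.le)
    ⟨le_rfl, hR.1⟩ ⟨hR.1, le_rfl⟩
  simpa [h0 t ht, abs_of_nonneg hR.1] using key

/-- The quotient `f(t, R) / R`, with value `c t` at `R = 0`. -/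
noncomputable def radialQuotient (f : ℝ → ℝ → ℝ) (c : ℝ → ℝ) (t R : ℝ) : ℝ := if R = 0 then c t else f t R / R

lemma radialQuotient_zero (f : ℝ → ℝ → ℝ) (c : ℝ → ℝ) (t : ℝ) : radialQuotient f c t 0 = c t :=
  if_pos rfl

lemma radialQuotient_of_ne (f : ℝ → ℝ → ℝ) (c : ℝ → ℝ) {t R : ℝ} (hR : R ≠ 0) :
    radialQuotient f c t R = f t R / R :=
  if_neg hR

/-- Only joint continuity at R = 0 is at stake. The estimate has the slope frozen at t₀ and is
uniform in t near t₀, so it survives division by R. -/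
lemma continuousOn_radialQuotient_of_estimate {c : ℝ → ℝ}
    (hf : ContinuousOn (fun p : ℝ × ℝ => f p.1 p.2) (I ×ˢ Icc (0 : ℝ) 1))
    (hc : ContinuousOn c I)
    (hest : ∀ t₀ ∈ I, ∀ ε > 0, ∃ δ > 0, ∀ t ∈ I, |t - t₀| < δ → ∀ R ∈ Icc (0 : ℝ) 1, R < δ →
      |f t R - c t₀ * R| ≤ ε * R) :
    ContinuousOn (fun p : ℝ × ℝ => radialQuotient f c p.1 p.2) (I ×ˢ Icc (0 : ℝ) 1) := by
  rintro ⟨t₀, R₀⟩ ⟨ht₀, hR₀⟩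
  by_cases h : R₀ = 0
  · subst h
    rw [Metric.continuousWithinAt_iff]
    intro ε hε
    obtain ⟨δ₁, hδ₁, h1⟩ := Metric.continuousWithinAt_iff.1 (hc t₀ ht₀) ε hε
    obtain ⟨δ₂, hδ₂, h2⟩ := hest t₀ ht₀ (ε / 2) (half_pos hε)
    refine ⟨min δ₁ δ₂, lt_min hδ₁ hδ₂, ?_⟩
    rintro ⟨t, R⟩ ⟨ht, hR⟩ hdist
    rw [Prod.dist_eq, max_lt_iff] at hdist
    simp only [Real.dist_eq, sub_zero, lt_min_iff, radialQuotient_zero] at hdist ⊢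
    by_cases hR0 : R = 0
    · subst hR0
      rw [radialQuotient_zero]
      exact h1 ht hdist.1.1
    · have hRpos : 0 < R := lt_of_le_of_ne hR.1 (Ne.symm hR0)
      rw [abs_of_pos hRpos] at hdist
      have h3 := h2 t ht hdist.1.2 R hR hdist.2.2
      rw [radialQuotient_of_ne _ _ hR0]
      have h4 : f t R / R - c t₀ = (f t R - c t₀ * R) / R := by field_simp
      rw [h4, abs_div, abs_of_pos hRpos, div_lt_iff₀ hRpos]
      nlinarith
  · have h1 : ContinuousWithinAt (fun p : ℝ × ℝ => f p.1 p.2 / p.2) (I ×ˢ Icc (0 : ℝ) 1)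
        (t₀, R₀) := (hf (t₀, R₀) ⟨ht₀, hR₀⟩).div continuous_snd.continuousWithinAt h
    refine h1.congr_of_eventuallyEq ?_ (radialQuotient_of_ne _ _ h)
    have : ∀ᶠ p : ℝ × ℝ in 𝓝 (t₀, R₀), p.2 ≠ 0 :=
      continuous_snd.continuousAt.eventually_ne h
    filter_upwards [mem_nhdsWithin_of_mem_nhds this] with p hp
    exact radialQuotient_of_ne _ _ hp

lemma HasRadialFDeriv.continuousOn_radialQuotient (h : HasRadialFDeriv I f ft fR)
    (h0 : ∀ t ∈ I, f t 0 = 0) :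
    ContinuousOn (fun p : ℝ × ℝ => radialQuotient f (fun t => fR t 0) p.1 p.2)
      (I ×ˢ Icc (0 : ℝ) 1) := by
  refine continuousOn_radialQuotient_of_estimate h.continuousOn ?_ ?_
  · exact h.continuousOn_radial.comp (by fun_prop : Continuous fun t : ℝ => (t, (0 : ℝ))).continuousOn
      fun t ht => ⟨ht, le_rfl, zero_le_one⟩
  · intro t₀ ht₀ ε hε
    exact eventually_abs_sub_le ht₀ h0 (fun t ht R hR => h.hasDerivWithinAt_radial ht hR)
      h.continuousOn_radial rfl hε

end

/-! ### Second derivatives, and regularity of the stretch at the centre. -/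

/-- `f` is `C²` on `I × [0, 1]`, with the indicated partial derivatives. -/
structure HasRadialFDeriv2 (I : Set ℝ) (f ft fR ftt ftR fRR : ℝ → ℝ → ℝ) : Prop where
  self : HasRadialFDeriv I f ft fR
  time : HasRadialFDeriv I ft ftt ftR
  radial : HasRadialFDeriv I fR ftR fRR

/-- One function serves as the mixed derivative of both first partials. Symmetry of the one-sided
second derivative holds also on the boundary, because a convex set with nonempty interior lies in
the closure of that interior. -/
lemma exists_hasRadialFDeriv2 {I : Set ℝ} (hconv : Convex ℝ I) (hint : (interior I).Nonempty)
    {f : ℝ → ℝ → ℝ}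
    (hf : ContDiffOn ℝ 2 (fun p : ℝ × ℝ => f p.1 p.2) (I ×ˢ Icc (0 : ℝ) 1)) :
    ∃ ft fR ftt ftR fRR : ℝ → ℝ → ℝ, HasRadialFDeriv2 I f ft fR ftt ftR fRR := by
  have hI : UniqueDiffOn ℝ I := uniqueDiffOn_convex hconv hint
  set K := I ×ˢ Icc (0 : ℝ) 1 with hK
  have hKconv : Convex ℝ K := hconv.prod (convex_Icc 0 1)
  have hKint : (interior K).Nonempty := by
    rw [hK, interior_prod_eq, interior_Icc]
    exact hint.prod (nonempty_Ioo.2 zero_lt_one)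
  have hKu : UniqueDiffOn ℝ K := hI.prod (uniqueDiffOn_Icc zero_lt_one)
  set F := fun p : ℝ × ℝ => f p.1 p.2 with hF
  have hF' : ContDiffOn ℝ 1 (fderivWithin ℝ F K) K := hf.fderivWithin hKu (by norm_num)
  have hv : ∀ v : ℝ × ℝ, ContDiffOn ℝ 1 (fun p => fderivWithin ℝ F K p v) K := fun v =>
    hF'.clm_apply contDiffOn_const
  have hd : ∀ v w : ℝ × ℝ, ∀ p ∈ K, fderivWithin ℝ (fun p => fderivWithin ℝ F K p v) K p w
      = fderivWithin ℝ (fderivWithin ℝ F K) K p w v := by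
    intro v w p hp
    have h1 := (hF'.differentiableOn one_ne_zero p hp).hasFDerivWithinAt
    have h2 := h1.clm_apply (hasFDerivWithinAt_const v p K)
    rw [h2.fderivWithin (hKu p hp)]
    simp
  have hsymm : ∀ p ∈ K, fderivWithin ℝ (fun p => fderivWithin ℝ F K p (0, 1)) K p (1, 0)
      = fderivWithin ℝ (fun p => fderivWithin ℝ F K p (1, 0)) K p (0, 1) := by
    intro p hp
    rw [hd _ _ p hp, hd _ _ p hp]
    refine (hf p hp).isSymmSndFDerivWithinAt (by simp) hKu ?_ hp _ _
    rw [hKconv.closure_interior_eq_closure_of_nonempty_interior hKint]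
    exact subset_closure hp
  have h := HasRadialFDeriv.of_contDiffOn (f := fun t R => fderivWithin ℝ F K (t, R) (0, 1)) hI
    (hv (0, 1))
  have h' := HasRadialFDeriv.of_contDiffOn (f := fun t R => fderivWithin ℝ F K (t, R) (1, 0)) hI
    (hv (1, 0))
  refine ⟨_, _, _, _,
    fun t R => fderivWithin ℝ (fun p => fderivWithin ℝ F K (p.1, p.2) (0, 1)) K (t, R) (0, 1),
    .of_contDiffOn hI (hf.of_le (by norm_num)), h',
    fun t ht R hR => (h.hasFDerivWithinAt t ht R hR).congr_fderiv ?_,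
    h.continuousOn_time.congr ?_, h.continuousOn_radial⟩
  · exact congrArg (fun c => radialCLM c _) (hsymm (t, R) ⟨ht, hR⟩)
  · exact fun p hp => (hsymm p hp).symm

section

variable {I : Set ℝ} {f ft fR ftt ftR fRR : ℝ → ℝ → ℝ}

lemma HasRadialFDeriv.hasFDerivWithinAt_quotient_of_ne (h : HasRadialFDeriv I f ft fR)
    {t R : ℝ} (ht : t ∈ I) (hR : R ∈ Icc (0 : ℝ) 1) (hR0 : R ≠ 0) :
    HasFDerivWithinAt (fun p : ℝ × ℝ => f p.1 p.2 / p.2)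
      (radialCLM (ft t R / R) ((fR t R - f t R / R) / R)) (I ×ˢ Icc (0 : ℝ) 1) (t, R) := by
  have h1 := h.hasFDerivWithinAt t ht R hR
  have h2 : HasFDerivWithinAt (fun p : ℝ × ℝ => p.2⁻¹)
      ((-(R ^ 2)⁻¹) • ContinuousLinearMap.snd ℝ ℝ ℝ) (I ×ˢ Icc (0 : ℝ) 1) (t, R) :=
    (hasDerivAt_inv hR0).comp_hasFDerivWithinAt (f := fun p : ℝ × ℝ => p.2) (t, R)
      hasFDerivWithinAt_snd
  simp only [div_eq_mul_inv]
  refine (h1.mul h2).congr_fderiv ?_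
  ext <;> simp <;> field_simp
  ring

/-- The stretch `f / R` of a `C²` function `f` with `f(t, 0) = f_RR(t, 0) = 0` is `C¹`, and its
radial derivative vanishes at the origin. -/
lemma HasRadialFDeriv2.radialQuotient (h : HasRadialFDeriv2 I f ft fR ftt ftR fRR)
    (hI : UniqueDiffOn ℝ I) (h0 : ∀ t ∈ I, f t 0 = 0) (h2 : ∀ t ∈ I, fRR t 0 = 0) :
    HasRadialFDeriv I (radialQuotient f fun t => fR t 0) (radialQuotient ft fun t => ftR t 0)
      (radialQuotient (fun t R => fR t R - radialQuotient f (fun t => fR t 0) t R) fun _ => 0) := by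
  -- As f_RR is continuous and vanishes at (t₀, 0), the mean value inequality gives f_R(t, R) -
  -- f_R(t, 0) = o(R), uniformly in t near t₀.
  have hE1 : ∀ t₀ ∈ I, ∀ ε > 0, ∃ δ > 0, ∀ t ∈ I, |t - t₀| < δ → ∀ R ∈ Icc (0 : ℝ) 1, R < δ →
      |fR t R - fR t 0| ≤ ε * R := by
    intro t₀ ht₀ ε hε
    obtain ⟨δ, hδ, hb⟩ := eventually_abs_sub_le (f := fun t R => fR t R - fR t 0) (c := 0) ht₀
      (fun t _ => sub_self _) (fun t ht R hR => (h.radial.hasDerivWithinAt_radial ht hR).sub_const _)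
      h.radial.continuousOn_radial (h2 t₀ ht₀) hε
    exact ⟨δ, hδ, fun t ht htδ R hR hRδ => by simpa using hb t ht htδ R hR hRδ⟩
  -- The mean value inequality once more, with derivative bound εR on [0, R], gives |f - f_R(t, 0)
  -- R| ≤ εR².
  have hE2 : ∀ t₀ ∈ I, ∀ ε > 0, ∃ δ > 0, ∀ t ∈ I, |t - t₀| < δ → ∀ R ∈ Icc (0 : ℝ) 1, R < δ →
      |SelfGravElastic.radialQuotient f (fun t => fR t 0) t R - fR t 0| ≤ ε * R := by
    intro t₀ ht₀ ε hε
    obtain ⟨δ, hδ, hb⟩ := hE1 t₀ ht₀ ε hε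
    refine ⟨δ, hδ, fun t ht htδ R hR hRδ => ?_⟩
    by_cases hR0 : R = 0
    · subst hR0
      simp [radialQuotient_zero]
    have hRpos : 0 < R := lt_of_le_of_ne hR.1 (Ne.symm hR0)
    have hsub : Icc 0 R ⊆ Icc (0 : ℝ) 1 := Icc_subset_Icc_right hR.2
    have key := (convex_Icc (0 : ℝ) R).norm_image_sub_le_of_norm_hasDerivWithin_le
      (f := fun r => f t r - fR t 0 * r) (f' := fun r => fR t r - fR t 0) (C := ε * R)
      (x := 0) (y := R)
      (fun r hr => ((h.self.hasDerivWithinAt_radial ht (hsub hr)).mono hsub).sub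
        (by simpa using (hasDerivWithinAt_id r (Icc 0 R)).const_mul (fR t 0)))
      (fun r hr => (hb t ht htδ r (hsub hr) (lt_of_le_of_lt hr.2 hRδ)).trans
        (mul_le_mul_of_nonneg_left hr.2 hε.le))
      ⟨le_rfl, hR.1⟩ ⟨hR.1, le_rfl⟩
    rw [radialQuotient_of_ne _ _ hR0]
    have h4 : f t R / R - fR t 0 = (f t R - fR t 0 * R) / R := by field_simp
    rw [h4, abs_div, abs_of_pos hRpos, div_le_iff₀ hRpos]
    simpa [h0 t ht, abs_of_pos hRpos] using key
  have hcont := h.self.continuousOn_radialQuotient h0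
  refine ⟨?_, h.time.continuousOn_radialQuotient (h.self.time_eq_zero hI h0), ?_⟩
  · intro t ht R hR
    by_cases hR0 : R = 0
    · subst hR0
      rw [radialQuotient_zero, radialQuotient_zero, hasFDerivWithinAt_iff_isLittleO,
        Asymptotics.isLittleO_iff]
      intro ε hε
      have h3 := (h.radial.hasDerivWithinAt_time ht hR)
      rw [hasDerivWithinAt_iff_isLittleO, Asymptotics.isLittleO_iff] at h3
      obtain ⟨δ₁, hδ₁, hb₁⟩ := Metric.mem_nhdsWithin_iff.1 (h3 (half_pos hε))
      obtain ⟨δ₂, hδ₂, hb₂⟩ := hE2 t ht (ε / 2) (half_pos hε)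
      refine Metric.mem_nhdsWithin_iff.2 ⟨min δ₁ δ₂, lt_min hδ₁ hδ₂, ?_⟩
      rintro ⟨s, r⟩ ⟨hdist, hs, hr⟩
      rw [Metric.mem_ball, Prod.dist_eq, max_lt_iff] at hdist
      simp only [Real.dist_eq, sub_zero, lt_min_iff, abs_of_nonneg hr.1] at hdist
      have e1 : ‖fR s 0 - fR t 0 - (s - t) • ftR t 0‖ ≤ ε / 2 * ‖s - t‖ :=
        hb₁ ⟨by simpa [Real.dist_eq] using hdist.1.1, hs⟩
      have e2 := hb₂ s hs hdist.1.2 r hr hdist.2.2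
      simp only [radialQuotient_zero, Prod.mk_sub_mk, sub_zero, mem_ofPred_eq, radialCLM_apply,
        zero_mul, add_zero]
      have e3 : ‖s - t‖ ≤ ‖((s - t, r) : ℝ × ℝ)‖ := norm_fst_le ((s - t, r) : ℝ × ℝ)
      have e4 : |r| ≤ ‖((s - t, r) : ℝ × ℝ)‖ := norm_snd_le ((s - t, r) : ℝ × ℝ)
      rw [abs_of_nonneg hr.1] at e4
      -- The increment at the centre splits into a radial part, small by `hE2`, and the time
      -- increment of f_R(·, 0), which is differentiable.
      have e5 : SelfGravElastic.radialQuotient f (fun t => fR t 0) s r - fR t 0 - ftR t 0 * (s - t)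
          = (SelfGravElastic.radialQuotient f (fun t => fR t 0) s r - fR s 0)
            + (fR s 0 - fR t 0 - (s - t) • ftR t 0) := by
        rw [smul_eq_mul]; ring
      rw [e5]
      refine (norm_add_le _ _).trans ?_
      rw [Real.norm_eq_abs (_ - fR s 0)]
      nlinarith
    · rw [radialQuotient_of_ne _ _ hR0, radialQuotient_of_ne _ _ hR0, radialQuotient_of_ne _ _ hR0]
      refine (h.self.hasFDerivWithinAt_quotient_of_ne ht hR hR0).congr_of_eventuallyEq ?_
        (radialQuotient_of_ne _ _ hR0)
      have : ∀ᶠ p : ℝ × ℝ in 𝓝 (t, R), p.2 ≠ 0 := continuous_snd.continuousAt.eventually_ne hR0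
      filter_upwards [mem_nhdsWithin_of_mem_nhds this] with p hp
      exact radialQuotient_of_ne _ _ hp
  -- The radial derivative of f/R is (f_R - f/R)/R. Both f_R and f/R are within o(R) of f_R(t, 0),
  -- so it tends to 0 at the centre.
  · refine continuousOn_radialQuotient_of_estimate (h.radial.continuousOn.sub hcont)
      continuousOn_const ?_
    intro t₀ ht₀ ε hε
    obtain ⟨δ₁, hδ₁, hb₁⟩ := hE1 t₀ ht₀ (ε / 2) (half_pos hε)
    obtain ⟨δ₂, hδ₂, hb₂⟩ := hE2 t₀ ht₀ (ε / 2) (half_pos hε)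
    refine ⟨min δ₁ δ₂, lt_min hδ₁ hδ₂, fun t ht htδ R hR hRδ => ?_⟩
    have e1 := abs_le.1 (hb₁ t ht (htδ.trans_le (min_le_left _ _)) R hR
      (hRδ.trans_le (min_le_left _ _)))
    have e2 := abs_le.1 (hb₂ t ht (htδ.trans_le (min_le_right _ _)) R hR
      (hRδ.trans_le (min_le_right _ _)))
    rw [zero_mul, sub_zero, abs_le]
    constructor <;> linarith [e1.1, e1.2, e2.1, e2.2]

end

/-! ### Spherically symmetric fields on the reference body -/

/-- The radial unit vector `X / |X|`, equal to `0` at the origin. -/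
noncomputable def direction (X : Space) : Space := ‖X‖⁻¹ • X

lemma direction_zero : direction 0 = 0 := by simp [direction]

lemma norm_direction {X : Space} (hX : X ≠ 0) : ‖direction X‖ = 1 := by
  rw [direction, norm_smul, norm_inv, norm_norm, inv_mul_cancel₀ (norm_ne_zero_iff.2 hX)]

lemma norm_direction_le (X : Space) : ‖direction X‖ ≤ 1 := by
  by_cases hX : X = 0
  · simp [hX, direction_zero]
  · exact (norm_direction hX).le

lemma norm_smul_direction (X : Space) : ‖X‖ • direction X = X := by
  by_cases hX : X = 0
  · simp [hX]
  · rw [direction, smul_smul, mul_inv_cancel₀ (norm_ne_zero_iff.2 hX), one_smul]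

lemma abs_direction_le (X : Space) (i : Fin 3) : |direction X i| ≤ 1 :=
  (PiLp.norm_apply_le (direction X) i).trans (norm_direction_le X)

lemma inner_direction_self (X : Space) : inner ℝ (direction X) X = ‖X‖ := by
  by_cases hX : X = 0
  · simp [hX]
  · rw [direction, real_inner_smul_left, real_inner_self_eq_norm_sq]
    field_simp [norm_ne_zero_iff.2 hX]

lemma hasFDerivAt_norm {X : Space} (hX : X ≠ 0) :
    HasFDerivAt (fun Y : Space => ‖Y‖) (innerSL ℝ (direction X)) X := by
  have h1 : HasFDerivAt (fun Y : Space => √(‖Y‖ ^ 2)) _ X :=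
    ((hasStrictFDerivAt_norm_sq X).hasFDerivAt).sqrt
      (pow_ne_zero 2 (norm_ne_zero_iff.2 hX))
  simp only [Real.sqrt_sq (norm_nonneg _)] at h1
  refine h1.congr_fderiv ?_
  ext v
  simp [direction]
  ring

lemma hasFDerivAt_direction {X : Space} (hX : X ≠ 0) :
    HasFDerivAt direction (‖X‖⁻¹ • (ContinuousLinearMap.id ℝ Space -
      (innerSL ℝ (direction X)).smulRight (direction X))) X := by
  have h1 := ((hasDerivAt_inv (norm_ne_zero_iff.2 hX)).comp_hasFDerivAt X
    (hasFDerivAt_norm hX)).smul (hasFDerivAt_id X)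
  refine h1.congr_fderiv ?_
  ext1 v
  have h2 : direction X = ‖X‖⁻¹ • X := rfl
  simp [h2, smul_smul, smul_sub]
  rw [sub_eq_add_neg, ← neg_smul]
  congr 2
  field_simp
  rw [neg_smul]

lemma hasFDerivAt_direction_snd (t : ℝ) {X : Space} (hX : X ≠ 0) :
    HasFDerivAt (fun p : ℝ × Space => direction p.2)
      ((‖X‖⁻¹ • (ContinuousLinearMap.id ℝ Space -
        (innerSL ℝ (direction X)).smulRight (direction X))).comp
          (ContinuousLinearMap.snd ℝ ℝ Space)) (t, X) :=
  HasFDerivAt.comp (g := direction) (t, X) (hasFDerivAt_direction hX) hasFDerivAt_snd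

lemma continuousOn_direction : ContinuousOn direction {0}ᶜ := fun _ hX =>
  (hasFDerivAt_direction hX).continuousAt.continuousWithinAt

/-- This needs neither openness nor unique differentiability of `s`. Finite dimension of the source
allows continuity of the derivative to be tested one vector at a time. -/
lemma contDiffOn_one_of_hasFDerivWithinAt {E F : Type*} [NormedAddCommGroup E] [NormedSpace ℝ E]
    [FiniteDimensional ℝ E] [NormedAddCommGroup F] [NormedSpace ℝ F] {s : Set E} {f : E → F}
    {f' : E → E →L[ℝ] F} (h : ∀ x ∈ s, HasFDerivWithinAt f (f' x) s x)
    (hc : ∀ v, ContinuousOn (fun x => f' x v) s) : ContDiffOn ℝ 1 f s := by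
  have h1 : ContinuousOn f' s := continuousOn_clm_apply.2 hc
  rw [show (1 : WithTop ℕ∞) = 0 + 1 by norm_num, contDiffOn_succ_iff_hasFDerivWithinAt (by simp)]
  intro x hx
  refine ⟨s, ?_, by simp, f', h, contDiffOn_zero.2 h1⟩
  rw [insert_eq_of_mem hx]
  exact self_mem_nhdsWithin

/-- The linear map `(τ, V) ↦ τ a + L V` on space-time. -/
noncomputable def spaceTimeCLM {F : Type*} [NormedAddCommGroup F] [NormedSpace ℝ F] (a : F)
    (L : Space →L[ℝ] F) : ℝ × Space →L[ℝ] F :=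
  (ContinuousLinearMap.fst ℝ ℝ Space).smulRight a + L.comp (ContinuousLinearMap.snd ℝ ℝ Space)

@[simp] lemma spaceTimeCLM_apply {F : Type*} [NormedAddCommGroup F] [NormedSpace ℝ F] (a : F)
    (L : Space →L[ℝ] F) (v : ℝ × Space) : spaceTimeCLM a L v = v.1 • a + L v.2 := by
  simp [spaceTimeCLM]

lemma norm_mem_Icc {X : Space} (hX : X ∈ refBody) : ‖X‖ ∈ Icc (0 : ℝ) 1 :=
  ⟨norm_nonneg X, mem_closedBall_zero_iff.1 hX⟩

lemma mapsTo_norm (I : Set ℝ) :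
    MapsTo (fun p : ℝ × Space => (p.1, ‖p.2‖)) (I ×ˢ refBody) (I ×ˢ Icc (0 : ℝ) 1) :=
  fun _ hp => ⟨hp.1, norm_mem_Icc hp.2⟩

section

variable {I : Set ℝ} {f ft fR : ℝ → ℝ → ℝ}

lemma continuousOn_comp_norm {c : ℝ → ℝ → ℝ}
    (hc : ContinuousOn (fun p : ℝ × ℝ => c p.1 p.2) (I ×ˢ Icc (0 : ℝ) 1)) :
    ContinuousOn (fun p : ℝ × Space => c p.1 ‖p.2‖) (I ×ˢ refBody) :=
  hc.comp (by fun_prop : Continuous fun p : ℝ × Space => (p.1, ‖p.2‖)).continuousOn (mapsTo_norm I)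

/-- The product of a radial function vanishing at the centre and a bounded field that is continuous
away from the centre is continuous. -/
lemma continuousOn_comp_norm_smul {F : Type*} [NormedAddCommGroup F] [NormedSpace ℝ F]
    {c : ℝ → ℝ → ℝ} (hc : ContinuousOn (fun p : ℝ × ℝ => c p.1 p.2) (I ×ˢ Icc (0 : ℝ) 1))
    (h0 : ∀ t ∈ I, c t 0 = 0) {b : Space → F} (hb : ContinuousOn b {0}ᶜ) {C : ℝ}
    (hC : ∀ X, ‖b X‖ ≤ C) :
    ContinuousOn (fun p : ℝ × Space => c p.1 ‖p.2‖ • b p.2) (I ×ˢ refBody) := by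
  rintro ⟨t, X⟩ hp
  have h1 := continuousOn_comp_norm hc (t, X) hp
  by_cases hX : X = 0
  · subst hX
    have h2 : Tendsto (fun p : ℝ × Space => c p.1 ‖p.2‖) (𝓝[I ×ˢ refBody] (t, 0)) (𝓝 0) := by
      have := h1.tendsto
      simpa [h0 t hp.1] using this
    have h3 : Tendsto (fun p : ℝ × Space => c p.1 ‖p.2‖ • b p.2) (𝓝[I ×ˢ refBody] (t, 0)) (𝓝 0) :=
      h2.zero_smul_isBoundedUnder_le
        (isBoundedUnder_of_eventually_le (a := C) (Eventually.of_forall fun p => hC p.2))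
    rw [ContinuousWithinAt]
    simpa [h0 t hp.1] using h3
  · have h2 : ContinuousAt (fun p : ℝ × Space => b p.2) (t, X) :=
      (hb.continuousAt (isOpen_compl_singleton.mem_nhds hX)).comp (f := Prod.snd) (x := (t, X))
        continuous_snd.continuousAt
    exact h1.smul h2.continuousWithinAt

/-- The norm is not differentiable at 0. If f_R(t, 0) = 0, however, the linear part of f there
involves time only, and the remainder in (t, |X|) is also a remainder in (t, X). -/
lemma HasRadialFDeriv.hasFDerivWithinAt_comp_norm (h : HasRadialFDeriv I f ft fR) {t : ℝ}
    {X : Space} (ht : t ∈ I) (hX : X ∈ refBody) (hc : X ≠ 0 ∨ fR t 0 = 0) :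
    HasFDerivWithinAt (fun p : ℝ × Space => f p.1 ‖p.2‖)
      (spaceTimeCLM (ft t ‖X‖) (fR t ‖X‖ • innerSL ℝ (direction X))) (I ×ˢ refBody) (t, X) := by
  have h1 := h.hasFDerivWithinAt t ht ‖X‖ (norm_mem_Icc hX)
  by_cases hX0 : X = 0
  · subst hX0
    have h0 : fR t 0 = 0 := hc.resolve_left (by simp)
    rw [norm_zero, hasFDerivWithinAt_iff_isLittleO] at h1
    have h2 : Tendsto (fun p : ℝ × Space => (p.1, ‖p.2‖)) (𝓝[I ×ˢ refBody] (t, 0))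
        (𝓝[I ×ˢ Icc (0 : ℝ) 1] (t, 0)) := by
      have h3 : ContinuousWithinAt (fun p : ℝ × Space => (p.1, ‖p.2‖)) (I ×ˢ refBody) (t, 0) :=
        (by fun_prop : Continuous fun p : ℝ × Space => (p.1, ‖p.2‖)).continuousWithinAt
      have h4 := h3.tendsto_nhdsWithin (mapsTo_norm I)
      simpa using h4
    have h5 := h1.comp_tendsto h2
    rw [hasFDerivWithinAt_iff_isLittleO]
    refine (h5.congr_left fun p => ?_).trans_isBigO (Asymptotics.IsBigO.of_bound 1 ?_)
    · simp [h0, direction_zero, mul_comm]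
    · refine Eventually.of_forall fun p => ?_
      simp [Prod.norm_def]
  · have h3 : HasFDerivAt (fun p : ℝ × Space => (p.1, ‖p.2‖))
        ((ContinuousLinearMap.fst ℝ ℝ Space).prod
          ((innerSL ℝ (direction X)).comp (ContinuousLinearMap.snd ℝ ℝ Space))) (t, X) :=
      hasFDerivAt_fst.prodMk ((hasFDerivAt_norm hX0).comp (t, X) hasFDerivAt_snd)
    refine (h1.comp (t, X) h3.hasFDerivWithinAt (mapsTo_norm I)).congr_fderiv ?_
    ext <;> simp

lemma HasRadialFDeriv.contDiffOn_comp_norm (h : HasRadialFDeriv I f ft fR)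
    (h0 : ∀ t ∈ I, fR t 0 = 0) :
    ContDiffOn ℝ 1 (fun p : ℝ × Space => f p.1 ‖p.2‖) (I ×ˢ refBody) := by
  refine contDiffOn_one_of_hasFDerivWithinAt
    (fun p hp => h.hasFDerivWithinAt_comp_norm hp.1 hp.2 (.inr (h0 _ hp.1))) fun v => ?_
  simp only [spaceTimeCLM_apply]
  refine ((continuousOn_comp_norm h.continuousOn_time).const_smul v.1).add ?_
  exact continuousOn_comp_norm_smul (b := fun X => inner ℝ (direction X) v.2) (C := ‖v.2‖)
    h.continuousOn_radial h0 (continuousOn_direction.inner continuousOn_const) fun X =>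
    (norm_inner_le_norm _ _).trans (mul_le_of_le_one_left (norm_nonneg _) (norm_direction_le X))

/-- The linear map with eigenvalue `a` in the direction of the unit vector `e` and eigenvalue `b`
on its orthogonal complement. -/
noncomputable def axialCLM (a b : ℝ) (e : Space) : Space →L[ℝ] Space :=
  b • ContinuousLinearMap.id ℝ Space + (a - b) • (innerSL ℝ e).smulRight e

lemma axialCLM_apply (a b : ℝ) (e v : Space) :
    axialCLM a b e v = b • v + (a - b) • (inner ℝ e v : ℝ) • e := by
  simp [axialCLM]

/-- The space-time derivative of the radial vector field `f(t, |X|) X / |X|`. -/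
lemma HasRadialFDeriv.hasFDerivWithinAt_smul_direction (h : HasRadialFDeriv I f ft fR)
    (h0 : ∀ t ∈ I, f t 0 = 0) {t : ℝ} {X : Space} (ht : t ∈ I)
    (hX : X ∈ refBody) :
    HasFDerivWithinAt (fun p : ℝ × Space => f p.1 ‖p.2‖ • direction p.2)
      (spaceTimeCLM (ft t ‖X‖ • direction X)
        (axialCLM (fR t ‖X‖) (radialQuotient f (fun t => fR t 0) t ‖X‖) (direction X)))
      (I ×ˢ refBody) (t, X) := by
  by_cases hX0 : X = 0
  · subst hX0
    have h1 := continuousOn_comp_norm (h.continuousOn_radialQuotient h0) (t, 0) ⟨ht, hX⟩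
    simp only [ContinuousWithinAt, norm_zero] at h1
    have h2 : (fun p : ℝ × Space => radialQuotient f (fun t => fR t 0) p.1 ‖p.2‖
        - radialQuotient f (fun t => fR t 0) t 0) =o[𝓝[I ×ˢ refBody] (t, 0)]
          fun _ => (1 : ℝ) := by
      rw [Asymptotics.isLittleO_one_iff]
      simpa using h1.sub_const (radialQuotient f (fun t => fR t 0) t 0)
    have h3 : (fun p : ℝ × Space => p.2) =O[𝓝[I ×ˢ refBody] (t, 0)]
        fun p : ℝ × Space => p - (t, 0) := by
      refine Asymptotics.IsBigO.of_bound 1 (Eventually.of_forall fun p => ?_)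
      simp [Prod.norm_def]
    have h4 := h2.smul_isBigO h3
    rw [hasFDerivWithinAt_iff_isLittleO]
    -- At the centre f e - f_R(t, 0) Y = (f/|Y| - f_R(t, 0)) Y, a quantity tending to 0 times Y. The
    -- time part drops out because `direction 0 = 0`.
    refine (h4.congr_left fun p => ?_).congr_right fun p => one_smul _ _
    by_cases hp : p.2 = 0
    · simp [hp, direction_zero]
    · simp only [spaceTimeCLM_apply, direction_zero, norm_zero, axialCLM_apply,
        radialQuotient_of_ne _ _ (norm_ne_zero_iff.2 hp)]
      simp [direction, sub_smul, smul_smul, div_eq_mul_inv]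
  · have h1 := h.hasFDerivWithinAt_comp_norm ht hX (.inl hX0)
    have h2 := hasFDerivAt_direction_snd t hX0
    refine (h1.smul h2.hasFDerivWithinAt).congr_fderiv ?_
    rw [radialQuotient_of_ne _ _ (norm_ne_zero_iff.2 hX0)]
    refine ContinuousLinearMap.ext fun v => ?_
    simp only [axialCLM_apply, add_apply, smul_apply, ContinuousLinearMap.smulRight_apply,
      ContinuousLinearMap.comp_apply, spaceTimeCLM_apply, ContinuousLinearMap.coe_snd',
      sub_apply, ContinuousLinearMap.id_apply, innerSL_apply_apply, smul_eq_mul]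
    module

/-- The spatial derivative is (f/R) V + (f_R - f/R) ⟨e, V⟩ e. The discontinuous factor ⟨e, V⟩ e is
bounded and its coefficient vanishes at the centre, as does f_t in front of e. No condition on
f_R(t, 0) is needed. -/
lemma HasRadialFDeriv.contDiffOn_smul_direction (h : HasRadialFDeriv I f ft fR)
    (hI : UniqueDiffOn ℝ I) (h0 : ∀ t ∈ I, f t 0 = 0) :
    ContDiffOn ℝ 1 (fun p : ℝ × Space => f p.1 ‖p.2‖ • direction p.2) (I ×ˢ refBody) := by
  refine contDiffOn_one_of_hasFDerivWithinAt
    (fun p hp => h.hasFDerivWithinAt_smul_direction h0 hp.1 hp.2) fun v => ?_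
  have hq := h.continuousOn_radialQuotient h0
  have h1 := continuousOn_comp_norm_smul (C := 1) h.continuousOn_time (h.time_eq_zero hI h0)
    continuousOn_direction norm_direction_le
  have h2 := continuousOn_comp_norm_smul (C := ‖v.2‖)
    (c := fun t R => fR t R - radialQuotient f (fun t => fR t 0) t R)
    (b := fun X => (inner ℝ (direction X) v.2 : ℝ) • direction X) (h.continuousOn_radial.sub hq)
    (fun t _ => by simp [radialQuotient_zero])
    (ContinuousOn.smul (f := fun X => (inner ℝ (direction X) v.2 : ℝ))
      (continuousOn_direction.inner continuousOn_const) continuousOn_direction) fun X => by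
      rw [norm_smul]
      have e1 := norm_inner_le_norm (𝕜 := ℝ) (direction X) v.2
      have e2 := norm_direction_le X
      have e3 := mul_le_of_le_one_left (norm_nonneg v.2) e2
      exact (mul_le_of_le_one_right (norm_nonneg _) e2).trans (e1.trans e3)
  have h3 : ContinuousOn (fun p : ℝ × Space => radialQuotient f (fun t => fR t 0) p.1 ‖p.2‖ • v.2)
      (I ×ˢ refBody) := (continuousOn_comp_norm hq).smul continuousOn_const
  refine ((h1.const_smul v.1).add (h3.add h2)).congr fun p _ => ?_
  simp [axialCLM_apply]

/-- The space-time derivative of the components of the radial tensor field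
`f(t, |X|) (X ⊗ X) / |X|²`. -/
lemma HasRadialFDeriv.hasFDerivWithinAt_mul_direction_mul (h : HasRadialFDeriv I f ft fR)
    (hI : UniqueDiffOn ℝ I) (h0 : ∀ t ∈ I, f t 0 = 0) (h1 : ∀ t ∈ I, fR t 0 = 0) (i j : Fin 3)
    {t : ℝ} {X : Space} (ht : t ∈ I) (hX : X ∈ refBody) :
    HasFDerivWithinAt (fun p : ℝ × Space => f p.1 ‖p.2‖ * (direction p.2 i * direction p.2 j))
      (spaceTimeCLM (ft t ‖X‖ * (direction X i * direction X j))
        ((fR t ‖X‖ - 2 * radialQuotient f (fun t => fR t 0) t ‖X‖) •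
            (direction X i * direction X j) • innerSL ℝ (direction X)
          + radialQuotient f (fun t => fR t 0) t ‖X‖ •
            (direction X j • EuclideanSpace.proj i + direction X i • EuclideanSpace.proj j)))
      (I ×ˢ refBody) (t, X) := by
  have h2 := h.hasFDerivWithinAt_comp_norm ht hX (.inr (h1 t ht))
  by_cases hX0 : X = 0
  · subst hX0
    rw [hasFDerivWithinAt_iff_isLittleO] at h2 ⊢
    -- With f, f_t and f_R all zero at the centre, the remainder of f is f itself, and it dominates
    -- f e_i e_j because |e_i e_j| ≤ 1.
    refine Asymptotics.IsBigO.trans_isLittleO (Asymptotics.IsBigO.of_bound 1 ?_) h2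
    refine Eventually.of_forall fun p => ?_
    simp [h0 t ht, direction_zero, h.time_eq_zero hI h0 t ht]
    exact mul_le_of_le_one_right (abs_nonneg _)
      (mul_le_one₀ (abs_direction_le _ _) (abs_nonneg _) (abs_direction_le _ _))
  · have h4 := fun k => (EuclideanSpace.proj k : Space →L[ℝ] ℝ).hasFDerivAt.comp (t, X)
      (hasFDerivAt_direction_snd t hX0)
    refine (h2.mul ((h4 i).mul (h4 j)).hasFDerivWithinAt).congr_fderiv ?_
    rw [radialQuotient_of_ne _ _ (norm_ne_zero_iff.2 hX0)]
    refine ContinuousLinearMap.ext fun v => ?_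
    simp
    ring

lemma HasRadialFDeriv.contDiffOn_mul_direction_mul (h : HasRadialFDeriv I f ft fR)
    (hI : UniqueDiffOn ℝ I) (h0 : ∀ t ∈ I, f t 0 = 0) (h1 : ∀ t ∈ I, fR t 0 = 0) (i j : Fin 3) :
    ContDiffOn ℝ 1 (fun p : ℝ × Space => f p.1 ‖p.2‖ * (direction p.2 i * direction p.2 j))
      (I ×ˢ refBody) := by
  refine contDiffOn_one_of_hasFDerivWithinAt
    (fun p hp => h.hasFDerivWithinAt_mul_direction_mul hI h0 h1 i j hp.1 hp.2) fun v => ?_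
  have hq := h.continuousOn_radialQuotient h0
  have hq0 : ∀ t ∈ I, radialQuotient f (fun t => fR t 0) t 0 = 0 := fun t ht => by
    rw [radialQuotient_zero, h1 t ht]
  have hcomp : ∀ k, ContinuousOn (fun X => direction X k) {0}ᶜ := fun k =>
    (EuclideanSpace.proj k : Space →L[ℝ] ℝ).continuous.comp_continuousOn
      continuousOn_direction
  have hle : ∀ X, |direction X i * direction X j| ≤ 1 := fun X => by
    rw [abs_mul]
    exact mul_le_one₀ (abs_direction_le _ _) (abs_nonneg _) (abs_direction_le _ _)
  have e1 := continuousOn_comp_norm_smul (C := 1) h.continuousOn_time (h.time_eq_zero hI h0)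
    ((hcomp i).mul (hcomp j)) hle
  have e2 := continuousOn_comp_norm_smul (C := ‖v.2‖)
    (c := fun t R => fR t R - 2 * radialQuotient f (fun t => fR t 0) t R)
    (b := fun X => direction X i * direction X j * inner ℝ (direction X) v.2)
    (h.continuousOn_radial.sub (continuousOn_const.mul hq))
    (fun t ht => by rw [hq0 t ht, h1 t ht, mul_zero, sub_zero])
    (((hcomp i).mul (hcomp j)).mul (continuousOn_direction.inner continuousOn_const)) fun X => by
      rw [norm_mul]
      have e3 := mul_le_of_le_one_left (norm_nonneg v.2) (norm_direction_le X)
      exact (mul_le_of_le_one_left (norm_nonneg _) (hle X)).trans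
        ((norm_inner_le_norm (𝕜 := ℝ) (direction X) v.2).trans e3)
  have e3 := continuousOn_comp_norm_smul (C := |v.2 i| + |v.2 j|) hq hq0
    (b := fun X => direction X j * v.2 i + direction X i * v.2 j)
    (((hcomp j).mul continuousOn_const).add ((hcomp i).mul continuousOn_const)) fun X => by
      refine (norm_add_le _ _).trans (add_le_add ?_ ?_)
      · rw [norm_mul]
        exact mul_le_of_le_one_left (norm_nonneg _) (abs_direction_le _ _)
      · rw [norm_mul]
        exact mul_le_of_le_one_left (norm_nonneg _) (abs_direction_le _ _)
  refine ((e1.const_smul v.1).add (e2.add e3)).congr fun p _ => ?_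
  simp
  ring

end

/-! ### Inverses of `C¹` maps on sets that need not be open -/

/-- A properness argument. Near f x the values of `g` stay in a compact set, so along any
ultrafilter they converge to some x'. Continuity gives f x' = f x, and the left inverse forces x' =
x. -/
lemma continuousOn_of_leftInvOn {X Y : Type*} [TopologicalSpace X] [TopologicalSpace Y] [T2Space Y]
    {f : X → Y} {g : Y → X} {s : Set X} (hf : ContinuousOn f s) (hg : LeftInvOn g f s)
    (hC : ∀ x ∈ s, ∃ C ⊆ s, IsCompact C ∧ ∀ᶠ y in 𝓝[f '' s] (f x), g y ∈ C) :
    ContinuousOn g (f '' s) := by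
  rintro _ ⟨x, hx, rfl⟩
  obtain ⟨C, hCs, hCc, hC⟩ := hC x hx
  rw [ContinuousWithinAt, hg hx, tendsto_iff_ultrafilter]
  intro U hU
  have h1 : C ∈ U.map g := hU hC
  obtain ⟨x', hx', hUx'⟩ := hCc.ultrafilter_le_nhds' (U.map g) h1
  have h2 : Tendsto f (U.map g : Filter X) (𝓝 (f x')) := by
    refine ((hf x' (hCs hx')).mono hCs).tendsto.mono_left (le_inf hUx' ?_)
    exact le_principal_iff.2 h1
  have h3 : Tendsto (f ∘ g) U (𝓝 (f x')) := h2.comp tendsto_map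
  have h4 : Tendsto (f ∘ g) U (𝓝 (f x)) := by
    have h5 : Tendsto id (U : Filter Y) (𝓝 (f x)) := hU.trans inf_le_left
    refine h5.congr' ?_
    have : f '' s ∈ (U : Filter Y) := hU self_mem_nhdsWithin
    filter_upwards [this]
    rintro _ ⟨z, hz, rfl⟩
    simp [hg hz]
  have h5 : f x' = f x := tendsto_nhds_unique h3 h4
  have h6 : x' = x := by rw [← hg (hCs hx'), h5, hg hx]
  rw [h6] at hUx'
  exact hUx'

lemma exists_continuousLinearEquiv {E : Type*} [NormedAddCommGroup E] [NormedSpace ℝ E]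
    [FiniteDimensional ℝ E] {L : E →L[ℝ] E} (hL : Function.Injective L) :
    ∃ e : E ≃L[ℝ] E, (e : E →L[ℝ] E) = L :=
  ⟨(LinearEquiv.ofInjectiveEndo (L : E →ₗ[ℝ] E) hL).toContinuousLinearEquiv, by ext; rfl⟩

/-- The inverse and its continuity are given, so only the formula for its derivative is needed from
inverse function theory. That part works on sets that are not open, and inversion of linear maps is
continuous at invertible ones. -/
lemma contDiffOn_of_leftInvOn {E : Type*} [NormedAddCommGroup E] [NormedSpace ℝ E]
    [FiniteDimensional ℝ E] {f g : E → E} {s : Set E} (hs : UniqueDiffOn ℝ s)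
    (hf : ContDiffOn ℝ 1 f s) (hinj : ∀ x ∈ s, Function.Injective (fderivWithin ℝ f s x))
    (hg : LeftInvOn g f s) (hgc : ContinuousOn g (f '' s)) : ContDiffOn ℝ 1 g (f '' s) := by
  have hmaps : MapsTo g (f '' s) s := by
    rintro _ ⟨x, hx, rfl⟩
    rwa [hg hx]
  refine contDiffOn_one_of_hasFDerivWithinAt
    (f' := fun y => ContinuousLinearMap.inverse (fderivWithin ℝ f s (g y))) ?_ fun v => ?_
  · rintro _ ⟨x, hx, rfl⟩
    obtain ⟨e, he⟩ := exists_continuousLinearEquiv (hinj x hx)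
    have h1 : HasFDerivWithinAt f (e : E →L[ℝ] E) s (g (f x)) := by
      rw [he, hg hx]
      exact (hf.differentiableOn one_ne_zero x hx).hasFDerivWithinAt
    rw [hg hx, ← he, ContinuousLinearMap.inverse_equiv]
    refine h1.of_local_left_inverse ?_ (mem_image_of_mem f hx) ?_
    · exact (hgc (f x) (mem_image_of_mem f hx)).tendsto_nhdsWithin hmaps
    · filter_upwards [self_mem_nhdsWithin]
      rintro _ ⟨z, hz, rfl⟩
      rw [hg hz]
  · refine ContinuousOn.clm_apply ?_ continuousOn_const
    have h2 : ContinuousOn (fun y => fderivWithin ℝ f s (g y)) (f '' s) :=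
      (hf.continuousOn_fderivWithin hs le_rfl).comp hgc hmaps
    intro y hy
    obtain ⟨e, he⟩ := exists_continuousLinearEquiv (hinj (g y) (hmaps hy))
    have h3 : ContinuousAt ContinuousLinearMap.inverse (fderivWithin ℝ f s (g y)) := by
      rw [← he]
      exact (contDiffAt_map_inverse (n := 0) e).continuousAt
    exact h3.comp_continuousWithinAt (f := fun y => fderivWithin ℝ f s (g y)) (h2 y hy)

/-- Used for the world tube of the body, so that the `fderivWithin` in the Eulerian system is
determined by any derivative that can be exhibited. -/
lemma uniqueDiffOn_image_of_injective {E : Type*} [NormedAddCommGroup E] [NormedSpace ℝ E]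
    [FiniteDimensional ℝ E] {f : E → E} {s : Set E} (hs : UniqueDiffOn ℝ s)
    (hf : DifferentiableOn ℝ f s) (hinj : ∀ x ∈ s, Function.Injective (fderivWithin ℝ f s x)) :
    UniqueDiffOn ℝ (f '' s) := by
  refine hs.image (fun x hx => (hf x hx).hasFDerivWithinAt) fun x hx => ?_
  obtain ⟨e, he⟩ := exists_continuousLinearEquiv (hinj x hx)
  rw [← he]
  exact e.surjective.denseRange

/-! ### Axial linear maps -/

/-- The alternative a = b covers the centre of the body, where `direction` is 0 but the two
stretches coincide. -/
lemma axialCLM_inv_apply {a b : ℝ} (ha : a ≠ 0) (hb : b ≠ 0) {e : Space} (he : ‖e‖ = 1 ∨ a = b)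
    (v : Space) : axialCLM a⁻¹ b⁻¹ e (axialCLM a b e v) = v := by
  rcases he with he | rfl
  · have h1 : inner ℝ e e = (1 : ℝ) := by rw [real_inner_self_eq_norm_sq, he, one_pow]
    simp only [axialCLM_apply, smul_add, smul_smul, inner_add_right, inner_smul_right, h1]
    rw [inv_mul_cancel₀ hb, one_smul, add_assoc, ← add_smul]
    have : b⁻¹ * ((a - b) * inner ℝ e v)
        + (a⁻¹ - b⁻¹) * (b * inner ℝ e v + (a - b) * (inner ℝ e v * 1)) = 0 := by
      field_simp
      ring
    simp only [← mul_assoc] at this ⊢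
    rw [this, zero_smul, add_zero]
  · simp [axialCLM_apply, smul_smul, ha]

lemma axialCLM_apply_inv {a b : ℝ} (ha : a ≠ 0) (hb : b ≠ 0) {e : Space} (he : ‖e‖ = 1 ∨ a = b)
    (v : Space) : axialCLM a b e (axialCLM a⁻¹ b⁻¹ e v) = v := by
  have := axialCLM_inv_apply (inv_ne_zero ha) (inv_ne_zero hb)
    (he.imp_right fun h => by rw [h]) v
  rwa [inv_inv, inv_inv] at this

lemma axialCLM_stdVec (a b : ℝ) (e : Space) (i j : Fin 3) :
    axialCLM a b e (stdVec j) i = axialMatrix a b e i j := by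
  simp only [axialCLM_apply, axialMatrix_apply, Matrix.one_apply, PiLp.add_apply, PiLp.smul_apply,
    stdVec_apply, smul_eq_mul]
  have : inner ℝ e (stdVec j) = e j := by
    rw [stdVec, EuclideanSpace.inner_single_right]
    simp
  rw [this]
  ring

lemma uniqueDiffOn_refBody : UniqueDiffOn ℝ refBody := by
  refine uniqueDiffOn_convex (convex_closedBall 0 1) ?_
  rw [refBody, interior_closedBall _ one_ne_zero]
  exact Metric.nonempty_ball.2 one_pos

/-! ### The flow of a radial motion -/

/-- The motion on space-time. -/
noncomputable def spaceTimeMotion (φ : ℝ → ℝ → ℝ) (p : ℝ × Space) : ℝ × Space :=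
  (p.1, radialMotion φ p.1 p.2)

/-- The inverse of `radialMotion φ t`. -/
noncomputable def inverseMotion (φ : ℝ → ℝ → ℝ) (t : ℝ) : Space → Space :=
  Function.invFunOn (radialMotion φ t) refBody

/-- The inverse of the motion on space-time. -/
noncomputable def spaceTimeInverse (φ : ℝ → ℝ → ℝ) (p : ℝ × Space) : ℝ × Space :=
  (p.1, inverseMotion φ p.1 p.2)

lemma radialMotion_eq (φ : ℝ → ℝ → ℝ) (t : ℝ) (X : Space) :
    radialMotion φ t X = φ t ‖X‖ • direction X := by
  rw [radialMotion, direction, smul_smul, div_eq_mul_inv]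

/-- A `C²` function `φ` on `I × [0, 1]` that defines a regular radial motion. -/
structure IsRadialFlow (I : Set ℝ) (φ φt φR φtt φtR φRR : ℝ → ℝ → ℝ) : Prop
    extends HasRadialFDeriv2 I φ φt φR φtt φtR φRR where
  uniqueDiffOn : UniqueDiffOn ℝ I
  exists_compact : ∀ t ∈ I, ∃ C ⊆ I, IsCompact C ∧ C ∈ 𝓝[I] t
  map_zero : ∀ t ∈ I, φ t 0 = 0
  radial2_zero : ∀ t ∈ I, φRR t 0 = 0
  radial_pos : ∀ t ∈ I, ∀ R ∈ Icc (0 : ℝ) 1, 0 < φR t R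

/-- The stretch `φ / R`, in terms of the radial derivative `φR`. -/
noncomputable abbrev stretchOf (φ φR : ℝ → ℝ → ℝ) : ℝ → ℝ → ℝ := radialQuotient φ fun t => φR t 0

namespace IsRadialFlow

variable {I : Set ℝ} {φ φt φR φtt φtR φRR : ℝ → ℝ → ℝ}

lemma strictMonoOn (h : IsRadialFlow I φ φt φR φtt φtR φRR) {t : ℝ} (ht : t ∈ I) :
    StrictMonoOn (φ t) (Icc 0 1) := by
  refine strictMonoOn_of_deriv_pos (convex_Icc 0 1)
    (fun R hR => (h.self.hasDerivWithinAt_radial ht hR).continuousWithinAt) fun R hR => ?_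
  rw [interior_Icc] at hR
  have h1 := (h.self.hasDerivWithinAt_radial ht (Ioo_subset_Icc_self hR)).hasDerivAt
    (Icc_mem_nhds hR.1 hR.2)
  rw [h1.deriv]
  exact h.radial_pos t ht R (Ioo_subset_Icc_self hR)

lemma continuousOn_radius (h : IsRadialFlow I φ φt φR φtt φtR φRR) {t : ℝ} (ht : t ∈ I) :
    ContinuousOn (φ t) (Icc 0 1) :=
  fun _ hR => (h.self.hasDerivWithinAt_radial ht hR).continuousWithinAt

lemma pos (h : IsRadialFlow I φ φt φR φtt φtR φRR) {t R : ℝ} (ht : t ∈ I)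
    (hR : R ∈ Ioc (0 : ℝ) 1) : 0 < φ t R := by
  have := h.strictMonoOn ht ⟨le_rfl, zero_le_one⟩ (Ioc_subset_Icc_self hR) hR.1
  rwa [h.map_zero t ht] at this

lemma nonneg (h : IsRadialFlow I φ φt φR φtt φtR φRR) {t R : ℝ} (ht : t ∈ I)
    (hR : R ∈ Icc (0 : ℝ) 1) : 0 ≤ φ t R := by
  rcases hR.1.eq_or_lt with h0 | h0
  · rw [← h0, h.map_zero t ht]
  · exact (h.pos ht ⟨h0, hR.2⟩).le

lemma stretch_pos (h : IsRadialFlow I φ φt φR φtt φtR φRR) {t R : ℝ} (ht : t ∈ I)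
    (hR : R ∈ Icc (0 : ℝ) 1) : 0 < stretchOf φ φR t R := by
  by_cases h0 : R = 0
  · rw [h0, stretchOf, radialQuotient_zero]
    exact h.radial_pos t ht 0 ⟨le_rfl, zero_le_one⟩
  · rw [stretchOf, radialQuotient_of_ne _ _ h0]
    have h1 : 0 < R := lt_of_le_of_ne hR.1 (Ne.symm h0)
    exact div_pos (h.pos ht ⟨h1, hR.2⟩) h1

lemma stretch_mul (h : IsRadialFlow I φ φt φR φtt φtR φRR) {t R : ℝ} (ht : t ∈ I) :
    stretchOf φ φR t R * R = φ t R := by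
  by_cases h0 : R = 0
  · rw [h0, mul_zero, h.map_zero t ht]
  · rw [stretchOf, radialQuotient_of_ne _ _ h0, div_mul_cancel₀ _ h0]

/-- At every point the radial direction is a unit vector or the two stretches agree. -/
lemma norm_direction_or (X : Space) (t : ℝ) :
    ‖direction X‖ = 1 ∨ φR t ‖X‖ = stretchOf φ φR t ‖X‖ := by
  by_cases hX : X = 0
  · right
    rw [hX, norm_zero, stretchOf, radialQuotient_zero]
  · exact .inl (norm_direction hX)

lemma norm_motion (h : IsRadialFlow I φ φt φR φtt φtR φRR) {t : ℝ} {X : Space} (ht : t ∈ I)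
    (hX : X ∈ refBody) : ‖radialMotion φ t X‖ = φ t ‖X‖ := by
  by_cases hX0 : X = 0
  · simp [radialMotion, hX0, h.map_zero t ht]
  · rw [radialMotion_eq, norm_smul, norm_direction hX0, mul_one, Real.norm_eq_abs,
      abs_of_nonneg (h.nonneg ht (norm_mem_Icc hX))]

lemma motion_eq_stretch_smul (h : IsRadialFlow I φ φt φR φtt φtR φRR) {t : ℝ} {X : Space}
    (ht : t ∈ I) : radialMotion φ t X = stretchOf φ φR t ‖X‖ • X := by
  rw [radialMotion_eq, ← h.stretch_mul ht, mul_smul, norm_smul_direction]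

lemma bijOn (h : IsRadialFlow I φ φt φR φtt φtR φRR) {t : ℝ} (ht : t ∈ I) :
    BijOn (radialMotion φ t) refBody (Metric.closedBall 0 (φ t 1)) := by
  refine ⟨fun X hX => ?_, fun X hX Y hY hXY => ?_, fun z hz => ?_⟩
  · rw [mem_closedBall_zero_iff, h.norm_motion ht hX]
    exact (h.strictMonoOn ht).monotoneOn (norm_mem_Icc hX) ⟨zero_le_one, le_rfl⟩ (norm_mem_Icc hX).2
  · have h1 : ‖X‖ = ‖Y‖ := by
      refine (h.strictMonoOn ht).injOn (norm_mem_Icc hX) (norm_mem_Icc hY) ?_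
      rw [← h.norm_motion ht hX, hXY, h.norm_motion ht hY]
    rw [h.motion_eq_stretch_smul ht, h.motion_eq_stretch_smul ht, ← h1] at hXY
    exact smul_right_injective _ (h.stretch_pos ht (norm_mem_Icc hX)).ne' hXY
  · rw [mem_closedBall_zero_iff] at hz
    have h1 : ‖z‖ ∈ Icc (φ t 0) (φ t 1) := ⟨by rw [h.map_zero t ht]; exact norm_nonneg z, hz⟩
    obtain ⟨R, hR, hRz⟩ := intermediate_value_Icc zero_le_one (h.continuousOn_radius ht) h1
    -- The preimage of z is R z/|z|, where R solves φ(t, R) = |z| by the intermediate value theorem.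
    -- For z = 0 this R is 0.
    have h2 : ‖R • direction z‖ = R ∧ φ t R • direction (R • direction z) = z := by
      by_cases hz0 : z = 0
      · have : R = 0 := by
          refine (h.strictMonoOn ht).injOn hR ⟨le_rfl, zero_le_one⟩ ?_
          rw [hRz, hz0, norm_zero, h.map_zero t ht]
        simp [this, hz0, h.map_zero t ht]
      · have e1 : ‖R • direction z‖ = R := by
          rw [norm_smul, norm_direction hz0, mul_one, Real.norm_eq_abs, abs_of_nonneg hR.1]
        have hR0 : R ≠ 0 := by
          rintro rfl
          rw [h.map_zero t ht] at hRz
          exact hz0 (norm_eq_zero.1 hRz.symm)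
        refine ⟨e1, ?_⟩
        rw [hRz, direction, e1, smul_smul R⁻¹, inv_mul_cancel₀ hR0, one_smul, norm_smul_direction]
    refine ⟨R • direction z, ?_, ?_⟩
    · rw [refBody, mem_closedBall_zero_iff, h2.1]
      exact hR.2
    · rw [radialMotion_eq, h2.1, h2.2]

lemma leftInvOn_inverseMotion (h : IsRadialFlow I φ φt φR φtt φtR φRR) {t : ℝ} (ht : t ∈ I) :
    LeftInvOn (inverseMotion φ t) (radialMotion φ t) refBody :=
  (h.bijOn ht).injOn.leftInvOn_invFunOn

lemma spaceTimeInverse_motion (h : IsRadialFlow I φ φt φR φtt φtR φRR) :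
    LeftInvOn (spaceTimeInverse φ) (spaceTimeMotion φ) (I ×ˢ refBody) := fun p hp => by
  simp [spaceTimeInverse, spaceTimeMotion, h.leftInvOn_inverseMotion hp.1 hp.2]

lemma image_spaceTimeMotion (h : IsRadialFlow I φ φt φR φtt φtR φRR) :
    spaceTimeMotion φ '' (I ×ˢ refBody) = {p | p.1 ∈ I ∧ p.2 ∈ Metric.closedBall 0 (φ p.1 1)} := by
  ext ⟨t, z⟩
  constructor
  · rintro ⟨⟨s, X⟩, ⟨hs, hX⟩, hp⟩
    obtain ⟨rfl, rfl⟩ := Prod.mk.inj hp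
    exact ⟨hs, (h.bijOn hs).mapsTo hX⟩
  · rintro ⟨ht, hz⟩
    obtain ⟨X, hX, hXz⟩ := (h.bijOn ht).surjOn hz
    exact ⟨(t, X), ⟨ht, hX⟩, Prod.ext rfl hXz⟩

lemma hasFDerivWithinAt_spatialMotion (h : IsRadialFlow I φ φt φR φtt φtR φRR) {t : ℝ} {X : Space}
    (ht : t ∈ I) (hX : X ∈ refBody) :
    HasFDerivWithinAt (fun p : ℝ × Space => radialMotion φ p.1 p.2)
      (spaceTimeCLM (φt t ‖X‖ • direction X)
        (axialCLM (φR t ‖X‖) (stretchOf φ φR t ‖X‖) (direction X))) (I ×ˢ refBody) (t, X) := by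
  simp only [radialMotion_eq φ]
  exact h.self.hasFDerivWithinAt_smul_direction h.map_zero ht hX

/-- The space-time derivative of the motion. -/
lemma hasFDerivWithinAt_motion (h : IsRadialFlow I φ φt φR φtt φtR φRR) {t : ℝ} {X : Space}
    (ht : t ∈ I) (hX : X ∈ refBody) :
    HasFDerivWithinAt (spaceTimeMotion φ)
      ((ContinuousLinearMap.fst ℝ ℝ Space).prod (spaceTimeCLM (φt t ‖X‖ • direction X)
        (axialCLM (φR t ‖X‖) (stretchOf φ φR t ‖X‖) (direction X)))) (I ×ˢ refBody) (t, X) := by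
  have h1 := h.hasFDerivWithinAt_spatialMotion ht hX
  exact hasFDerivWithinAt_fst.prodMk h1

lemma contDiffOn_spaceTimeMotion (h : IsRadialFlow I φ φt φR φtt φtR φRR) :
    ContDiffOn ℝ 1 (spaceTimeMotion φ) (I ×ˢ refBody) := by
  have h1 := h.self.contDiffOn_smul_direction h.uniqueDiffOn h.map_zero
  simp only [← radialMotion_eq φ] at h1
  exact contDiff_fst.contDiffOn.prodMk h1

lemma uniqueDiffOn_reference (h : IsRadialFlow I φ φt φR φtt φtR φRR) :
    UniqueDiffOn ℝ (I ×ˢ refBody) :=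
  h.uniqueDiffOn.prod uniqueDiffOn_refBody

/-- The derivative is block triangular: the identity in time, and an axial map with positive
eigenvalues in space. -/
lemma injective_fderivWithin_motion (h : IsRadialFlow I φ φt φR φtt φtR φRR) :
    ∀ p ∈ I ×ˢ refBody,
      Function.Injective (fderivWithin ℝ (spaceTimeMotion φ) (I ×ˢ refBody) p) := by
  rintro ⟨t, X⟩ ⟨ht, hX⟩
  rw [(h.hasFDerivWithinAt_motion ht hX).fderivWithin (h.uniqueDiffOn_reference _ ⟨ht, hX⟩),
    injective_iff_map_eq_zero]
  rintro ⟨τ, V⟩ hv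
  simp only [ContinuousLinearMap.prod_apply, ContinuousLinearMap.coe_fst', spaceTimeCLM_apply,
    Prod.mk_eq_zero] at hv
  obtain ⟨rfl, hv⟩ := hv
  rw [zero_smul, zero_add] at hv
  have h1 := axialCLM_inv_apply (h.radial_pos t ht _ (norm_mem_Icc hX)).ne'
    (h.stretch_pos ht (norm_mem_Icc hX)).ne' (norm_direction_or (φ := φ) (φR := φR) X t) V
  rw [hv, _root_.map_zero] at h1
  simp [← h1]

lemma uniqueDiffOn_image (h : IsRadialFlow I φ φt φR φtt φtR φRR) :
    UniqueDiffOn ℝ (spaceTimeMotion φ '' (I ×ˢ refBody)) :=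
  uniqueDiffOn_image_of_injective h.uniqueDiffOn_reference
    (h.contDiffOn_spaceTimeMotion.differentiableOn one_ne_zero) h.injective_fderivWithin_motion

lemma contDiffOn_spaceTimeInverse (h : IsRadialFlow I φ φt φR φtt φtR φRR) :
    ContDiffOn ℝ 1 (spaceTimeInverse φ) (spaceTimeMotion φ '' (I ×ˢ refBody)) := by
  refine contDiffOn_of_leftInvOn h.uniqueDiffOn_reference h.contDiffOn_spaceTimeMotion
    h.injective_fderivWithin_motion h.spaceTimeInverse_motion
    (continuousOn_of_leftInvOn h.contDiffOn_spaceTimeMotion.continuousOn h.spaceTimeInverse_motion ?_)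
  rintro ⟨t, X⟩ ⟨ht, hX⟩
  obtain ⟨C, hCI, hC, hCt⟩ := h.exists_compact t ht
  -- The motion preserves the time coordinate, so points with nearby images have times in a compact
  -- subset of I, while the reference body is itself compact.
  refine ⟨C ×ˢ refBody, prod_mono_left hCI, hC.prod (isCompact_closedBall 0 1), ?_⟩
  have h1 : Tendsto Prod.fst (𝓝[spaceTimeMotion φ '' (I ×ˢ refBody)] (spaceTimeMotion φ (t, X)))
      (𝓝[I] t) := by
    refine tendsto_nhdsWithin_iff.2 ⟨continuous_fst.continuousWithinAt.tendsto, ?_⟩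
    filter_upwards [self_mem_nhdsWithin]
    rintro _ ⟨p, hp, rfl⟩
    exact hp.1
  filter_upwards [h1 hCt, self_mem_nhdsWithin] with y hy hy'
  obtain ⟨p, hp, rfl⟩ := hy'
  rw [h.spaceTimeInverse_motion hp]
  exact ⟨hy, hp.2⟩

lemma hasFDerivWithinAt_radialMotion (h : IsRadialFlow I φ φt φR φtt φtR φRR) {t : ℝ} {X : Space}
    (ht : t ∈ I) (hX : X ∈ refBody) :
    HasFDerivWithinAt (radialMotion φ t)
      (axialCLM (φR t ‖X‖) (stretchOf φ φR t ‖X‖) (direction X)) refBody X := by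
  have h1 := h.hasFDerivWithinAt_spatialMotion ht hX
  have h2 : HasFDerivWithinAt (fun Y : Space => (t, Y)) (ContinuousLinearMap.inr ℝ ℝ Space)
      refBody X := (hasFDerivAt_prodMk_right t X).hasFDerivWithinAt
  refine (h1.comp X h2 fun Y hY => ⟨ht, hY⟩).congr_fderiv ?_
  refine ContinuousLinearMap.ext fun v => ?_
  simp

lemma deformationGradient_eq (h : IsRadialFlow I φ φt φR φtt φtR φRR) {t : ℝ} {X : Space}
    (ht : t ∈ I) (hX : X ∈ refBody) :
    deformationGradient (radialMotion φ) t X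
      = axialMatrix (φR t ‖X‖) (stretchOf φ φR t ‖X‖) (direction X) := by
  ext i j
  rw [deformationGradient, Matrix.of_apply,
    (h.hasFDerivWithinAt_radialMotion ht hX).fderivWithin (uniqueDiffOn_refBody X hX),
    axialCLM_stdVec]

end IsRadialFlow

/-! ### Eulerian description of fields on the reference body -/

/-- The Eulerian description of a field `f` on the reference body. -/
noncomputable def eulerian {F : Type*} (φ : ℝ → ℝ → ℝ) (f : ℝ → Space → F) (t : ℝ) (z : Space) : F :=
  f t (inverseMotion φ t z)

lemma sum_smul_stdVec (v : Space) : ∑ j, v j • stdVec j = v := by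
  ext i
  simp [Fin.sum_univ_three, stdVec_apply]
  fin_cases i <;> simp

namespace IsRadialFlow

variable {I : Set ℝ} {φ φt φR φtt φtR φRR : ℝ → ℝ → ℝ}
  {F : Type*} [NormedAddCommGroup F] [NormedSpace ℝ F]

lemma eulerian_motion {G : Type*} (h : IsRadialFlow I φ φt φR φtt φtR φRR) (f : ℝ → Space → G)
    {t : ℝ} {X : Space}
    (ht : t ∈ I) (hX : X ∈ refBody) : eulerian φ f t (radialMotion φ t X) = f t X := by
  rw [eulerian, h.leftInvOn_inverseMotion ht hX]

lemma mapsTo_spaceTimeInverse (h : IsRadialFlow I φ φt φR φtt φtR φRR) :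
    MapsTo (spaceTimeInverse φ) (spaceTimeMotion φ '' (I ×ˢ refBody)) (I ×ˢ refBody) := by
  rintro _ ⟨p, hp, rfl⟩
  rwa [h.spaceTimeInverse_motion hp]

lemma contDiffOn_eulerian (h : IsRadialFlow I φ φt φR φtt φtR φRR) {f : ℝ → Space → F}
    (hf : ContDiffOn ℝ 1 (fun p : ℝ × Space => f p.1 p.2) (I ×ˢ refBody)) :
    ContDiffOn ℝ 1 (fun p : ℝ × Space => eulerian φ f p.1 p.2)
      (spaceTimeMotion φ '' (I ×ˢ refBody)) :=
  hf.comp h.contDiffOn_spaceTimeInverse h.mapsTo_spaceTimeInverse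

lemma hasFDerivWithinAt_spaceTimeInverse (h : IsRadialFlow I φ φt φR φtt φtR φRR) {t : ℝ}
    {X : Space} (ht : t ∈ I) (hX : X ∈ refBody) :
    HasFDerivWithinAt (spaceTimeInverse φ)
      ((ContinuousLinearMap.fst ℝ ℝ Space).prod (spaceTimeCLM
        (-(φt t ‖X‖ / φR t ‖X‖) • direction X)
        (axialCLM (φR t ‖X‖)⁻¹ (stretchOf φ φR t ‖X‖)⁻¹ (direction X))))
      (spaceTimeMotion φ '' (I ×ˢ refBody)) (t, radialMotion φ t X) := by
  have hmem : (t, radialMotion φ t X) ∈ spaceTimeMotion φ '' (I ×ˢ refBody) :=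
    ⟨(t, X), ⟨ht, hX⟩, rfl⟩
  have h1 := (h.contDiffOn_spaceTimeInverse.differentiableOn one_ne_zero _ hmem).hasFDerivWithinAt
  refine h1.congr_fderiv ?_
  set D := fderivWithin ℝ (spaceTimeInverse φ) (spaceTimeMotion φ '' (I ×ˢ refBody))
    (t, radialMotion φ t X)
  have h2 := h.hasFDerivWithinAt_motion ht hX
  have h3 : HasFDerivWithinAt (spaceTimeInverse φ ∘ spaceTimeMotion φ) _ (I ×ˢ refBody) (t, X) :=
    HasFDerivWithinAt.comp (g := spaceTimeInverse φ) (t, X) h1 h2 (mapsTo_image _ _)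
  have h4 : HasFDerivWithinAt (spaceTimeInverse φ ∘ spaceTimeMotion φ)
      (ContinuousLinearMap.id ℝ _) (I ×ˢ refBody) (t, X) :=
    (hasFDerivWithinAt_id (t, X) _).congr (fun p hp => h.spaceTimeInverse_motion hp)
      (h.spaceTimeInverse_motion ⟨ht, hX⟩)
  have h5 := (h.uniqueDiffOn_reference (t, X) ⟨ht, hX⟩).eq h3 h4
  have hR := norm_mem_Icc hX
  have hφR := (h.radial_pos t ht _ hR).ne'
  have hΛ := (h.stretch_pos ht hR).ne'
  have hor := norm_direction_or (φ := φ) (φR := φR) X t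
  refine ContinuousLinearMap.ext fun v => ?_
  set N := (ContinuousLinearMap.fst ℝ ℝ Space).prod (spaceTimeCLM
        (-(φt t ‖X‖ / φR t ‖X‖) • direction X)
        (axialCLM (φR t ‖X‖)⁻¹ (stretchOf φ φR t ‖X‖)⁻¹ (direction X))) with hN
  -- The derivative D of the inverse satisfies D ∘ A = id, where A is the derivative of the motion.
  -- The proposed N satisfies A ∘ N = id, so D v = D (A (N v)) = N v.
  have h6 := congrArg (fun M => M (N v)) h5
  simp only [ContinuousLinearMap.comp_apply, ContinuousLinearMap.id_apply] at h6
  rw [← h6]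
  congr 1
  simp only [hN, ContinuousLinearMap.prod_apply, ContinuousLinearMap.coe_fst', spaceTimeCLM_apply,
    _root_.map_add, _root_.map_smul, axialCLM_apply_inv hφR hΛ hor]
  refine Prod.ext rfl ?_
  simp only
  have h7 : axialCLM (φR t ‖X‖) (stretchOf φ φR t ‖X‖) (direction X) (direction X)
      = φR t ‖X‖ • direction X := by
    rcases hor with he | he
    · rw [axialCLM_apply, real_inner_self_eq_norm_sq, he]
      module
    · rw [axialCLM_apply, he]
      module
  rw [h7, ← add_assoc, smul_smul _ (φR t ‖X‖), ← smul_add, ← add_smul, neg_mul,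
    div_mul_cancel₀ _ hφR]
  simp

/-- The space-time derivative of the Eulerian description of a field. -/
lemma hasFDerivWithinAt_eulerian (h : IsRadialFlow I φ φt φR φtt φtR φRR) {t : ℝ}
    {X : Space} (ht : t ∈ I) (hX : X ∈ refBody) {f : ℝ → Space → F} {a : F} {L : Space →L[ℝ] F}
    (hf : HasFDerivWithinAt (fun p : ℝ × Space => f p.1 p.2) (spaceTimeCLM a L) (I ×ˢ refBody)
      (t, X)) :
    HasFDerivWithinAt (fun p : ℝ × Space => eulerian φ f p.1 p.2)
      (spaceTimeCLM (a - (φt t ‖X‖ / φR t ‖X‖) • L (direction X))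
        (L.comp (axialCLM (φR t ‖X‖)⁻¹ (stretchOf φ φR t ‖X‖)⁻¹ (direction X))))
      (spaceTimeMotion φ '' (I ×ˢ refBody)) (t, radialMotion φ t X) := by
  have h1 := h.hasFDerivWithinAt_spaceTimeInverse ht hX
  have h2 : spaceTimeInverse φ (t, radialMotion φ t X) = (t, X) :=
    h.spaceTimeInverse_motion (x := (t, X)) ⟨ht, hX⟩
  rw [← h2] at hf
  refine (HasFDerivWithinAt.comp (g := fun p : ℝ × Space => f p.1 p.2) _ hf h1
    h.mapsTo_spaceTimeInverse).congr_fderiv ?_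
  refine ContinuousLinearMap.ext fun v => ?_
  simp
  module

lemma contDiffOn_eulerian_slice (h : IsRadialFlow I φ φt φR φtt φtR φRR) {f : ℝ → Space → F}
    (hf : ContDiffOn ℝ 1 (fun p : ℝ × Space => f p.1 p.2) (I ×ˢ refBody)) {t : ℝ} (ht : t ∈ I) :
    ContDiffOn ℝ 1 (eulerian φ f t) (Metric.closedBall 0 (φ t 1)) := by
  have h1 : ContDiff ℝ 1 fun z : Space => (t, z) := contDiff_const.prodMk contDiff_id
  refine (h.contDiffOn_eulerian hf).comp h1.contDiffOn fun z hz => ?_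
  rw [h.image_spaceTimeMotion]
  exact ⟨ht, hz⟩

end IsRadialFlow

/-! ### Radial potentials -/

/-- A radial field `P(z) z` that is Newtonian outside a ball has a potential decaying at infinity. -/
lemma exists_radial_potential {P : Space → ℝ} {a c : ℝ} (ha : 0 < a) (hP : Continuous P)
    (hrad : ∀ z w, ‖z‖ = ‖w‖ → P z = P w) (hext : ∀ z, a ≤ ‖z‖ → P z = c / ‖z‖ ^ 3) :
    ∃ Φ : Space → ℝ, (∀ z, HasFDerivAt Φ (P z • innerSL ℝ z) z) ∧
      Tendsto Φ (cocompact Space) (𝓝 0) := by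
  -- P as a function of the squared radius w: |z|² is smooth at the origin, and the gradient of ½ ∫
  -- p dw up to |z|² is P(z) z.
  set p : ℝ → ℝ := fun w => P (√w • stdVec 0) with hp
  have hpc : Continuous p := by
    refine hP.comp ?_
    fun_prop
  have hnorm : ∀ w, ‖√w • stdVec 0‖ = √w := fun w => by
    rw [norm_smul, norm_stdVec, mul_one, Real.norm_eq_abs, abs_of_nonneg (Real.sqrt_nonneg w)]
  have hpP : ∀ z, p (‖z‖ ^ 2) = P z := fun z => by
    refine hrad _ _ ?_
    rw [hnorm, Real.sqrt_sq (norm_nonneg z)]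
  -- The constant -c/a is the Newtonian value on the sphere of radius a. It makes the potential
  -- equal to -c/|z| outside, hence decaying.
  refine ⟨fun z => (1 / 2) * (∫ w in (a ^ 2)..(‖z‖ ^ 2), p w) - c / a, fun z => ?_, ?_⟩
  · have h1 : HasDerivAt (fun s => ∫ w in (a ^ 2)..s, p w) (p (‖z‖ ^ 2)) (‖z‖ ^ 2) :=
      intervalIntegral.integral_hasDerivAt_right (hpc.intervalIntegrable _ _)
        (hpc.stronglyMeasurableAtFilter _ _) hpc.continuousAt
    have h2 := ((h1.comp_hasFDerivAt z (hasStrictFDerivAt_norm_sq z).hasFDerivAt).const_mul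
      (1 / 2)).sub_const (c / a)
    refine h2.congr_fderiv ?_
    rw [hpP]
    ext v
    simp
    ring
  · have h3 : ∀ z : Space, a ≤ ‖z‖ →
        (1 / 2) * (∫ w in (a ^ 2)..(‖z‖ ^ 2), p w) - c / a = -c * ‖z‖⁻¹ := by
      intro z hz
      have h4 : ∀ w ∈ uIcc (a ^ 2) (‖z‖ ^ 2), HasDerivAt (fun w => -2 * c * (√w)⁻¹) (p w) w := by
        intro w hw
        rw [uIcc_of_le (pow_le_pow_left₀ ha.le hz 2)] at hw
        have hw0 : 0 < w := lt_of_lt_of_le (by positivity) hw.1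
        have haw : a ≤ √w := Real.le_sqrt_of_sq_le hw.1
        have hsw : √w ≠ 0 := (Real.sqrt_pos.2 hw0).ne'
        have h5 := ((Real.hasDerivAt_sqrt hw0.ne').inv hsw).const_mul (-2 * c)
        refine h5.congr_deriv ?_
        simp only [hp]
        rw [hext _ (by rwa [hnorm]), hnorm]
        field_simp
      rw [intervalIntegral.integral_eq_sub_of_hasDerivAt h4 (hpc.intervalIntegrable _ _),
        Real.sqrt_sq (norm_nonneg z), Real.sqrt_sq ha.le]
      field_simp
      ring
    have h6 : Tendsto (fun z : Space => -c * ‖z‖⁻¹) (cocompact Space) (𝓝 0) := by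
      have := (tendsto_inv_atTop_zero.comp (tendsto_norm_cocompact_atTop (E := Space))).const_mul (-c)
      rwa [mul_zero] at this
    refine h6.congr' ?_
    filter_upwards [tendsto_norm_cocompact_atTop.eventually_ge_atTop a] with z hz
    exact (h3 z hz).symm

section

variable {P Φ : Space → ℝ} (hΦ : ∀ z, HasFDerivAt Φ (P z • innerSL ℝ z) z)
include hΦ

lemma contDiff_one_radial_potential (hP : Continuous P) : ContDiff ℝ 1 Φ := by
  refine contDiff_one_iff_fderiv.2 ⟨fun z => (hΦ z).differentiableAt, ?_⟩
  have h1 : fderiv ℝ Φ = fun z => P z • innerSL ℝ z := funext fun z => (hΦ z).fderiv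
  rw [h1]
  exact hP.smul (innerSL ℝ).continuous

lemma contDiffOn_two_radial_potential {U : Set Space} (hU : IsOpen U) (hP : ContDiffOn ℝ 1 P U) :
    ContDiffOn ℝ 2 Φ U := by
  have h1 : fderiv ℝ Φ = fun z => P z • innerSL ℝ z := funext fun z => (hΦ z).fderiv
  rw [show (2 : WithTop ℕ∞) = 1 + 1 by norm_num, contDiffOn_succ_iff_fderiv_of_isOpen hU, h1]
  exact ⟨fun z _ => (hΦ z).differentiableAt.differentiableWithinAt, by simp,
    hP.smul (innerSL ℝ).contDiff.contDiffOn⟩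

/-- This is div(P z) = 3P + z · ∇P. -/
lemma laplacian_radial_potential {z : Space} {P' : Space →L[ℝ] ℝ} (hP : HasFDerivAt P P' z) :
    Laplacian.laplacian Φ z = 3 * P z + P' z := by
  have h1 : fderiv ℝ Φ = fun z => P z • innerSL ℝ z := funext fun z => (hΦ z).fderiv
  obtain ⟨J, hJ⟩ : ∃ J : Space →L[ℝ] Space →L[ℝ] ℝ, ∀ z, innerSL ℝ z = J z :=
    ⟨innerSL ℝ, fun _ => rfl⟩
  have hJ' : ∀ v w, J v w = inner ℝ v w := fun v w => by rw [← hJ, innerSL_apply_apply]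
  have h2 : HasFDerivAt (fun z => P z • J z) (P z • J + P'.smulRight (J z)) z :=
    hP.smul J.hasFDerivAt
  rw [InnerProductSpace.laplacian_eq_iteratedFDeriv_orthonormalBasis Φ
    (EuclideanSpace.basisFun (Fin 3) ℝ)]
  simp only [iteratedFDeriv_two_apply, h1, hJ, h2.fderiv]
  have h3 : P' z = ∑ i, z i * P' (stdVec i) := by
    conv_lhs => rw [← sum_smul_stdVec z]
    simp
  have h4 : ∀ i, EuclideanSpace.basisFun (Fin 3) ℝ i = stdVec i := fun i => by simp [stdVec]
  have h5 : ∀ i, inner ℝ z (stdVec i) = z i := fun i => by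
    rw [stdVec, EuclideanSpace.inner_single_right]
    simp
  rw [h3]
  simp [h4, Fin.sum_univ_three, h5, hJ', norm_stdVec]
  ring

end

/-! ### Density and gravitational field of a radial motion. -/

/-- The Lagrangian density `ρbar / (Λ² φ_R)`. -/
noncomputable def lagrangianDensity (ρbar : ℝ) (φ φR : ℝ → ℝ → ℝ) (t R : ℝ) : ℝ :=
  ρbar * ((stretchOf φ φR t R ^ 2)⁻¹ * (φR t R)⁻¹)

open Classical in
/-- The Eulerian density of a radial motion, which vanishes outside the body. -/
noncomputable def radialDensity (ρbar : ℝ) (φ φR : ℝ → ℝ → ℝ) (t : ℝ) (z : Space) : ℝ :=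
  if z ∈ Metric.closedBall (0 : Space) (φ t 1) then
    eulerian φ (fun s X => lagrangianDensity ρbar φ φR s ‖X‖) t z else 0

open Classical in
/-- The coefficient `P` of the gravitational field `∇Φ = P(z) z` of a radial motion; `c` is the
total mass. -/
noncomputable def gravityCoeff (c : ℝ) (φ φR : ℝ → ℝ → ℝ) (t : ℝ) (z : Space) : ℝ :=
  if z ∈ Metric.closedBall (0 : Space) (φ t 1) then
    eulerian φ (fun s X => c * (stretchOf φ φR s ‖X‖ ^ 3)⁻¹) t z else c / ‖z‖ ^ 3

namespace IsRadialFlow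

variable {I : Set ℝ} {φ φt φR φtt φtR φRR : ℝ → ℝ → ℝ}

lemma hasRadialFDeriv_stretch (h : IsRadialFlow I φ φt φR φtt φtR φRR) :
    HasRadialFDeriv I (stretchOf φ φR) (stretchOf φt φtR)
      (radialQuotient (fun t R => φR t R - stretchOf φ φR t R) fun _ => 0) :=
  h.toHasRadialFDeriv2.radialQuotient h.uniqueDiffOn h.map_zero h.radial2_zero

/-- A `C¹` function of the stretches has vanishing radial derivative at the centre. -/
lemma exists_hasRadialFDeriv_comp (h : IsRadialFlow I φ φt φR φtt φtR φRR) {A : ℝ → ℝ → ℝ}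
    (hA : ContDiffOn ℝ 1 (fun p : ℝ × ℝ => A p.1 p.2) (Ioi 0 ×ˢ Ioi 0)) :
    ∃ ft fR, HasRadialFDeriv I (fun t R => A (stretchOf φ φR t R) (φR t R)) ft fR ∧
      ∀ t ∈ I, fR t 0 = 0 := by
  refine ⟨_, _, h.hasRadialFDeriv_stretch.comp₂ h.radial (isOpen_Ioi.prod isOpen_Ioi) hA
    fun t ht R hR => ⟨h.stretch_pos ht hR, h.radial_pos t ht R hR⟩, fun t ht => ?_⟩
  -- At the centre the radial derivatives Λ_R and φ_RR of both stretches vanish, so the chain rule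
  -- applies the derivative of `A` to the zero vector.
  rw [radialQuotient_zero, h.radial2_zero t ht]
  exact _root_.map_zero _

lemma stretch_radial_mul {t R : ℝ} :
    radialQuotient (fun t R => φR t R - stretchOf φ φR t R) (fun _ => 0) t R * R
      = φR t R - stretchOf φ φR t R := by
  by_cases h0 : R = 0
  · rw [h0, mul_zero, stretchOf, radialQuotient_zero, sub_self]
  · rw [radialQuotient_of_ne _ _ h0, div_mul_cancel₀ _ h0]

lemma stretch_one : stretchOf φ φR t 1 = φ t 1 := by
  rw [stretchOf, radialQuotient_of_ne _ _ one_ne_zero, div_one]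

lemma radius_pos (h : IsRadialFlow I φ φt φR φtt φtR φRR) {t : ℝ} (ht : t ∈ I) : 0 < φ t 1 :=
  h.pos ht ⟨one_pos, le_rfl⟩

section density

variable {ρbar : ℝ}

lemma radialDensity_of_mem {t : ℝ} {z : Space}
    (hz : z ∈ Metric.closedBall (0 : Space) (φ t 1)) : radialDensity ρbar φ φR t z
      = eulerian φ (fun s X => lagrangianDensity ρbar φ φR s ‖X‖) t z := if_pos hz

lemma radialDensity_motion (h : IsRadialFlow I φ φt φR φtt φtR φRR) {t : ℝ} {X : Space}
    (ht : t ∈ I) (hX : X ∈ refBody) :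
    radialDensity ρbar φ φR t (radialMotion φ t X) = lagrangianDensity ρbar φ φR t ‖X‖ := by
  rw [radialDensity_of_mem ((h.bijOn ht).mapsTo hX), h.eulerian_motion _ ht hX]

lemma lagrangianDensity_pos (h : IsRadialFlow I φ φt φR φtt φtR φRR) (hρ : 0 < ρbar) {t R : ℝ}
    (ht : t ∈ I) (hR : R ∈ Icc (0 : ℝ) 1) : 0 < lagrangianDensity ρbar φ φR t R := by
  have h1 := h.stretch_pos ht hR
  have h2 := h.radial_pos t ht R hR
  rw [lagrangianDensity]
  positivity

lemma body_radialDensity (h : IsRadialFlow I φ φt φR φtt φtR φRR) (hρ : 0 < ρbar) {t : ℝ}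
    (ht : t ∈ I) : body (radialDensity ρbar φ φR) t = Metric.closedBall 0 (φ t 1) := by
  have h1 : Function.support (radialDensity ρbar φ φR t) = Metric.closedBall 0 (φ t 1) := by
    ext z
    rw [Function.mem_support]
    constructor
    · intro hz
      by_contra hz'
      exact hz (if_neg hz')
    · intro hz
      obtain ⟨X, hX, rfl⟩ := (h.bijOn ht).surjOn hz
      rw [h.radialDensity_motion ht hX]
      exact (h.lagrangianDensity_pos hρ ht (norm_mem_Icc hX)).ne'
  rw [body, tsupport, h1, Metric.isClosed_closedBall.closure_eq]

lemma radialDensity_nonneg (h : IsRadialFlow I φ φt φR φtt φtR φRR) (hρ : 0 < ρbar) {t : ℝ}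
    (ht : t ∈ I) (z : Space) : 0 ≤ radialDensity ρbar φ φR t z := by
  by_cases hz : z ∈ Metric.closedBall (0 : Space) (φ t 1)
  · obtain ⟨X, hX, rfl⟩ := (h.bijOn ht).surjOn hz
    rw [h.radialDensity_motion ht hX]
    exact (h.lagrangianDensity_pos hρ ht (norm_mem_Icc hX)).le
  · exact (if_neg hz).ge

lemma worldTube_radialDensity (h : IsRadialFlow I φ φt φR φtt φtR φRR) (hρ : 0 < ρbar) :
    worldTube I (radialDensity ρbar φ φR) = spaceTimeMotion φ '' (I ×ˢ refBody) := by
  rw [h.image_spaceTimeMotion, worldTube]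
  ext p
  simp only [mem_ofPred_eq]
  exact and_congr_right fun hp => by rw [h.body_radialDensity hρ hp]

end density

section gravity

variable {c : ℝ}

lemma contDiffOn_stretch_cube :
    ContDiffOn ℝ 1 (fun p : ℝ × ℝ => c * (p.1 ^ 3)⁻¹) (Ioi 0 ×ˢ Ioi 0) := by
  refine contDiffOn_const.mul ((contDiff_fst.pow 3).contDiffOn.inv fun p hp => ?_)
  exact pow_ne_zero 3 (ne_of_gt hp.1)

lemma contDiffOn_gravityCoeff (h : IsRadialFlow I φ φt φR φtt φtR φRR) {t : ℝ} (ht : t ∈ I) :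
    ContDiffOn ℝ 1 (gravityCoeff c φ φR t) (Metric.closedBall 0 (φ t 1)) := by
  obtain ⟨ft, fR, hf, hf0⟩ := h.exists_hasRadialFDeriv_comp (A := fun l _ => c * (l ^ 3)⁻¹)
    contDiffOn_stretch_cube
  refine (h.contDiffOn_eulerian_slice
    (f := fun s X => c * (stretchOf φ φR s ‖X‖ ^ 3)⁻¹) (hf.contDiffOn_comp_norm hf0) ht).congr fun z hz => ?_
  exact if_pos hz

/-- With c the total mass, the mass inside reference radius R is c R³. It acts at distance φ = ΛR,
whence c R³/φ³ = c Λ⁻³. -/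
lemma gravityCoeff_motion (h : IsRadialFlow I φ φt φR φtt φtR φRR) {t : ℝ} {X : Space}
    (ht : t ∈ I) (hX : X ∈ refBody) :
    gravityCoeff c φ φR t (radialMotion φ t X) = c * (stretchOf φ φR t ‖X‖ ^ 3)⁻¹ := by
  rw [gravityCoeff, if_pos ((h.bijOn ht).mapsTo hX), h.eulerian_motion _ ht hX]

/-- The two branches agree on the boundary sphere, because Λ(t, 1) = φ(t, 1). This is what makes ∇Φ
continuous across the boundary. -/
lemma gravityCoeff_of_le (h : IsRadialFlow I φ φt φR φtt φtR φRR) {t : ℝ} (ht : t ∈ I)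
    {z : Space} (hz : φ t 1 ≤ ‖z‖) : gravityCoeff c φ φR t z = c / ‖z‖ ^ 3 := by
  rcases hz.eq_or_lt with h1 | h1
  · have h2 : z ∈ Metric.closedBall (0 : Space) (φ t 1) := mem_closedBall_zero_iff.2 h1.ge
    obtain ⟨X, hX, rfl⟩ := (h.bijOn ht).surjOn h2
    rw [h.norm_motion ht hX] at h1
    have h3 := (h.strictMonoOn ht).injOn ⟨zero_le_one, le_rfl⟩ (norm_mem_Icc hX) h1
    rw [h.gravityCoeff_motion ht hX, h.norm_motion ht hX, ← h3, stretch_one, div_eq_mul_inv]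
  · exact if_neg fun h2 => h1.not_ge (mem_closedBall_zero_iff.1 h2)

lemma continuous_gravityCoeff (h : IsRadialFlow I φ φt φR φtt φtR φRR) {t : ℝ} (ht : t ∈ I) :
    Continuous (gravityCoeff c φ φR t) := by
  rw [← continuousOn_univ]
  have h1 : IsClosed {z : Space | φ t 1 ≤ ‖z‖} := isClosed_le continuous_const continuous_norm
  have h2 : ContinuousOn (gravityCoeff c φ φR t) {z : Space | φ t 1 ≤ ‖z‖} := by
    refine ContinuousOn.congr (f := fun z => c / ‖z‖ ^ 3) ?_ fun z hz => h.gravityCoeff_of_le ht hz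
    refine continuousOn_const.div (continuous_norm.pow 3).continuousOn fun z hz => ?_
    exact pow_ne_zero 3 (lt_of_lt_of_le (h.radius_pos ht) hz).ne'
  refine ((h.contDiffOn_gravityCoeff ht).continuousOn.union_of_isClosed h2
    Metric.isClosed_closedBall h1).mono fun z _ => ?_
  rcases le_total ‖z‖ (φ t 1) with h3 | h3
  · exact .inl (mem_closedBall_zero_iff.2 h3)
  · exact .inr h3

lemma gravityCoeff_radial (h : IsRadialFlow I φ φt φR φtt φtR φRR) {t : ℝ} (ht : t ∈ I)
    (z w : Space) (hzw : ‖z‖ = ‖w‖) : gravityCoeff c φ φR t z = gravityCoeff c φ φR t w := by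
  rcases le_total ‖z‖ (φ t 1) with h1 | h1
  · obtain ⟨X, hX, rfl⟩ := (h.bijOn ht).surjOn (mem_closedBall_zero_iff.2 h1)
    obtain ⟨Y, hY, rfl⟩ := (h.bijOn ht).surjOn (mem_closedBall_zero_iff.2 (hzw ▸ h1))
    rw [h.norm_motion ht hX, h.norm_motion ht hY] at hzw
    rw [h.gravityCoeff_motion ht hX, h.gravityCoeff_motion ht hY,
      (h.strictMonoOn ht).injOn (norm_mem_Icc hX) (norm_mem_Icc hY) hzw]
  · rw [h.gravityCoeff_of_le ht h1, h.gravityCoeff_of_le ht (hzw ▸ h1), hzw]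

lemma axialCLM_apply_self (a b : ℝ) (X : Space) : axialCLM a b (direction X) X = a • X := by
  rw [axialCLM_apply, inner_direction_self, norm_smul_direction]
  module

/-- Mass conservation in the form of the divergence of the gravitational field. -/
lemma divergence_gravity (h : IsRadialFlow I φ φt φR φtt φtR φRR) {t : ℝ} {X : Space}
    (ht : t ∈ I) (hX : X ∈ refBody) {P' : Space →L[ℝ] ℝ}
    (hP : HasFDerivAt (gravityCoeff c φ φR t) P' (radialMotion φ t X)) :
    3 * gravityCoeff c φ φR t (radialMotion φ t X) + P' (radialMotion φ t X)
      = 3 * lagrangianDensity c φ φR t ‖X‖ := by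
  have hR := norm_mem_Icc hX
  have hΛ := h.stretch_pos ht hR
  have hφR := h.radial_pos t ht _ hR
  have h1 : HasFDerivWithinAt (fun Y => gravityCoeff c φ φR t (radialMotion φ t Y))
      (P'.comp (axialCLM (φR t ‖X‖) (stretchOf φ φR t ‖X‖) (direction X))) refBody X :=
    hP.comp_hasFDerivWithinAt X (h.hasFDerivWithinAt_radialMotion ht hX)
  have h2 := h.hasRadialFDeriv_stretch.hasFDerivWithinAt_comp_norm ht hX
    (.inr (radialQuotient_zero _ _ t))
  have h3 : HasFDerivWithinAt (fun Y : Space => (t, Y)) (ContinuousLinearMap.inr ℝ ℝ Space)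
      refBody X := (hasFDerivAt_prodMk_right t X).hasFDerivWithinAt
  have h4 := h2.comp X h3 fun Y hY => ⟨ht, hY⟩
  have h5 := (((hasDerivAt_pow 3 (stretchOf φ φR t ‖X‖)).inv
    (pow_ne_zero 3 hΛ.ne')).const_mul c).comp_hasFDerivWithinAt X h4
  have h6 := h5.congr (f₁ := fun Y => gravityCoeff c φ φR t (radialMotion φ t Y))
    (fun Y hY => h.gravityCoeff_motion ht hY) (h.gravityCoeff_motion ht hX)
  -- The identity P(x(t, X)) = c Λ⁻³ is differentiated in the direction X: Dx sends X to φ_R X, and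
  -- Λ changes at rate R Λ_R = φ_R - Λ.
  have h7 := congrArg (fun L => L X) ((uniqueDiffOn_refBody X hX).eq h1 h6)
  simp only [ContinuousLinearMap.comp_apply, axialCLM_apply_self, map_smul, smul_eq_mul,
    smul_apply, ContinuousLinearMap.inr_apply, spaceTimeCLM_apply, zero_mul, zero_add,
    innerSL_apply_apply, inner_direction_self, stretch_radial_mul] at h7
  rw [h.gravityCoeff_motion ht hX, h.motion_eq_stretch_smul ht, map_smul, smul_eq_mul,
    lagrangianDensity]
  have h8 : P' X = (c * (-(3 * stretchOf φ φR t ‖X‖ ^ 2) / (stretchOf φ φR t ‖X‖ ^ 3) ^ 2) *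
      (φR t ‖X‖ - stretchOf φ φR t ‖X‖)) / φR t ‖X‖ := by
    rw [eq_div_iff hφR.ne', mul_comm, h7]
    norm_num
  rw [h8]
  field_simp
  ring

lemma exists_gravitationalPotential (h : IsRadialFlow I φ φt φR φtt φtR φRR) {ρbar : ℝ}
    (hρ : 0 < ρbar) {t : ℝ} (ht : t ∈ I) :
    ∃ Φ : Space → ℝ, IsGravitationalPotential (radialDensity ρbar φ φR t) Φ ∧
      ∀ z, fderiv ℝ Φ z = gravityCoeff (4 * Real.pi / 3 * ρbar) φ φR t z • innerSL ℝ z := by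
  set c := 4 * Real.pi / 3 * ρbar with hc
  have ha := h.radius_pos ht
  obtain ⟨Φ, hΦ, hdecay⟩ := exists_radial_potential ha (h.continuous_gravityCoeff (c := c) ht)
    (h.gravityCoeff_radial ht) fun z hz => h.gravityCoeff_of_le ht hz
  refine ⟨Φ, ?_, fun z => (hΦ z).fderiv⟩
  have hfr : (frontier (tsupport (radialDensity ρbar φ φR t)))ᶜ
      = Metric.ball 0 (φ t 1) ∪ (Metric.closedBall 0 (φ t 1))ᶜ := by
    have h1 : tsupport (radialDensity ρbar φ φR t) = Metric.closedBall 0 (φ t 1) :=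
      h.body_radialDensity hρ ht
    rw [h1, frontier_closedBall _ ha.ne']
    ext z
    simp [lt_or_lt_iff_ne]
  have hin : ContDiffOn ℝ 1 (gravityCoeff c φ φR t) (Metric.ball 0 (φ t 1)) :=
    (h.contDiffOn_gravityCoeff ht).mono Metric.ball_subset_closedBall
  have hev : ∀ z ∈ (Metric.closedBall (0 : Space) (φ t 1))ᶜ,
      gravityCoeff c φ φR t z = c * (‖z‖ ^ 3)⁻¹ := fun z hz => by
    rw [← div_eq_mul_inv]
    exact if_neg hz
  have hne : ∀ z ∈ (Metric.closedBall (0 : Space) (φ t 1))ᶜ, z ≠ 0 := by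
    rintro z hz rfl
    exact hz (Metric.mem_closedBall_self ha.le)
  have hopen : IsOpen (Metric.closedBall (0 : Space) (φ t 1))ᶜ :=
    Metric.isClosed_closedBall.isOpen_compl
  have hout : ContDiffOn ℝ 1 (gravityCoeff c φ φR t) (Metric.closedBall 0 (φ t 1))ᶜ := by
    refine ContDiffOn.congr (f := fun z => c * (‖z‖ ^ 3)⁻¹) ?_ hev
    intro z hz
    exact (contDiffAt_const.mul (((contDiffAt_norm ℝ (hne z hz)).pow 3).inv
      (pow_ne_zero 3 (norm_ne_zero_iff.2 (hne z hz))))).contDiffWithinAt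
  refine ⟨contDiff_one_radial_potential hΦ (h.continuous_gravityCoeff ht), ?_, ?_, hdecay⟩
  · rw [hfr]
    exact (contDiffOn_two_radial_potential hΦ Metric.isOpen_ball hin).union_of_isOpen
      (contDiffOn_two_radial_potential hΦ hopen hout) Metric.isOpen_ball hopen
  · rw [hfr]
    rintro z (hz | hz)
    · have h1 := ((hin.contDiffAt (Metric.isOpen_ball.mem_nhds hz)).differentiableAt
        one_ne_zero).hasFDerivAt
      rw [laplacian_radial_potential hΦ h1]
      obtain ⟨X, hX, rfl⟩ := (h.bijOn ht).surjOn (Metric.ball_subset_closedBall hz)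
      rw [h.divergence_gravity ht hX h1, h.radialDensity_motion ht hX, lagrangianDensity,
        lagrangianDensity, hc]
      ring
    -- Outside the body P is homogeneous of degree -3, so 3P + z · ∇P = 0.
    · have hz0 := norm_ne_zero_iff.2 (hne z hz)
      have h1 := (((hasDerivAt_pow 3 ‖z‖).inv (pow_ne_zero 3 hz0)).const_mul
        c).comp_hasFDerivAt z (hasFDerivAt_norm (hne z hz))
      have h2 : gravityCoeff c φ φR t =ᶠ[𝓝 z] fun z => c * (‖z‖ ^ 3)⁻¹ := by
        filter_upwards [hopen.mem_nhds hz] with w hw using hev w hw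
      rw [laplacian_radial_potential hΦ (h1.congr_of_eventuallyEq h2), hev z hz, radialDensity,
        if_neg hz, mul_zero]
      simp only [smul_apply, innerSL_apply_apply, inner_direction_self, smul_eq_mul]
      field_simp
      norm_num

end gravity

end IsRadialFlow

lemma axialCLM_comp_apply {a b A B : ℝ} {e : Space} (he : ‖e‖ = 1 ∨ a = b ∧ A = B) (v : Space) :
    axialCLM a b e (axialCLM A B e v) = axialCLM (a * A) (b * B) e v := by
  rcases he with he | ⟨rfl, rfl⟩
  · have h1 : inner ℝ e e = (1 : ℝ) := by rw [real_inner_self_eq_norm_sq, he, one_pow]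
    simp only [axialCLM_apply, inner_add_right, inner_smul_right, h1]
    module
  · simp only [axialCLM_apply]
    module

lemma trace_axialMatrix {a b : ℝ} {e : Space} (he : ‖e‖ = 1 ∨ a = b) :
    ∑ j, axialMatrix a b e j j = a + 2 * b := by
  simp only [axialMatrix_apply, Fin.sum_univ_three, Matrix.one_apply_eq]
  rcases he with he | rfl
  · linear_combination (a - b) * sum_sq_eq_one he
  · ring

lemma sum_axialMatrix_mul {a b : ℝ} {e : Space} (he : ‖e‖ = 1) (i : Fin 3) :
    ∑ j, axialMatrix a b e i j * e j = a * e i := by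
  have h := sum_sq_eq_one he
  simp only [axialMatrix_apply, Fin.sum_univ_three]
  fin_cases i <;> simp [Matrix.one_apply]
  · linear_combination (a - b) * e 0 * h
  · linear_combination (a - b) * e 1 * h
  · linear_combination (a - b) * e 2 * h

lemma inner_axialCLM_stdVec (a b : ℝ) {e : Space} (he : ‖e‖ = 1) (j : Fin 3) :
    inner ℝ e (axialCLM a b e (stdVec j)) = a * e j := by
  have h1 : inner ℝ e e = (1 : ℝ) := by rw [real_inner_self_eq_norm_sq, he, one_pow]
  have h2 : inner ℝ e (stdVec j) = e j := by
    rw [stdVec, EuclideanSpace.inner_single_right]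
    simp
  rw [axialCLM_apply, inner_add_right, inner_smul_right, inner_smul_right, inner_smul_right, h1, h2]
  ring

/-! ### Velocity, acceleration and conservation of mass. -/

namespace IsRadialFlow

variable {I : Set ℝ} {φ φt φR φtt φtR φRR : ℝ → ℝ → ℝ} {ρbar : ℝ}

/-- The Eulerian velocity of a radial motion. -/
noncomputable def _root_.SelfGravElastic.radialVelocity (φ φt : ℝ → ℝ → ℝ) : ℝ → Space → Space :=
  eulerian φ fun s X => φt s ‖X‖ • direction X

lemma velocity_zero (h : IsRadialFlow I φ φt φR φtt φtR φRR) : ∀ t ∈ I, φt t 0 = 0 :=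
  h.self.time_eq_zero h.uniqueDiffOn h.map_zero

lemma contDiffOn_velocity (h : IsRadialFlow I φ φt φR φtt φtR φRR) :
    ContDiffOn ℝ 1 (fun p : ℝ × Space => radialVelocity φ φt p.1 p.2)
      (spaceTimeMotion φ '' (I ×ˢ refBody)) :=
  h.contDiffOn_eulerian (f := fun s X => φt s ‖X‖ • direction X)
    (h.time.contDiffOn_smul_direction h.uniqueDiffOn h.velocity_zero)

lemma velocity_motion (h : IsRadialFlow I φ φt φR φtt φtR φRR) {t : ℝ} {X : Space}
    (ht : t ∈ I) (hX : X ∈ refBody) :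
    radialVelocity φ φt t (radialMotion φ t X) = φt t ‖X‖ • direction X :=
  h.eulerian_motion _ ht hX

lemma hasFDerivWithinAt_velocity (h : IsRadialFlow I φ φt φR φtt φtR φRR) {t : ℝ} {X : Space}
    (ht : t ∈ I) (hX : X ∈ refBody) :
    HasFDerivWithinAt (fun p : ℝ × Space => radialVelocity φ φt p.1 p.2)
      (spaceTimeCLM (φtt t ‖X‖ • direction X - (φt t ‖X‖ / φR t ‖X‖) •
          axialCLM (φtR t ‖X‖) (stretchOf φt φtR t ‖X‖) (direction X) (direction X))
        ((axialCLM (φtR t ‖X‖) (stretchOf φt φtR t ‖X‖) (direction X)).comp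
          (axialCLM (φR t ‖X‖)⁻¹ (stretchOf φ φR t ‖X‖)⁻¹ (direction X))))
      (spaceTimeMotion φ '' (I ×ˢ refBody)) (t, radialMotion φ t X) :=
  h.hasFDerivWithinAt_eulerian ht hX (f := fun s X => φt s ‖X‖ • direction X)
    (h.time.hasFDerivWithinAt_smul_direction h.velocity_zero ht hX)

lemma mem_image_motion {t : ℝ} {X : Space} (ht : t ∈ I) (hX : X ∈ refBody) :
    (t, radialMotion φ t X) ∈ spaceTimeMotion φ '' (I ×ˢ refBody) :=
  ⟨(t, X), ⟨ht, hX⟩, rfl⟩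

lemma inv_apply_direction (t : ℝ) (X : Space) :
    axialCLM (φR t ‖X‖)⁻¹ (stretchOf φ φR t ‖X‖)⁻¹ (direction X) (direction X)
      = (φR t ‖X‖)⁻¹ • direction X := by
  rcases norm_direction_or (φ := φ) (φR := φR) X t with he | he
  · rw [axialCLM_apply, real_inner_self_eq_norm_sq, he]
    module
  · rw [axialCLM_apply, he]
    module

/-- The acceleration `∂ₜu + u · ∇u`. -/
lemma material_acceleration (h : IsRadialFlow I φ φt φR φtt φtR φRR) {t : ℝ} {X : Space}
    (ht : t ∈ I) (hX : X ∈ refBody) (i : Fin 3) :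
    timeDeriv (spaceTimeMotion φ '' (I ×ˢ refBody)) (fun s w => radialVelocity φ φt s w i) t
        (radialMotion φ t X)
      + ∑ j, radialVelocity φ φt t (radialMotion φ t X) j *
        spaceDeriv (spaceTimeMotion φ '' (I ×ˢ refBody)) j
          (fun s w => radialVelocity φ φt s w i) t (radialMotion φ t X)
      = φtt t ‖X‖ * direction X i := by
  have h1 := (EuclideanSpace.proj i : Space →L[ℝ] ℝ).hasFDerivAt.comp_hasFDerivWithinAt _
    (h.hasFDerivWithinAt_velocity ht hX)
  have h2 : fderivWithin ℝ (fun p : ℝ × Space => radialVelocity φ φt p.1 p.2 i)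
    (spaceTimeMotion φ '' (I ×ˢ refBody)) (t, radialMotion φ t X) = _ :=
    h1.fderivWithin (h.uniqueDiffOn_image _ (mem_image_motion ht hX))
  simp only [timeDeriv, spaceDeriv, h2, h.velocity_motion ht hX]
  set L := axialCLM (φtR t ‖X‖) (stretchOf φt φtR t ‖X‖) (direction X)
  set M := axialCLM (φR t ‖X‖)⁻¹ (stretchOf φ φR t ‖X‖)⁻¹ (direction X) with hM
  have h3 : ∑ j, (φt t ‖X‖ • direction X) j * (L (M (stdVec j))) i
      = (L (M (φt t ‖X‖ • direction X))) i := by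
    conv_rhs => rw [← sum_smul_stdVec (φt t ‖X‖ • direction X)]
    simp [Fin.sum_univ_three]
  have h4 : M (direction X) = (φR t ‖X‖)⁻¹ • direction X := inv_apply_direction t X
  simp only [ContinuousLinearMap.comp_apply, spaceTimeCLM_apply, one_smul, zero_smul, zero_add,
    _root_.map_zero, add_zero, PiLp.proj_apply]
  -- Convection contributes (φ_t/φ_R) L e, which cancels the same term, with a minus sign, in the
  -- Eulerian time derivative.
  rw [h3, map_smul, h4]
  simp
  ring

/-- The Eulerian density is `C¹` in space-time. -/
lemma contDiffOn_density (h : IsRadialFlow I φ φt φR φtt φtR φRR) :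
    ContDiffOn ℝ 1 (fun p : ℝ × Space => radialDensity ρbar φ φR p.1 p.2)
      (spaceTimeMotion φ '' (I ×ˢ refBody)) := by
  obtain ⟨ft, fR, hf, hf0⟩ := h.exists_hasRadialFDeriv_comp
    (A := fun l m => ρbar * ((l ^ 2)⁻¹ * m⁻¹)) (by
      refine contDiffOn_const.mul (((contDiff_fst.pow 2).contDiffOn.inv fun p hp => ?_).mul
        (contDiff_snd.contDiffOn.inv fun p hp => ?_))
      · exact pow_ne_zero 2 (ne_of_gt hp.1)
      · exact ne_of_gt hp.2)
  refine (h.contDiffOn_eulerian (f := fun s X => lagrangianDensity ρbar φ φR s ‖X‖)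
    (hf.contDiffOn_comp_norm hf0)).congr fun p hp => ?_
  rw [h.image_spaceTimeMotion] at hp
  exact radialDensity_of_mem hp.2

/-- Conservation of mass. -/
lemma continuity (h : IsRadialFlow I φ φt φR φtt φtR φRR) {t : ℝ} {X : Space}
    (ht : t ∈ I) (hX : X ∈ refBody) :
    timeDeriv (spaceTimeMotion φ '' (I ×ˢ refBody)) (radialDensity ρbar φ φR) t
        (radialMotion φ t X)
      + ∑ j, spaceDeriv (spaceTimeMotion φ '' (I ×ˢ refBody)) j
        (fun s w => radialDensity ρbar φ φR s w * radialVelocity φ φt s w j) t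
          (radialMotion φ t X) = 0 := by
  have hR := norm_mem_Icc hX
  have hΛ := h.stretch_pos ht hR
  have hφR := h.radial_pos t ht _ hR
  have hmem := mem_image_motion (φ := φ) ht hX
  have hu := h.uniqueDiffOn_image _ hmem
  have hρ := (h.contDiffOn_density (ρbar := ρbar)).differentiableOn one_ne_zero _ hmem
  have hv := h.hasFDerivWithinAt_velocity ht hX
  set Dρ := fderivWithin ℝ (fun p : ℝ × Space => radialDensity ρbar φ φR p.1 p.2)
    (spaceTimeMotion φ '' (I ×ˢ refBody)) (t, radialMotion φ t X) with hDρ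
  set e := direction X
  set L := axialCLM (φtR t ‖X‖) (stretchOf φt φtR t ‖X‖) e
  set M := axialCLM (φR t ‖X‖)⁻¹ (stretchOf φ φR t ‖X‖)⁻¹ e with hM
  have h1 : ∀ j, spaceDeriv (spaceTimeMotion φ '' (I ×ˢ refBody)) j
      (fun s w => radialDensity ρbar φ φR s w * radialVelocity φ φt s w j) t (radialMotion φ t X)
      = lagrangianDensity ρbar φ φR t ‖X‖ * (L (M (stdVec j))) j
        + (φt t ‖X‖ • e) j * Dρ (0, stdVec j) := by
    intro j
    have h2 := hρ.hasFDerivWithinAt.mul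
      ((EuclideanSpace.proj j : Space →L[ℝ] ℝ).hasFDerivAt.comp_hasFDerivWithinAt _ hv)
    rw [spaceDeriv]
    refine (congrArg (fun D => D (0, stdVec j)) (h2.fderivWithin hu)).trans ?_
    simp only [add_apply, smul_apply, ContinuousLinearMap.comp_apply, spaceTimeCLM_apply,
      zero_smul, zero_add, PiLp.proj_apply, smul_eq_mul, Function.comp_apply,
      h.velocity_motion ht hX, h.radialDensity_motion ht hX]
    rfl
  have h3 : ∑ j, (φt t ‖X‖ • e) j * Dρ (0, stdVec j) = Dρ (0, φt t ‖X‖ • e) := by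
    have h4 : ((0 : ℝ), φt t ‖X‖ • e) = ∑ j, (φt t ‖X‖ • e) j • ((0 : ℝ), stdVec j) := by
      refine Prod.ext (by simp [Prod.fst_sum]) ?_
      rw [Prod.snd_sum]
      simp only [Prod.smul_snd]
      exact (sum_smul_stdVec _).symm
    rw [h4, map_sum]
    simp only [map_smul, smul_eq_mul]
  -- `Dρ` applied to (1, u) is the derivative of ρ along a particle path, hence the time derivative
  -- of the Lagrangian density.
  have h5 : HasDerivWithinAt (fun s => lagrangianDensity ρbar φ φR s ‖X‖)
      (Dρ (1, φt t ‖X‖ • e)) I t := by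
    have h6 : HasDerivWithinAt (fun s => (s, radialMotion φ s X)) (1, φt t ‖X‖ • e) I t := by
      refine (hasDerivWithinAt_id t I).prodMk ?_
      simp only [radialMotion_eq φ]
      exact (h.self.hasDerivWithinAt_time ht hR).smul_const e
    have h7 := hρ.hasFDerivWithinAt.comp_hasDerivWithinAt t h6 fun s hs => mem_image_motion hs hX
    exact h7.congr (fun s hs => (h.radialDensity_motion hs hX).symm)
      (h.radialDensity_motion ht hX).symm
  have h8 := ((((h.hasRadialFDeriv_stretch.hasDerivWithinAt_time ht hR).pow 2).inv
    (pow_ne_zero 2 hΛ.ne')).mul ((h.radial.hasDerivWithinAt_time ht hR).inv hφR.ne')).const_mul ρbar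
  have h9 := (h.uniqueDiffOn t ht).eq_deriv _ h5 h8
  -- The divergence of u is φ_tR/φ_R + 2 Λ_t/Λ, the logarithmic derivative of det Dx = Λ² φ_R.
  have h10 : ∑ j, (L (M (stdVec j))) j = φtR t ‖X‖ * (φR t ‖X‖)⁻¹
      + 2 * (stretchOf φt φtR t ‖X‖ * (stretchOf φ φR t ‖X‖)⁻¹) := by
    have h11 : ‖e‖ = 1 ∨ φtR t ‖X‖ = stretchOf φt φtR t ‖X‖ ∧
        (φR t ‖X‖)⁻¹ = (stretchOf φ φR t ‖X‖)⁻¹ := by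
      by_cases hX0 : X = 0
      · right
        simp [hX0, stretchOf, radialQuotient_zero]
      · exact .inl (norm_direction hX0)
    rw [← trace_axialMatrix (e := e) (h11.imp_right fun h => by rw [h.1, h.2])]
    refine Finset.sum_congr rfl fun j _ => ?_
    rw [← axialCLM_stdVec, ← axialCLM_comp_apply h11]
  have h12 : Dρ (1, φt t ‖X‖ • e) = Dρ (1, 0) + Dρ (0, φt t ‖X‖ • e) := by
    rw [← _root_.map_add]
    simp
  have h13 : timeDeriv (spaceTimeMotion φ '' (I ×ˢ refBody)) (radialDensity ρbar φ φR) t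
      (radialMotion φ t X) = Dρ (1, 0) := rfl
  simp only [h1]
  rw [Finset.sum_add_distrib, h3, ← Finset.mul_sum, h10, h13, lagrangianDensity]
  rw [h12] at h9
  simp only [Pi.pow_apply, Pi.inv_apply] at h9
  have h14 : ∀ x y z : ℝ, x + (y + z) = (x + z) + y := fun x y z => by ring
  rw [h14, h9]
  field_simp
  push_cast
  ring

end IsRadialFlow

/-! ### The stress -/

/-- The axial Cauchy stress for transversal stretch `l` and axial stretch `m`. -/
noncomputable def axialCauchy (Shat : Mat → Mat) (l m : ℝ) : ℝ :=
  (l ^ 4)⁻¹ * axialStress Shat (m / l)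

/-- The transversal Cauchy stress for transversal stretch `l` and axial stretch `m`. -/
noncomputable def transversalCauchy (Shat : Mat → Mat) (l m : ℝ) : ℝ :=
  (l ^ 4)⁻¹ * (transversalStress Shat (m / l) / (m / l))

/-- The Cauchy stress of a radial motion, as a field on the reference body. -/
noncomputable def lagrangianStress (Shat : Mat → Mat) (φ φR : ℝ → ℝ → ℝ) (t : ℝ) (X : Space) : Mat :=
  axialMatrix (axialCauchy Shat (stretchOf φ φR t ‖X‖) (φR t ‖X‖))
    (transversalCauchy Shat (stretchOf φ φR t ‖X‖) (φR t ‖X‖)) (direction X)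

section

variable {ρbar : ℝ} {W : Mat → ℝ} {Shat : Mat → Mat}

/-- The powers of l come from T = J⁻¹ S Fᵀ with J = l² m, where S carries l⁻² by homogeneity. The
axial value gains m/(l⁴ m) and the transversal one l/(l⁴ m). -/
lemma cauchy_piola (hyper : IsHyperelastic ρbar W Shat) (hobj : IsObjective W)
    (hiso : IsIsotropic W) (hhom : IsHomogeneousOfDegree (-1) W) {l m : ℝ} (hl : 0 < l) (hm : 0 < m)
    {e : Space} (he : ‖e‖ = 1) :
    (axialMatrix m l e).det •
        (axialMatrix (axialCauchy Shat l m) (transversalCauchy Shat l m) e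
          * ((axialMatrix m l e)⁻¹)ᵀ) = Shat (axialMatrix m l e) := by
  rw [axialMatrix_inv hm.ne' hl.ne' he, axialMatrix_transpose, axialMatrix_mul _ _ _ _ he,
    axialMatrix_det _ _ he, smul_axialMatrix, response_axialMatrix' hyper hobj hiso hhom hm hl he,
    axialCauchy, transversalCauchy]
  congr 1 <;> field_simp

lemma axialCauchy_self (hyper : IsHyperelastic ρbar W Shat) (hobj : IsObjective W)
    (hiso : IsIsotropic W) {l : ℝ} (hl : l ≠ 0) :
    axialCauchy Shat l l = transversalCauchy Shat l l := by
  rw [axialCauchy, transversalCauchy, div_self hl, axialStress_one hyper hobj hiso, div_one]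

lemma contDiffOn_axialCauchy (hyper : IsHyperelastic ρbar W Shat) :
    ContDiffOn ℝ 1 (fun p : ℝ × ℝ => axialCauchy Shat p.1 p.2) (Ioi 0 ×ˢ Ioi 0) := by
  have h1 : ContDiffOn ℝ 1 (fun p : ℝ × ℝ => (p.1 ^ 4)⁻¹) (Ioi 0 ×ˢ Ioi 0) :=
    (contDiff_fst.pow 4).contDiffOn.inv fun p hp => pow_ne_zero 4 (ne_of_gt hp.1)
  have h2 : ContDiffOn ℝ 1 (fun p : ℝ × ℝ => p.2 / p.1) (Ioi 0 ×ˢ Ioi 0) :=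
    contDiff_snd.contDiffOn.div contDiff_fst.contDiffOn fun p hp => ne_of_gt hp.1
  exact h1.mul ((contDiffOn_response_axialMatrix hyper 0 0).comp h2
    fun p hp => div_pos (mem_Ioi.1 hp.2) hp.1)

lemma contDiffOn_transversalCauchy (hyper : IsHyperelastic ρbar W Shat) :
    ContDiffOn ℝ 1 (fun p : ℝ × ℝ => transversalCauchy Shat p.1 p.2) (Ioi 0 ×ˢ Ioi 0) := by
  have h1 : ContDiffOn ℝ 1 (fun p : ℝ × ℝ => (p.1 ^ 4)⁻¹) (Ioi 0 ×ˢ Ioi 0) :=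
    (contDiff_fst.pow 4).contDiffOn.inv fun p hp => pow_ne_zero 4 (ne_of_gt hp.1)
  have h2 : ContDiffOn ℝ 1 (fun p : ℝ × ℝ => p.2 / p.1) (Ioi 0 ×ˢ Ioi 0) :=
    contDiff_snd.contDiffOn.div contDiff_fst.contDiffOn fun p hp => ne_of_gt hp.1
  have h3 : ∀ p ∈ (Ioi 0 ×ˢ Ioi 0 : Set (ℝ × ℝ)), 0 < p.2 / p.1 :=
    fun p hp => div_pos (mem_Ioi.1 hp.2) hp.1
  exact h1.mul (((contDiffOn_response_axialMatrix hyper 1 1).comp h2 h3).div h2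
    fun p hp => (h3 p hp).ne')

end

/-- The divergence of an axially symmetric tensor field, in terms of the derivatives along the
reference body. -/
lemma sum_tensor_deriv {bR kR q A B : ℝ} {e : Space} (he : ‖e‖ = 1) (i : Fin 3) :
    ∑ j, (bR * (1 : Mat) i j * inner ℝ e (axialCLM A B e (stdVec j))
      + ((kR - 2 * q) * (e i * e j * inner ℝ e (axialCLM A B e (stdVec j)))
        + q * (e j * axialCLM A B e (stdVec j) i + e i * axialCLM A B e (stdVec j) j)))
      = (A * (bR + kR) + 2 * q * B) * e i := by
  have h := sum_sq_eq_one he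
  simp only [inner_axialCLM_stdVec _ _ he, axialCLM_stdVec, axialMatrix_apply, Fin.sum_univ_three]
  fin_cases i <;> simp [Matrix.one_apply]
  · linear_combination ((kR - 2 * q) * A + 2 * q * (A - B)) * e 0 * h
  · linear_combination ((kR - 2 * q) * A + 2 * q * (A - B)) * e 1 * h
  · linear_combination ((kR - 2 * q) * A + 2 * q * (A - B)) * e 2 * h

namespace IsRadialFlow

variable {I : Set ℝ} {φ φt φR φtt φtR φRR : ℝ → ℝ → ℝ} {ρbar : ℝ}
  {W : Mat → ℝ} {Shat : Mat → Mat}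

lemma constitutive_law (h : IsRadialFlow I φ φt φR φtt φtR φRR)
    (hyper : IsHyperelastic ρbar W Shat) (hobj : IsObjective W)
    (hiso : IsIsotropic W) (hhom : IsHomogeneousOfDegree (-1) W) {t : ℝ} {X : Space} (ht : t ∈ I)
    (hX : X ∈ refBody) :
    (deformationGradient (radialMotion φ) t X).det •
        (lagrangianStress Shat φ φR t X * ((deformationGradient (radialMotion φ) t X)⁻¹)ᵀ)
      = Shat (deformationGradient (radialMotion φ) t X) := by
  have hR := norm_mem_Icc hX
  have hΛ := h.stretch_pos ht hR
  have hφR := h.radial_pos t ht _ hR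
  rw [h.deformationGradient_eq ht hX, lagrangianStress]
  rcases norm_direction_or (φ := φ) (φR := φR) X t with he | he
  · exact cauchy_piola hyper hobj hiso hhom hΛ hφR he
  -- At the centre the stretches agree and both matrices are multiples of the identity, so `stdVec
  -- 0` can stand in for the missing axis.
  · have := cauchy_piola hyper hobj hiso hhom hΛ hφR (norm_stdVec 0)
    rw [he, axialCauchy_self hyper hobj hiso hΛ.ne'] at this ⊢
    simp only [axialMatrix_self] at this ⊢
    exact this

/-- The stress components, as sums of a radial function and a radial function vanishing to second
order at the centre times `X ⊗ X / |X|²`. -/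
lemma exists_stress_deriv (h : IsRadialFlow I φ φt φR φtt φtR φRR)
    (hyper : IsHyperelastic ρbar W Shat) (hobj : IsObjective W) (hiso : IsIsotropic W) :
    ∃ at' aR bt bR : ℝ → ℝ → ℝ,
      HasRadialFDeriv I (fun t R => axialCauchy Shat (stretchOf φ φR t R) (φR t R)) at' aR ∧
      HasRadialFDeriv I (fun t R => transversalCauchy Shat (stretchOf φ φR t R) (φR t R)) bt bR ∧
      (∀ t ∈ I, aR t 0 = 0) ∧ (∀ t ∈ I, bR t 0 = 0) ∧
      ∀ t ∈ I, axialCauchy Shat (stretchOf φ φR t 0) (φR t 0)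
        - transversalCauchy Shat (stretchOf φ φR t 0) (φR t 0) = 0 := by
  obtain ⟨at', aR, ha, ha0⟩ := h.exists_hasRadialFDeriv_comp (contDiffOn_axialCauchy hyper)
  obtain ⟨bt, bR, hb, hb0⟩ := h.exists_hasRadialFDeriv_comp (contDiffOn_transversalCauchy hyper)
  refine ⟨at', aR, bt, bR, ha, hb, ha0, hb0, fun t ht => ?_⟩
  rw [stretchOf, radialQuotient_zero, axialCauchy_self hyper hobj hiso, sub_self]
  exact (h.radial_pos t ht 0 ⟨le_rfl, zero_le_one⟩).ne'

lemma contDiffOn_stress (h : IsRadialFlow I φ φt φR φtt φtR φRR)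
    (hyper : IsHyperelastic ρbar W Shat) (hobj : IsObjective W) (hiso : IsIsotropic W)
    (i j : Fin 3) :
    ContDiffOn ℝ 1 (fun p : ℝ × Space => eulerian φ (lagrangianStress Shat φ φR) p.1 p.2 i j)
      (spaceTimeMotion φ '' (I ×ˢ refBody)) := by
  obtain ⟨at', aR, bt, bR, ha, hb, ha0, hb0, hab⟩ := h.exists_stress_deriv hyper hobj hiso
  have h1 := hb.contDiffOn_comp_norm hb0
  have h2 := (ha.sub hb).contDiffOn_mul_direction_mul h.uniqueDiffOn hab
    (fun t ht => by rw [ha0 t ht, hb0 t ht, sub_self]) i j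
  refine h.contDiffOn_eulerian (f := fun t X => lagrangianStress Shat φ φR t X i j) ?_
  simp only [lagrangianStress, axialMatrix_apply]
  exact (h1.mul contDiffOn_const).add h2

/-- The divergence of the Cauchy stress. -/
lemma divergence_stress (h : IsRadialFlow I φ φt φR φtt φtR φRR)
    (hyper : IsHyperelastic ρbar W Shat) (hobj : IsObjective W) (hiso : IsIsotropic W)
    {t : ℝ} {X : Space} (ht : t ∈ I) (hX : X ∈ refBody) {aR' : ℝ}
    (haR : HasDerivWithinAt (fun R => axialCauchy Shat (stretchOf φ φR t R) (φR t R)) aR'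
      (Icc 0 1) ‖X‖) (i : Fin 3) :
    ∑ j, spaceDeriv (spaceTimeMotion φ '' (I ×ˢ refBody)) j
        (fun s w => eulerian φ (lagrangianStress Shat φ φR) s w i j) t (radialMotion φ t X)
      = (aR' / φR t ‖X‖ + 2 * (axialCauchy Shat (stretchOf φ φR t ‖X‖) (φR t ‖X‖)
          - transversalCauchy Shat (stretchOf φ φR t ‖X‖) (φR t ‖X‖)) / φ t ‖X‖)
        * direction X i := by
  obtain ⟨at', aR, bt, bR, ha, hb, ha0, hb0, hab⟩ := h.exists_stress_deriv hyper hobj hiso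
  have hR := norm_mem_Icc hX
  have hk0 : ∀ t ∈ I, aR t 0 - bR t 0 = 0 := fun t ht => by rw [ha0 t ht, hb0 t ht, sub_self]
  have haR' : aR' = aR t ‖X‖ :=
    (uniqueDiffOn_Icc zero_lt_one _ hR).eq_deriv _ haR (ha.hasDerivWithinAt_radial ht hR)
  have h1 := hb.hasFDerivWithinAt_comp_norm ht hX (.inr (hb0 t ht))
  have h2 := fun j => (ha.sub hb).hasFDerivWithinAt_mul_direction_mul h.uniqueDiffOn hab hk0 i j
    ht hX
  have hu := h.uniqueDiffOn_image _ (mem_image_motion (φ := φ) ht hX)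
  set e := direction X
  set q := radialQuotient (fun t R => axialCauchy Shat (stretchOf φ φR t R) (φR t R)
    - transversalCauchy Shat (stretchOf φ φR t R) (φR t R)) (fun t => aR t 0 - bR t 0) t ‖X‖
    with hq
  set M := axialCLM (φR t ‖X‖)⁻¹ (stretchOf φ φR t ‖X‖)⁻¹ e with hM
  have h3 : ∀ j, spaceDeriv (spaceTimeMotion φ '' (I ×ˢ refBody)) j
      (fun s w => eulerian φ (lagrangianStress Shat φ φR) s w i j) t (radialMotion φ t X)
      = bR t ‖X‖ * (1 : Mat) i j * inner ℝ e (M (stdVec j))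
        + ((aR t ‖X‖ - bR t ‖X‖ - 2 * q) * (e i * e j * inner ℝ e (M (stdVec j)))
          + q * (e j * M (stdVec j) i + e i * M (stdVec j) j)) := by
    intro j
    have h4 := (h1.mul_const ((1 : Mat) i j)).add (h2 j)
    have h5 : HasFDerivWithinAt (fun p : ℝ × Space => lagrangianStress Shat φ φR p.1 p.2 i j)
        (spaceTimeCLM ((1 : Mat) i j * bt t ‖X‖ + (at' t ‖X‖ - bt t ‖X‖) * (e i * e j))
          ((1 : Mat) i j • bR t ‖X‖ • innerSL ℝ e +
            ((aR t ‖X‖ - bR t ‖X‖ - 2 * q) • (e i * e j) • innerSL ℝ e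
            + q • (e j • EuclideanSpace.proj i + e i • EuclideanSpace.proj j))))
        (I ×ˢ refBody) (t, X) := by
      simp only [lagrangianStress, axialMatrix_apply]
      refine h4.congr_fderiv (ContinuousLinearMap.ext fun v => ?_)
      simp
      ring
    have h6 := h.hasFDerivWithinAt_eulerian ht hX
      (f := fun s X => lagrangianStress Shat φ φR s X i j) h5
    rw [spaceDeriv]
    refine (congrArg (fun D => D (0, stdVec j)) (h6.fderivWithin hu)).trans ?_
    simp
    ring
  simp only [h3]
  by_cases hX0 : X = 0
  -- At the centre every term carries a factor from `direction 0 = 0`.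
  · have he : e = 0 := by simp only [e, hX0, direction_zero]
    simp [he]
  -- Here A = 1/φ_R and B = 1/Λ. The hoop term 2qB becomes 2(a - b)/φ, since q = (a - b)/R and φ =
  -- ΛR.
  · rw [sum_tensor_deriv (norm_direction hX0), hq,
      radialQuotient_of_ne _ _ (norm_ne_zero_iff.2 hX0), haR', ← h.stretch_mul ht (R := ‖X‖)]
    have := (h.stretch_pos ht hR).ne'
    have := (h.radial_pos t ht _ hR).ne'
    have := norm_ne_zero_iff.2 hX0
    field_simp
    ring

/-- A unit vector that is normal to a ball at a boundary point is radial. -/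
lemma _root_.SelfGravElastic.eq_of_isOutwardUnitNormal_closedBall {a : ℝ} (ha : 0 < a)
    {z n : Space} (hz : ‖z‖ = a) (hn : IsOutwardUnitNormal (Metric.closedBall 0 a) z n) :
    n = a⁻¹ • z := by
  have h1 : a • n ∈ Metric.closedBall (0 : Space) a := by
    rw [mem_closedBall_zero_iff, norm_smul, hn.1, mul_one, Real.norm_eq_abs, abs_of_pos ha]
  have h2 : a • n - z ∈ posTangentConeAt (Metric.closedBall (0 : Space) a) z :=
    -- Testing the normal against the direction from z to the boundary point a n yields ⟨n, z⟩ ≥ a =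
    -- |n||z|. Equality in Cauchy–Schwarz then makes n parallel to z.
    sub_mem_posTangentConeAt_of_segment_subset ((convex_closedBall 0 a).segment_subset
      (mem_closedBall_zero_iff.2 hz.le) h1)
  have h3 := hn.2 _ h2
  rw [inner_sub_right, inner_smul_right, real_inner_self_eq_norm_sq, hn.1] at h3
  have h4 : ‖n‖ * ‖z‖ ≤ inner ℝ n z := by
    rw [hn.1, hz]
    linarith
  have h5 := (inner_eq_norm_mul_iff_real).1 (le_antisymm (real_inner_le_norm n z) h4)
  rw [hn.1, hz, one_smul] at h5
  rw [← h5, smul_smul, inv_mul_cancel₀ ha.ne', one_smul]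

end IsRadialFlow

/-! ### From the radial equation to the Eulerian system. -/

namespace IsRadialFlow

variable {I : Set ℝ} {φ φt φR φtt φtR φRR : ℝ → ℝ → ℝ} {G ρbar : ℝ}
  {W : Mat → ℝ} {Shat : Mat → Mat}

lemma radialDeriv_eq (h : IsRadialFlow I φ φt φR φtt φtR φRR) {t R : ℝ} (ht : t ∈ I)
    (hR : R ∈ Icc (0 : ℝ) 1) : radialDeriv φ t R = φR t R :=
  h.self.derivWithin_radial ht hR

lemma stretchRatio_eq (h : IsRadialFlow I φ φt φR φtt φtR φRR) {t R : ℝ} (ht : t ∈ I)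
    (hR : R ∈ Icc (0 : ℝ) 1) : stretchRatio φ t R = φR t R / stretchOf φ φR t R := by
  rw [stretchRatio, h.radialDeriv_eq ht hR, stretch, stretchOf, radialQuotient,
    h.radialDeriv_eq ht ⟨le_rfl, zero_le_one⟩]

lemma accel_eq (h : IsRadialFlow I φ φt φR φtt φtR φRR) {t R : ℝ} (ht : t ∈ I)
    (hR : R ∈ Icc (0 : ℝ) 1) : accel I φ t R = φtt t R := by
  rw [accel, derivWithin_congr
    (fun s hs => h.self.derivWithin_time h.uniqueDiffOn hs hR)
    (h.self.derivWithin_time h.uniqueDiffOn ht hR)]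
  exact h.time.derivWithin_time h.uniqueDiffOn ht hR

/-- The radial equation of motion as a balance of momentum. -/
lemma momentum_radial (h : IsRadialFlow I φ φt φR φtt φtR φRR) (hρ : 0 < ρbar)
    (hyper : IsHyperelastic ρbar W Shat) (hobj : IsObjective W) (hiso : IsIsotropic W)
    (hhom : IsHomogeneousOfDegree (-1) W) {ω : Space} (hω : ‖ω‖ = 1)
    (hsys : SolvesRadialSystem G ρbar (energyProfile ρbar W ω) I φ)
    {t R aR : ℝ} (ht : t ∈ I) (hR : R ∈ Ioc (0 : ℝ) 1)
    (haR : HasDerivWithinAt (fun R => axialCauchy Shat (stretchOf φ φR t R) (φR t R)) aR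
      (Icc 0 1) R) :
    lagrangianDensity ρbar φ φR t R * φtt t R
      = aR / φR t R + 2 * (axialCauchy Shat (stretchOf φ φR t R) (φR t R)
          - transversalCauchy Shat (stretchOf φ φR t R) (φR t R)) / φ t R
        - G * lagrangianDensity ρbar φ φR t R *
          (4 * Real.pi / 3 * ρbar * (stretchOf φ φR t R ^ 3)⁻¹ * φ t R) := by
  have hR' := Ioc_subset_Icc_self hR
  have hR0 : 0 < R := hR.1
  have hφ := h.pos ht hR
  have hφR := h.radial_pos t ht R hR'
  have heq := hsys.equation t ht R hR
  set g := energyProfile ρbar W ω with hg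
  -- Working with s turns the fractional powers of ρbar into integer powers, which makes the final
  -- identity rational.
  set s := ρbar ^ (1 / 3 : ℝ) with hs
  have hs0 : 0 < s := Real.rpow_pos_of_pos hρ _
  have hs3 : ρbar = s ^ 3 := by
    rw [hs, ← Real.rpow_natCast, ← Real.rpow_mul hρ.le]
    norm_num
  have hs4 : ρbar ^ (4 / 3 : ℝ) = s ^ 4 := by
    rw [hs, ← Real.rpow_natCast, ← Real.rpow_mul hρ.le]
    norm_num
  have hΛ : ∀ r ∈ Ioc (0 : ℝ) 1, stretchOf φ φR t r = φ t r / r := fun r hr =>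
    radialQuotient_of_ne _ _ hr.1.ne'
  have hax : ∀ r ∈ Ioc (0 : ℝ) 1, axialCauchy Shat (stretchOf φ φR t r) (φR t r)
      = ((φ t r / r) ^ 4)⁻¹ * (s ^ 4 * deriv g (stretchRatio φ t r)) := fun r hr => by
    have hr' := Ioc_subset_Icc_self hr
    have hy : 0 < φR t r / stretchOf φ φR t r :=
      div_pos (h.radial_pos t ht r hr') (h.stretch_pos ht hr')
    rw [axialCauchy, axialStress_eq hρ hyper hobj hiso hω hy, h.stretchRatio_eq ht hr', hΛ r hr, hs4]
  -- For r > 0 the function differentiated in the radial equation is s⁻⁴ φ³ a, with a the axial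
  -- Cauchy stress. Its derivative therefore follows from that of a, although g' is not assumed
  -- differentiable.
  have hQ : HasDerivWithinAt (fun r => r ^ 4 / φ t r * deriv g (stretchRatio φ t r))
      ((s ^ 4)⁻¹ * (3 * φ t R ^ 2 * φR t R * axialCauchy Shat (stretchOf φ φR t R) (φR t R)
        + φ t R ^ 3 * aR)) (Icc 0 1) R := by
    have h1 := ((((h.self.hasDerivWithinAt_radial ht hR').pow 3).mul haR).const_mul (s ^ 4)⁻¹)
    have h2 : ∀ r ∈ Ioc (0 : ℝ) 1, r ^ 4 / φ t r * deriv g (stretchRatio φ t r)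
        = (s ^ 4)⁻¹ * (φ t r ^ 3 * axialCauchy Shat (stretchOf φ φR t r) (φR t r)) := fun r hr => by
      have := hr.1.ne'
      have := (h.pos ht hr).ne'
      rw [hax r hr]
      field_simp
    refine (h1.congr_of_eventuallyEq ?_ (h2 R hR)).congr_deriv (by simp)
    filter_upwards [self_mem_nhdsWithin, mem_nhdsWithin_of_mem_nhds (Ioi_mem_nhds hR0)] with r hr hr'
    exact h2 r ⟨hr', hr.2⟩
  rw [hQ.derivWithin (uniqueDiffOn_Icc zero_lt_one R hR'), h.accel_eq ht hR'] at heq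
  have htr : transversalCauchy Shat (stretchOf φ φR t R) (φR t R)
      = ((φ t R / R) ^ 4)⁻¹ * (-(s ^ 4 * (g (stretchRatio φ t R) + stretchRatio φ t R *
        deriv g (stretchRatio φ t R))) / 2 / (φR t R / (φ t R / R))) := by
    have hy : 0 < φR t R / stretchOf φ φR t R :=
      div_pos hφR (h.stretch_pos ht hR')
    rw [transversalCauchy, transversalStress_eq hρ hyper hobj hiso hhom hω hy,
      h.stretchRatio_eq ht hR', hΛ R hR, hs4]
  have hy : stretchRatio φ t R = φR t R / (φ t R / R) := by rw [h.stretchRatio_eq ht hR', hΛ R hR]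
  have hax' := hax R hR
  set α := axialCauchy Shat (stretchOf φ φR t R) (φR t R)
  rw [lagrangianDensity, htr, hΛ R hR]
  generalize deriv g (stretchRatio φ t R) = g1 at *
  generalize g (stretchRatio φ t R) = g0 at *
  generalize stretchRatio φ t R = y at *
  have h3 : φtt t R = s * (1 / (R ^ 2 * φ t R) * ((s ^ 4)⁻¹ * (3 * φ t R ^ 2 * φR t R * α
      + φ t R ^ 3 * aR)) + R / φ t R ^ 2 * g0) - 4 * Real.pi / 3 * R ^ 3 * G * ρbar / φ t R ^ 2 := by
    linarith
  rw [h3, hax', hy, hs3]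
  field_simp
  ring

/-- A spherically symmetric solution of the Lagrangian equation of motion is a classical solution
of the Eulerian system. -/
theorem isClassicalSolution (h : IsRadialFlow I φ φt φR φtt φtR φRR) (hρ : 0 < ρbar)
    (hyper : IsHyperelastic ρbar W Shat) (hobj : IsObjective W) (hiso : IsIsotropic W)
    (hhom : IsHomogeneousOfDegree (-1) W) {ω : Space} (hω : ‖ω‖ = 1)
    (hφ : ContDiffOn ℝ 2 (fun p : ℝ × ℝ => φ p.1 p.2) (I ×ˢ Icc (0 : ℝ) 1))
    (hsys : SolvesRadialSystem G ρbar (energyProfile ρbar W ω) I φ) :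
    IsClassicalSolution G ρbar Shat I (radialDensity ρbar φ φR) (radialVelocity φ φt)
      (radialMotion φ) := by
  choose! Φ hΦ hΦ' using fun (t : ℝ) (ht : t ∈ I) => h.exists_gravitationalPotential hρ ht
  have htube := h.worldTube_radialDensity hρ
  have hbody := fun (t : ℝ) (ht : t ∈ I) => h.body_radialDensity hρ ht
  have hflow : IsFlowMap ρbar I (radialDensity ρbar φ φR) (radialVelocity φ φt)
      (radialMotion φ) := by
    refine ⟨fun t ht => ?_, fun t ht => ?_, fun t ht => ?_, fun t ht X hX => ?_, fun X hX => ?_,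
      fun t ht X hX => ?_, fun t ht X hX => ?_⟩
    · rw [hbody t ht]
      exact h.bijOn ht
    · have h1 := h.contDiffOn_spaceTimeMotion.comp
        (contDiff_const.prodMk contDiff_id : ContDiff ℝ 1 fun X : Space => (t, X)).contDiffOn
        fun X hX => ⟨ht, hX⟩
      exact (contDiff_snd (𝕜 := ℝ) (E := ℝ) (F := Space)).comp_contDiffOn h1
    · refine ⟨inverseMotion φ t, ?_, h.leftInvOn_inverseMotion ht⟩
      rw [hbody t ht]
      exact h.contDiffOn_eulerian_slice (f := fun _ X => X) contDiff_snd.contDiffOn ht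
    · rw [h.deformationGradient_eq ht hX]
      have hR := norm_mem_Icc hX
      have hΛ := h.stretch_pos ht hR
      have hφR := h.radial_pos t ht _ hR
      rcases norm_direction_or (φ := φ) (φR := φR) X t with he | he
      · rw [axialMatrix_det _ _ he]
        positivity
      · rw [he, axialMatrix_self, Matrix.det_smul]
        simp only [Matrix.det_one, mul_one]
        positivity
    · simp only [radialMotion_eq]
      have h0 : ContDiff ℝ 2 fun s : ℝ => (s, ‖X‖) := contDiff_id.prodMk contDiff_const
      have h1 : ContDiffOn ℝ 2 (fun s => φ s ‖X‖) I :=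
        hφ.comp h0.contDiffOn fun s hs => ⟨hs, norm_mem_Icc hX⟩
      exact h1.smul contDiffOn_const
    · rw [h.velocity_motion ht hX]
      simp only [radialMotion_eq]
      exact (h.self.hasDerivWithinAt_time ht (norm_mem_Icc hX)).smul_const _
    · rw [h.radialDensity_motion ht hX, h.deformationGradient_eq ht hX, lagrangianDensity]
      have hR := norm_mem_Icc hX
      have hΛ := (h.stretch_pos ht hR).ne'
      have hφR := (h.radial_pos t ht _ hR).ne'
      rcases norm_direction_or (φ := φ) (φR := φR) X t with he | he
      · rw [axialMatrix_det _ _ he]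
        field_simp
      · rw [he, axialMatrix_self, Matrix.det_smul]
        simp
        field_simp
  have hcover : ∀ t ∈ I, ∀ z ∈ body (radialDensity ρbar φ φR) t,
      ∃ X ∈ refBody, radialMotion φ t X = z := fun t ht z hz => by
    rw [hbody t ht] at hz
    exact (h.bijOn ht).surjOn hz
  refine ⟨eulerian φ (lagrangianStress Shat φ φR), Φ, ?_⟩
  refine
    { flow := hflow
      contDiffOn_density := by rw [htube]; exact h.contDiffOn_density
      contDiffOn_velocity := by rw [htube]; exact h.contDiffOn_velocity
      contDiffOn_stress := fun i j => by
        rw [htube]; exact h.contDiffOn_stress hyper hobj hiso i j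
      density_nonneg := fun t ht z => h.radialDensity_nonneg hρ ht z
      constitutive := fun t ht X hX => ?_
      continuity_equation := fun t ht z hz => ?_
      momentum_equation := fun t ht z hz i => ?_
      potential := hΦ
      boundary_condition := fun t ht z hz n hn i => ?_ }
  · rw [h.eulerian_motion _ ht hX]
    exact h.constitutive_law hyper hobj hiso hhom ht hX
  · obtain ⟨X, hX, rfl⟩ := hcover t ht z hz
    rw [htube]
    exact h.continuity ht hX
  · obtain ⟨X, hX, rfl⟩ := hcover t ht z hz
    obtain ⟨_, aR, _, _, ha, -⟩ := h.exists_stress_deriv hyper hobj hiso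
    have haR := ha.hasDerivWithinAt_radial ht (norm_mem_Icc hX)
    rw [htube, h.material_acceleration ht hX i, h.divergence_stress hyper hobj hiso ht hX haR i,
      h.radialDensity_motion ht hX, hΦ' t ht]
    have h1 : inner ℝ (radialMotion φ t X) (stdVec i) = φ t ‖X‖ * direction X i := by
      rw [stdVec, EuclideanSpace.inner_single_right, radialMotion_eq]
      simp
    rw [smul_apply, innerSL_apply_apply, h1, h.gravityCoeff_motion ht hX, smul_eq_mul]
    -- The radial equation is available only for R > 0. At the centre both sides are multiples of
    -- `direction 0 = 0`.
    by_cases hX0 : X = 0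
    · simp [hX0, direction_zero]
    · have h2 := h.momentum_radial hρ hyper hobj hiso hhom hω hsys ht
        ⟨norm_pos_iff.2 hX0, (norm_mem_Icc hX).2⟩ haR
      linear_combination direction X i * h2
  · have ha := h.radius_pos ht
    rw [hbody t ht] at hn hz
    rw [frontier_closedBall _ ha.ne', mem_sphere_zero_iff_norm] at hz
    have h1 := eq_of_isOutwardUnitNormal_closedBall ha hz hn
    obtain ⟨X, hX, rfl⟩ := (h.bijOn ht).surjOn (mem_closedBall_zero_iff.2 hz.le)
    rw [h.norm_motion ht hX] at hz
    have hX1 : ‖X‖ = 1 :=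
      (h.strictMonoOn ht).injOn (norm_mem_Icc hX) ⟨zero_le_one, le_rfl⟩ hz
    have hX0 : X ≠ 0 := by
      rintro rfl
      simp at hX1
    have h2 : n = direction X := by
      rw [h1, radialMotion_eq, hX1, smul_smul, inv_mul_cancel₀ ha.ne', one_smul]
    -- The traction on the sphere is a n with n radial, and a is a multiple of g'(y) at R = 1.
    have h3 : axialCauchy Shat (stretchOf φ φR t 1) (φR t 1) = 0 := by
      have h11 : (1 : ℝ) ∈ Icc (0 : ℝ) 1 := ⟨zero_le_one, le_rfl⟩
      have hy : 0 < φR t 1 / stretchOf φ φR t 1 :=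
        div_pos (h.radial_pos t ht 1 h11) (h.stretch_pos ht h11)
      rw [axialCauchy, axialStress_eq hρ hyper hobj hiso hω hy, ← h.stretchRatio_eq ht h11,
        hsys.boundary t ht, mul_zero, mul_zero]
    rw [h.eulerian_motion _ ht hX, h2]
    simp only [lagrangianStress]
    rw [sum_axialMatrix_mul (norm_direction hX0), hX1, h3, zero_mul]

end IsRadialFlow

end SelfGravElastic

theorem proposition1p1
    (G ρbar : ℝ) (hρbar : 0 < ρbar)
    (W : SelfGravElastic.Mat → ℝ) (Shat : SelfGravElastic.Mat → SelfGravElastic.Mat)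
    (hyper : SelfGravElastic.IsHyperelastic ρbar W Shat)
    (hobj : SelfGravElastic.IsObjective W)
    (hiso : SelfGravElastic.IsIsotropic W)
    (hhom : SelfGravElastic.IsHomogeneousOfDegree (-1) W)
    (ω : SelfGravElastic.Space) (hω : ‖ω‖ = 1)
    (T : EReal) (hT : 0 < T)
    (φ : ℝ → ℝ → ℝ)
    (hφ : ContDiffOn ℝ 2 (fun p : ℝ × ℝ => φ p.1 p.2)
      (SelfGravElastic.timeInterval T ×ˢ Set.Icc (0 : ℝ) 1))
    (hφ_zero : ∀ t ∈ SelfGravElastic.timeInterval T, φ t 0 = 0)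
    (hφ_RR : ∀ t ∈ SelfGravElastic.timeInterval T, SelfGravElastic.radialDeriv2 φ t 0 = 0)
    (hφ_R : ∀ t ∈ SelfGravElastic.timeInterval T, ∀ R ∈ Set.Icc (0 : ℝ) 1,
      0 < SelfGravElastic.radialDeriv φ t R)
    (hsys : SelfGravElastic.SolvesRadialSystem G ρbar
      (SelfGravElastic.energyProfile ρbar W ω) (SelfGravElastic.timeInterval T) φ) :
    ∃ (ρ : ℝ → SelfGravElastic.Space → ℝ)
      (u : ℝ → SelfGravElastic.Space → SelfGravElastic.Space),
      SelfGravElastic.IsClassicalSolution G ρbar Shat (SelfGravElastic.timeInterval T) ρ u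
        (SelfGravElastic.radialMotion φ) := by
  have hI := SelfGravElastic.uniqueDiffOn_timeInterval hT
  obtain ⟨φt, φR, φtt, φtR, φRR, h2⟩ := SelfGravElastic.exists_hasRadialFDeriv2
    (SelfGravElastic.convex_timeInterval T) (SelfGravElastic.interior_timeInterval_nonempty hT) hφ
  have hR : ∀ t ∈ SelfGravElastic.timeInterval T, ∀ R ∈ Set.Icc (0 : ℝ) 1,
      SelfGravElastic.radialDeriv φ t R = φR t R := fun t ht R hR =>
    h2.self.derivWithin_radial ht hR
  have h0 : (0 : ℝ) ∈ Set.Icc (0 : ℝ) 1 := ⟨le_rfl, zero_le_one⟩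
  have h : SelfGravElastic.IsRadialFlow (SelfGravElastic.timeInterval T) φ φt φR φtt φtR φRR :=
    { toHasRadialFDeriv2 := h2
      uniqueDiffOn := hI
      exists_compact := fun t ht => SelfGravElastic.exists_compact_nhdsWithin_timeInterval ht
      map_zero := hφ_zero
      radial2_zero := fun t ht => by
        have h1 := hφ_RR t ht
        rw [SelfGravElastic.radialDeriv2, derivWithin_congr (hR t ht) (hR t ht 0 h0)] at h1
        exact (h2.radial.derivWithin_radial ht h0).symm.trans h1
      radial_pos := fun t ht R hR' => by
        rw [← hR t ht R hR']
        exact hφ_R t ht R hR' }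
  exact ⟨_, _, h.isClassicalSolution hρbar hyper hobj hiso hhom hω hφ hsys⟩
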